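/- Let $0\le l<n$ be integers. Let $\mathfrak{gl}(1|1)$ have the basis $e_{ij}$ ($i,j\in\{1,2\}$, $|1|=\bar 0$, $|2|=\bar 1$, $e_{ij}$ of parity $|i|+|j|$), put $e_{ij}[r]=e_{ij}\otimes t^r\in\mathfrak{gl}(1|1)[t]$, with $$[e_{ij}[r],e_{ks}[q]]=\delta_{jk}e_{is}[r+q]-(-1)^{(|i|+|j|)(|k|+|s|)}\delta_{is}e_{kj}[r+q],$$ and $e_{ij}(x)=\sum_{r\ge 0}e_{ij}[r]x^{-r-1}$. Put $$\mathscr H(x)=\tfrac12\sum_{a,b=1}^2(-1)^{|b|}e_{ab}(x)e_{ba}(x),\qquad \mathcal T(x)=\tfrac12\,\partial_x\big(e_{11}(x)+e_{22}(x)\big)+\tfrac12\big(e_{11}(x)+e_{22}(x)\big)^2-\mathscr H(x).$$ The Bethe algebra $\mathcal B$ is the unital subalgebra of $\mathrm U(\mathfrak{gl}(1|1)[t])$ generated by the coefficients of $e_{11}(x)+e_{22}(x)$ and of $2\mathscr H(x)$. Let $\mathbb C^{1|1}$ have the even basis vector $v_1$ and the odd basis vector $v_2$, and let $\mathcal V=(\mathbb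 C^{1|1})^{\otimes n}\otimes\mathbb C[z_1,\dots,z_n]$, graded by the degree in $\bm z=(z_1,\dots,z_n)$. The algebra $\mathfrak{gl}(1|1)[t]$ acts on $\mathcal V$ by $$e_{ij}[r](p\,w_1\otimes\cdots\otimes w_n)=p\sum_{s=1}^n(-1)^{(|w_1|+\cdots+|w_{s-1}|)(|i|+|j|)}z_s^r\,w_1\otimes\cdots\otimes e_{ij}w_s\otimes\cdots\otimes w_n .$$ The symmetric group $\mathfrak S_n$ acts on $\mathcal V$, the simple transposition $s_i$ sending $\bm f(z_1,\dots,z_n)$ to $P^{(i,i+1)}\bm f(\dots,z_{i+1},z_i,\dots)$, where $P^{(i,i+1)}$ is the graded flip of the factors $i$ and $i+1$. Let $\mathcal V^{\mathfrak S}$ be the space of invariants and $$\mathcal M_l=(\mathcal V^{\mathfrak S})^{\rm sing}_{(n-l,l)}=\{v\in\mathcal V^{\mathfrak S}: e_{12}[0]v=0,\ e_{11}[0]v=(n-l)v,\ e_{22}[0]v=lv\}.$$ The Bethe algebra preserves $\mathcal M_l$; let $\mathcal B_l$ be its image in $\mathrm{End}(\mathcal M_l)$, graded by the degree of endomorphisms,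 and write $X(\bm z)$ for the operator on $\mathcal M_l$ given by $X$. There are central elements $C_1,\dots,C_n$ of $\mathrm U(\mathfrak{gl}(1|1)[t])$ such that $C_j$ acts on $\mathcal V^{\mathfrak S}$ as multiplication by the elementary symmetric polynomial $\sigma_j(\bm z)$. Fix any such elements and define $B_i$ by $$\Big(x^n+\sum_{j=1}^n(-1)^jC_jx^{n-j}\Big)\mathcal T(x)=x^n\sum_{i\ge 2}B_ix^{-i}.$$ Let $\mathcal O_l=\mathbb C[f_1,\dots,f_l,g_1,\dots,g_{n-l-1},\varSigma_n]$ with $\deg f_i=i$, $\deg g_j=j$, $\deg\varSigma_n=n$; put $f(x)=x^l+\sum_{i=1}^l f_ix^{l-i}$ and $g(x)=x^{n-l-1}+\sum_{j=1}^{n-l-1}g_jx^{n-l-1-j}$, and define $\varSigma_1,\dots,\varSigma_{n-1}$ and $G_1,\dots,G_{n-2}$ in $\mathcal O_l$ by $$nf(x)g(x)=nx^{n-1}+\sum_{i=1}^{n-1}(-1)^i(n-i)\varSigma_ix^{n-1-i},\qquad nf'(x)g(x)=nl\,x^{n-2}+\sum_{i=1}^{n-2}G_ix^{n-2-i}.$$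 The algebra $\mathbb C[\bm z]^{\mathfrak S}$ acts on $\mathcal O_l$ through the homomorphism $\sigma_j(\bm z)\mapsto\varSigma_j$, $1\le j\le n$, and on $\mathcal B_l$ by multiplication of operators by symmetric polynomials. Let $\mathfrak u_l=e_{12}[0]e_{21}[0]e_{21}[1]\cdots e_{21}[l]\,v_1^{\otimes n}$, which lies in $\mathcal M_l$. 1. The assignment $G_i\mapsto B_{i+2}(\bm z)$ ($1\le i\le n-2$), $\varSigma_j\mapsto C_j(\bm z)$ ($1\le j\le n$) extends uniquely to an algebra homomorphism $\eta_l:\mathcal O_l\to\mathcal B_l$. It is an isomorphism of graded algebras and of $\mathbb C[\bm z]^{\mathfrak S}$-modules. 2. The map $\rho_l:\mathcal O_l\to\mathcal M_l$, $F\mapsto\eta_l(F)\mathfrak u_l$, is an isomorphism of vector spaces that maps the component of degree $d$ of $\mathcal O_l$ onto the component of degree $d+l(l+1)/2$ of $\mathcal M_l$ for every $d\ge 0$, and $\rho_l(FH)=\eta_l(F)\rho_l(H)$ for all $F,H\in\mathcal O_l$; so it identifies the $\mathcal B_l$-module $\mathcal M_l$ with the regular representation of $\mathcal O_l$. -/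

import Mathlib

open scoped BigOperators

noncomputable section

namespace Gaudin

/-! Indices `1, 2` of `gl(1|1)` are the elements `0, 1` of `Fin 2`; the parity `|i|` is the value
of `i : Fin 2`. -/

/-! ### The universal enveloping superalgebra of `gl(1|1)[t]` -/

/-- The supercommutator relations of `gl(1|1)[t]`, the letter `(i, j, r)` standing for
`e_{ij}[r] = e_{ij} ⊗ t ^ r`. -/
inductive CurrentRel :
    FreeAlgebra ℂ (Fin 2 × Fin 2 × ℕ) → FreeAlgebra ℂ (Fin 2 × Fin 2 × ℕ) → Prop
  | supercomm (i j k l : Fin 2) (r s : ℕ) : CurrentRel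
      (FreeAlgebra.ι ℂ (i, j, r) * FreeAlgebra.ι ℂ (k, l, s)
        - (-1 : ℂ) ^ (((i : ℕ) + j) * ((k : ℕ) + l)) •
          (FreeAlgebra.ι ℂ (k, l, s) * FreeAlgebra.ι ℂ (i, j, r)))
      ((if j = k then FreeAlgebra.ι ℂ (i, l, r + s) else 0)
        - (-1 : ℂ) ^ (((i : ℕ) + j) * ((k : ℕ) + l)) •
          (if i = l then FreeAlgebra.ι ℂ (k, j, r + s) else 0))

/-- `U(gl(1|1)[t])`, by generators `e_{ij}[r]` and relations. -/
abbrev CurrentU : Type := RingQuot CurrentRel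

/-- The generator `e_{ij}[r]`. -/
def e (i j : Fin 2) (r : ℕ) : CurrentU :=
  RingQuot.mkAlgHom ℂ CurrentRel (FreeAlgebra.ι ℂ (i, j, r))

/-! ### Generating series: power series in `X = x⁻¹` with coefficients in `U(gl(1|1)[t])` -/

/-- `e_{ij}(x) = ∑_{r ≥ 0} e_{ij}[r] x^{-r-1}`. -/
def eSer (i j : Fin 2) : PowerSeries CurrentU :=
  PowerSeries.mk fun m => match m with
    | 0 => 0
    | r + 1 => e i j r

/-- The derivation `∂_x`, with `∂_x x^{-m} = -m x^{-m-1}`. -/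
def dx (a : PowerSeries CurrentU) : PowerSeries CurrentU :=
  PowerSeries.mk fun m => match m with
    | 0 => 0
    | k + 1 => -((k : ℂ) • PowerSeries.coeff k a)

/-- `𝓗(x) = (1/2) ∑_{a,b} e_{ab}(x) e_{ba}(x) (-1)^{|b|}`. -/
def hamSer : PowerSeries CurrentU :=
  (1 / 2 : ℂ) • ∑ a : Fin 2, ∑ b : Fin 2, (-1 : ℂ) ^ (b : ℕ) • (eSer a b * eSer b a)

/-- `𝓣(x) = (1/2)(e₁₁(x) + e₂₂(x))' + (1/2)(e₁₁(x) + e₂₂(x))² - 𝓗(x)`. -/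
def transferSer : PowerSeries CurrentU :=
  (1 / 2 : ℂ) • (dx (eSer 0 0) + dx (eSer 1 1))
    + (1 / 2 : ℂ) • (eSer 0 0 + eSer 1 1) ^ 2 - hamSer

/-- The Bethe algebra: the unital subalgebra of `U(gl(1|1)[t])` generated by the coefficients of
`e₁₁(x) + e₂₂(x)` and `2 𝓗(x)`. -/
def bethe : Subalgebra ℂ CurrentU :=
  Algebra.adjoin ℂ
    (Set.range (fun m : ℕ => PowerSeries.coeff m (eSer 0 0 + eSer 1 1)) ∪
      Set.range (fun m : ℕ => PowerSeries.coeff m ((2 : ℂ) • hamSer)))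

/-! ### The module `𝒱 = (ℂ^{1|1})^{⊗ n} ⊗ ℂ[z₁, …, z_n]` -/

/-- `𝒱`, the free `ℂ[z₁, …, z_n]`-module on the basis `v_I = v_{I 1} ⊗ ⋯ ⊗ v_{I n}` of
`(ℂ^{1|1})^{⊗ n}`, an element being given by its coordinates. -/
abbrev VPoly (n : ℕ) : Type := (Fin n → Fin 2) → MvPolynomial (Fin n) ℂ

/-- The operator `e_{ij}` in the `s`-th tensor factor, with the Koszul sign. -/
def siteOp (n : ℕ) (i j : Fin 2) (s : Fin n) : VPoly n →ₗ[MvPolynomial (Fin n) ℂ] VPoly n where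
  toFun F J :=
    if J s = i then
      (-1) ^ ((∑ k ∈ Finset.Iio s, (J k : ℕ)) * ((i : ℕ) + j)) * F (Function.update J s j)
    else 0
  map_add' F G := by
    funext J
    by_cases h : J s = i <;> simp [h, mul_add]
  map_smul' c F := by
    funext J
    by_cases h : J s = i <;> simp [h, mul_left_comm]

/-- The operator by which `e_{ij}[r]` acts on `𝒱`, as a `ℂ[z₁, …, z_n]`-linear map. -/
def polyOp (n : ℕ) (i j : Fin 2) (r : ℕ) : Module.End (MvPolynomial (Fin n) ℂ) (VPoly n) :=
  ∑ s : Fin n, (MvPolynomial.X s : MvPolynomial (Fin n) ℂ) ^ r • siteOp n i j s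

/-- The operator by which `e_{ij}[r]` acts on `𝒱`. -/
def currentOp (n : ℕ) (i j : Fin 2) (r : ℕ) : Module.End ℂ (VPoly n) :=
  (polyOp n i j r).restrictScalars ℂ

/-- `e_{ij}[r] (p v_I) = ∑_s (-1)^{(|I₁| + ⋯ + |I_{s-1}|)(|i| + |j|)} z_s^r p ⋯ ⊗ e_{ij} v_{I_s} ⊗ ⋯`. -/
theorem currentOp_single (n : ℕ) (i j : Fin 2) (r : ℕ) (I : Fin n → Fin 2)
    (p : MvPolynomial (Fin n) ℂ) :
    currentOp n i j r (Pi.single I p) =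
      ∑ s : Fin n, if I s = j then
        Pi.single (Function.update I s i)
          ((-1) ^ ((∑ k ∈ Finset.Iio s, (I k : ℕ)) * ((i : ℕ) + j)) * MvPolynomial.X s ^ r * p)
      else 0 := by
  simp only [currentOp, polyOp, LinearMap.sum_apply, LinearMap.restrictScalars_apply, LinearMap.smul_apply]
  refine Finset.sum_congr rfl fun s _ => ?_
  funext J
  simp only [siteOp, Pi.smul_apply, smul_eq_mul, LinearMap.coe_mk, AddHom.coe_mk]
  by_cases h : J = Function.update I s i ∧ I s = j
  · obtain ⟨rfl, rfl⟩ := h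
    have hs : ∀ k ∈ Finset.Iio s, (Function.update I s i k : ℕ) = I k := by
      intro k hk
      rw [Function.update_of_ne (Finset.mem_Iio.1 hk).ne]
    simp only [Function.update_self, if_true, Function.update_idem, Function.update_eq_self,
      Pi.single_eq_same]
    rw [Finset.sum_congr rfl hs]
    ring
  · have hR : (if I s = j then (Pi.single (Function.update I s i)
          ((-1) ^ ((∑ k ∈ Finset.Iio s, (I k : ℕ)) * ((i : ℕ) + j)) * MvPolynomial.X s ^ r * p) :
            VPoly n) else 0) J = 0 := by
      by_cases hI : I s = j
      · rw [if_pos hI, Pi.single_eq_of_ne]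
        exact fun hJ => h ⟨hJ, hI⟩
      · rw [if_neg hI]; rfl
    rw [hR]
    by_cases hJ : J s = i
    · rw [if_pos hJ, Pi.single_eq_of_ne, mul_zero, mul_zero]
      rintro rfl
      refine h ⟨?_, by simp⟩
      rw [Function.update_idem, ← hJ, Function.update_eq_self]
    · rw [if_neg hJ, mul_zero]

theorem siteOp_mul_self (n : ℕ) (i j k l : Fin 2) (s : Fin n) :
    siteOp n i j s * siteOp n k l s = if j = k then siteOp n i l s else 0 := by
  refine LinearMap.ext fun F => funext fun J => ?_
  have hs : ∀ m ∈ Finset.Iio s, (Function.update J s j m : ℕ) = J m := by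
    intro m hm
    rw [Function.update_of_ne (Finset.mem_Iio.1 hm).ne]
  by_cases hjk : j = k
  · subst hjk
    by_cases hJ : J s = i
    · simp only [siteOp, Module.End.mul_apply, LinearMap.coe_mk, AddHom.coe_mk, hJ, if_true,
        Function.update_self, Function.update_idem]
      rw [Finset.sum_congr rfl hs, ← mul_assoc, ← pow_add, ← mul_add]
      congr 1
      have : (i : ℕ) + j + (j + l) = (i + l) + 2 * j := by ring
      rw [this, mul_add, pow_add, mul_left_comm, pow_mul (-1) 2]
      simp
    · simp [siteOp, hJ]
  · simp [siteOp, hjk]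

theorem siteOp_mul_of_lt (n : ℕ) (i j k l : Fin 2) {s t : Fin n} (h : s < t) :
    siteOp n i j s * siteOp n k l t =
      (-1 : MvPolynomial (Fin n) ℂ) ^ (((i : ℕ) + j) * ((k : ℕ) + l)) •
        (siteOp n k l t * siteOp n i j s) := by
  refine LinearMap.ext fun F => funext fun J => ?_
  simp only [siteOp, Module.End.mul_apply, LinearMap.coe_mk, AddHom.coe_mk,
    LinearMap.smul_apply, Pi.smul_apply, smul_eq_mul, Function.update_of_ne h.ne,
    Function.update_of_ne h.ne']
  by_cases hs : J s = i
  · by_cases ht : J t = k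
    · have hsum1 : ∑ m ∈ Finset.Iio s, (Function.update J t l m : ℕ)
          = ∑ m ∈ Finset.Iio s, (J m : ℕ) := by
        refine Finset.sum_congr rfl fun m hm => ?_
        rw [Function.update_of_ne ((Finset.mem_Iio.1 hm).trans h).ne]
      have hmem : s ∈ Finset.Iio t := Finset.mem_Iio.2 h
      have hsum2 : (∑ m ∈ Finset.Iio t, (Function.update J s j m : ℕ)) + i
          = (∑ m ∈ Finset.Iio t, (J m : ℕ)) + j := by
        rw [← Finset.add_sum_erase _ _ hmem, ← Finset.add_sum_erase _ (fun m => (J m : ℕ)) hmem]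
        rw [Finset.sum_congr rfl (g := fun m => (J m : ℕ))]
        · simp only [Function.update_self, hs]; ring
        · intro m hm
          rw [Function.update_of_ne (Finset.ne_of_mem_erase hm)]
      simp only [hs, ht, if_true, hsum1, Function.update_comm h.ne]
      have key : (-1 : MvPolynomial (Fin n) ℂ) ^
            ((∑ m ∈ Finset.Iio t, (Function.update J s j m : ℕ)) * ((k : ℕ) + l)) =
          (-1) ^ (((i : ℕ) + j) * ((k : ℕ) + l)) *
            (-1) ^ ((∑ m ∈ Finset.Iio t, (J m : ℕ)) * ((k : ℕ) + l)) := by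
        have h1 : (-1 : MvPolynomial (Fin n) ℂ) ^
            (∑ m ∈ Finset.Iio t, (Function.update J s j m : ℕ)) =
            (-1) ^ ((i : ℕ) + j) * (-1) ^ (∑ m ∈ Finset.Iio t, (J m : ℕ)) := by
          have h2 : (-1 : MvPolynomial (Fin n) ℂ) ^ (i : ℕ) * (-1) ^ (i : ℕ) = 1 := by
            rw [← pow_add, ← two_mul, pow_mul]; simp
          have h3 := congrArg (fun m => (-1 : MvPolynomial (Fin n) ℂ) ^ m) hsum2
          simp only [pow_add] at h3
          calc _ = (-1 : MvPolynomial (Fin n) ℂ) ^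
                (∑ m ∈ Finset.Iio t, (Function.update J s j m : ℕ)) *
                ((-1) ^ (i : ℕ) * (-1) ^ (i : ℕ)) := by rw [h2, mul_one]
            _ = _ := by rw [← mul_assoc, h3, pow_add]; ring
        rw [pow_mul, h1, mul_pow, ← pow_mul, ← pow_mul]
      rw [key]
      ring
    · simp [ht]
  · simp [hs]

theorem siteOp_mul_of_ne (n : ℕ) (i j k l : Fin 2) {s t : Fin n} (h : s ≠ t) :
    siteOp n i j s * siteOp n k l t =
      (-1 : MvPolynomial (Fin n) ℂ) ^ (((i : ℕ) + j) * ((k : ℕ) + l)) •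
        (siteOp n k l t * siteOp n i j s) := by
  rcases lt_or_gt_of_ne h with h | h
  · exact siteOp_mul_of_lt n i j k l h
  · rw [siteOp_mul_of_lt n k l i j h, smul_smul, mul_comm ((k : ℕ) + l), ← mul_pow]
    simp

theorem polyOp_mul (n : ℕ) (i j k l : Fin 2) (r u : ℕ) :
    polyOp n i j r * polyOp n k l u =
      ∑ s : Fin n, ∑ t : Fin n, ((MvPolynomial.X s : MvPolynomial (Fin n) ℂ) ^ r *
        MvPolynomial.X t ^ u) • (siteOp n i j s * siteOp n k l t) := by
  simp only [polyOp, Finset.sum_mul_sum, smul_mul_smul_comm]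

theorem polyOp_supercomm (n : ℕ) (i j k l : Fin 2) (r u : ℕ) :
    polyOp n i j r * polyOp n k l u
        - (-1 : MvPolynomial (Fin n) ℂ) ^ (((i : ℕ) + j) * ((k : ℕ) + l)) •
          (polyOp n k l u * polyOp n i j r) =
      (if j = k then polyOp n i l (r + u) else 0)
        - (-1 : MvPolynomial (Fin n) ℂ) ^ (((i : ℕ) + j) * ((k : ℕ) + l)) •
          (if i = l then polyOp n k j (r + u) else 0) := by
  have hd : ∀ (a b c d : Fin 2), (if b = c then polyOp n a d (r + u) else 0) =
      ∑ s : Fin n, (MvPolynomial.X s : MvPolynomial (Fin n) ℂ) ^ (r + u) •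
        (siteOp n a b s * siteOp n c d s) := by
    intro a b c d
    simp only [siteOp_mul_self]
    split_ifs
    · rfl
    · simp
  rw [hd i j k l]
  have hd' : (if i = l then polyOp n k j (r + u) else 0) =
      ∑ s : Fin n, (MvPolynomial.X s : MvPolynomial (Fin n) ℂ) ^ (r + u) •
        (siteOp n k l s * siteOp n i j s) := by
    rw [← hd k l i j]
    simp only [eq_comm]
  rw [hd', polyOp_mul, polyOp_mul,
    Finset.sum_comm (f := fun s t => ((MvPolynomial.X s : MvPolynomial (Fin n) ℂ) ^ u *
        MvPolynomial.X t ^ r) • (siteOp n k l s * siteOp n i j t)),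
    Finset.smul_sum, Finset.smul_sum, ← Finset.sum_sub_distrib, ← Finset.sum_sub_distrib]
  refine Finset.sum_congr rfl fun s _ => ?_
  rw [Finset.smul_sum, ← Finset.sum_sub_distrib, Finset.sum_eq_single s]
  · rw [pow_add, mul_comm (MvPolynomial.X s ^ u)]
  · intro t _ hts
    rw [siteOp_mul_of_ne n i j k l hts.symm, smul_comm, mul_comm (MvPolynomial.X t ^ u), sub_self]
  · simp

/-- The supercommutator relations hold for the operators on `𝒱`. -/
theorem currentOp_supercomm (n : ℕ) (i j k l : Fin 2) (r s : ℕ) :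
    currentOp n i j r * currentOp n k l s
        - (-1 : ℂ) ^ (((i : ℕ) + j) * ((k : ℕ) + l)) • (currentOp n k l s * currentOp n i j r) =
      (if j = k then currentOp n i l (r + s) else 0)
        - (-1 : ℂ) ^ (((i : ℕ) + j) * ((k : ℕ) + l)) •
          (if i = l then currentOp n k j (r + s) else 0) := by
  refine LinearMap.ext fun F => ?_
  have h := congrArg (fun A => A F) (polyOp_supercomm n i j k l r s)
  have hr : ∀ (P : Prop) [Decidable P] (a b : Fin 2),
      (if P then currentOp n a b (r + s) else 0) F = (if P then polyOp n a b (r + s) else 0) F := by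
    intro P _ a b
    split_ifs <;> rfl
  simp only [LinearMap.sub_apply, LinearMap.smul_apply, Module.End.mul_apply, hr] at h ⊢
  rcases Nat.even_or_odd (((i : ℕ) + j) * ((k : ℕ) + l)) with hp | hp <;>
  · simp only [hp.neg_one_pow, one_smul, neg_smul] at h ⊢
    exact h

/-- The action of `U(gl(1|1)[t])` on `𝒱`. -/
def act (n : ℕ) : CurrentU →ₐ[ℂ] Module.End ℂ (VPoly n) :=
  RingQuot.liftAlgHom ℂ ⟨FreeAlgebra.lift ℂ fun x => currentOp n x.1 x.2.1 x.2.2, by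
    rintro _ _ ⟨i, j, k, l, r, s⟩
    have h := currentOp_supercomm n i j k l r s
    simp only [map_sub, map_mul, map_smul, FreeAlgebra.lift_ι_apply, apply_ite
      (FreeAlgebra.lift ℂ fun x : Fin 2 × Fin 2 × ℕ => currentOp n x.1 x.2.1 x.2.2), map_zero]
    exact h⟩

theorem act_e (n : ℕ) (i j : Fin 2) (r : ℕ) : act n (e i j r) = currentOp n i j r := by
  simp [act, e]

/-- `v⁺ = v₁ ⊗ ⋯ ⊗ v₁`. -/
def vplus (n : ℕ) : VPoly n := Pi.single (fun _ => 0) 1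

/-- The simple transposition exchanging the positions `a` and `b = a + 1`, acting on `𝒱` by
`f(z) ↦ P^{(a,b)} f(…, z_b, z_a, …)` with the graded flip `P^{(a,b)}`, which sends `v_I` to
`(-1)^{|I a||I b|} v_{I ∘ (a b)}`. -/
def flipOp (n : ℕ) (a b : Fin n) (F : VPoly n) : VPoly n := fun J =>
  (-1) ^ ((J a : ℕ) * J b) *
    MvPolynomial.rename (Equiv.swap a b) (F (J ∘ Equiv.swap a b))

/-- `𝒱^𝔖`, the vectors fixed by the symmetric group, that is, by its simple transpositions. -/
def VSym (n : ℕ) : Submodule ℂ (VPoly n) where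
  carrier := {F | ∀ a b : Fin n, (b : ℕ) = a + 1 → flipOp n a b F = F}
  add_mem' {F G} hF hG a b h := by
    conv_rhs => rw [← hF a b h, ← hG a b h]
    funext J
    simp [flipOp, mul_add]
  zero_mem' a b _ := by
    funext J
    simp [flipOp]
  smul_mem' c F hF a b h := by
    conv_rhs => rw [← hF a b h]
    funext J
    simp [flipOp]

/-- `𝓜_l = (𝒱^𝔖)^{sing}_{(n-l,l)}`: the vectors of `𝒱^𝔖` killed by `e₁₂` and of weight
`(n - l, l)`. -/
def M (n l : ℕ) : Submodule ℂ (VPoly n) where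
  carrier := {F | F ∈ VSym n ∧ act n (e 0 1 0) F = 0 ∧
    act n (e 0 0 0) F = ((n : ℂ) - l) • F ∧ act n (e 1 1 0) F = (l : ℂ) • F}
  add_mem' {F G} hF hG := by
    refine ⟨add_mem hF.1 hG.1, ?_, ?_, ?_⟩
    · rw [map_add, hF.2.1, hG.2.1, add_zero]
    · rw [map_add, hF.2.2.1, hG.2.2.1, smul_add]
    · rw [map_add, hF.2.2.2, hG.2.2.2, smul_add]
  zero_mem' := ⟨zero_mem _, by simp, by simp, by simp⟩
  smul_mem' c F hF := by
    refine ⟨Submodule.smul_mem _ c hF.1, ?_, ?_, ?_⟩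
    · rw [map_smul, hF.2.1, smul_zero]
    · rw [map_smul, hF.2.2.1, smul_comm]
    · rw [map_smul, hF.2.2.2, smul_comm]

/-- `u_l = e₁₂[0] e₂₁[0] e₂₁[1] ⋯ e₂₁[l] v⁺`. -/
def uvec (n l : ℕ) : VPoly n :=
  act n (e 0 1 0 * ((List.range (l + 1)).map fun r => e 1 0 r).prod) (vplus n)

/-- The homogeneous component of degree `d` of `𝒱`, where `deg (v ⊗ p) = deg p`. -/
def VHom (n d : ℕ) : Submodule ℂ (VPoly n) where
  carrier := {F | ∀ J, (F J).IsHomogeneous d}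
  add_mem' hF hG J := (hF J).add (hG J)
  zero_mem' _ := MvPolynomial.isHomogeneous_zero _ _ _
  smul_mem' c F hF J := by
    have h := (MvPolynomial.homogeneousSubmodule (Fin n) ℂ d).smul_mem c (x := F J) (hF J)
    exact h

/-- An endomorphism of `𝓜_l` is of degree `d` if it raises degrees by `d`. -/
def EndHasDegree (n l d : ℕ) (φ : Module.End ℂ (M n l)) : Prop :=
  ∀ (m : ℕ) (v : M n l), (v : VPoly n) ∈ VHom n m → (φ v : VPoly n) ∈ VHom n (m + d)

/-- `𝓑_l`, the image of the Bethe algebra in `End(𝓜_l)`: the endomorphisms of `𝓜_l` that are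
given by the action of an element of the Bethe algebra. -/
def betheM (n l : ℕ) : Subalgebra ℂ (Module.End ℂ (M n l)) where
  carrier := {φ | ∃ b ∈ bethe, ∀ v : M n l, (φ v : VPoly n) = act n b v}
  mul_mem' := by
    rintro φ ψ ⟨b, hb, hφ⟩ ⟨c, hc, hψ⟩
    refine ⟨b * c, mul_mem hb hc, fun v => ?_⟩
    rw [Module.End.mul_apply, hφ, hψ, map_mul, Module.End.mul_apply]
  add_mem' := by
    rintro φ ψ ⟨b, hb, hφ⟩ ⟨c, hc, hψ⟩
    refine ⟨b + c, add_mem hb hc, fun v => ?_⟩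
    rw [LinearMap.add_apply, Submodule.coe_add, hφ, hψ, map_add, LinearMap.add_apply]
  algebraMap_mem' c := by
    refine ⟨algebraMap ℂ CurrentU c, Subalgebra.algebraMap_mem _ c, fun v => ?_⟩
    rw [AlgHom.commutes, Module.algebraMap_end_apply, Module.algebraMap_end_apply,
      Submodule.coe_smul]

/-! ### The elements `C_j` and `B_i` -/

/-- `C₁, …, C_n` are central elements of `U(gl(1|1)[t])` such that `C_j` acts on `𝒱^𝔖` by
multiplication by the elementary symmetric polynomial `σ_j(z₁, …, z_n)`. -/
def IsCentralLift (n : ℕ) (C : ℕ → CurrentU) : Prop :=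
  ∀ j, 1 ≤ j → j ≤ n → C j ∈ Subalgebra.center ℂ CurrentU ∧
    ∀ v ∈ VSym n, act n (C j) v = MvPolynomial.esymm (Fin n) ℂ j • v

/-- The series `x^{-n} (x^n + ∑_{j=1}^n (-1)^j C_j x^{n-j})`. -/
def centralSer (n : ℕ) (C : ℕ → CurrentU) : PowerSeries CurrentU :=
  1 + ∑ j ∈ Finset.Icc 1 n, PowerSeries.monomial j ((-1 : ℂ) ^ j • C j)

/-- The elements `B_i` with
`(x^n + ∑_{j=1}^n (-1)^j C_j x^{n-j}) 𝓣(x) = x^n ∑_i B_i x^{-i}`. -/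
def B (n : ℕ) (C : ℕ → CurrentU) (i : ℕ) : CurrentU :=
  PowerSeries.coeff i (centralSer n C * transferSer)

/-! ### The algebra `𝓞_l = ℂ[f₁, …, f_l, g₁, …, g_{n-l-1}, Σ_n]` -/

/-- The coordinates `f₁, …, f_l`, then `g₁, …, g_{n-l-1}`, then `Σ_n`. -/
abbrev OIdx (n l : ℕ) : Type := Fin l ⊕ Fin (n - l - 1) ⊕ Unit

/-- `𝓞_l`. -/
abbrev O (n l : ℕ) : Type := MvPolynomial (OIdx n l) ℂ

/-- `deg f_i = i`, `deg g_j = j`, `deg Σ_n = n`. -/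
def OWeight (n l : ℕ) : OIdx n l → ℕ
  | Sum.inl i => i + 1
  | Sum.inr (Sum.inl j) => j + 1
  | Sum.inr (Sum.inr _) => n

/-- `f(x) = x^l + ∑_{i=1}^l f_i x^{l-i}`. -/
def fPoly (n l : ℕ) : Polynomial (O n l) :=
  Polynomial.X ^ l + ∑ i : Fin l,
    Polynomial.C (MvPolynomial.X (Sum.inl i)) * Polynomial.X ^ (l - ((i : ℕ) + 1))

/-- `g(x) = x^{n-l-1} + ∑_{j=1}^{n-l-1} g_j x^{n-l-1-j}`. -/
def gPoly (n l : ℕ) : Polynomial (O n l) :=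
  Polynomial.X ^ (n - l - 1) + ∑ j : Fin (n - l - 1),
    Polynomial.C (MvPolynomial.X (Sum.inr (Sum.inl j))) *
      Polynomial.X ^ (n - l - 1 - ((j : ℕ) + 1))

/-- `Σ_j` for `1 ≤ j ≤ n`: `Σ_n` is the coordinate, and for `j < n` the coefficient of
`x^{n-1-j}` in `n f(x) g(x)` is `(-1)^j (n - j) Σ_j`. -/
def SigmaO (n l j : ℕ) : O n l :=
  if j = n then MvPolynomial.X (Sum.inr (Sum.inr ()))
  else ((-1 : ℂ) ^ j / ((n : ℂ) - j)) •
    ((Polynomial.C (n : O n l) * fPoly n l * gPoly n l).coeff (n - 1 - j))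

/-- `G_i` for `1 ≤ i ≤ n - 2`: the coefficient of `x^{n-2-i}` in `n f'(x) g(x)`. -/
def GO (n l i : ℕ) : O n l :=
  (Polynomial.C (n : O n l) * Polynomial.derivative (fPoly n l) * gPoly n l).coeff (n - 2 - i)

/-- The homomorphism `π_l : ℂ[z₁, …, z_n]^𝔖 → 𝓞_l` with `σ_j(z) ↦ Σ_j`, through which `𝓞_l` is a
`ℂ[z₁, …, z_n]^𝔖`-module. -/
def symToO (n l : ℕ) : MvPolynomial.symmetricSubalgebra (Fin n) ℂ →ₐ[ℂ] O n l :=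
  (MvPolynomial.aeval fun j : Fin n => SigmaO n l (j + 1)).comp
    (MvPolynomial.esymmAlgEquiv (Fin n) ℂ (Fintype.card_fin n)).symm.toAlgHom

/-- An algebra homomorphism `η : 𝓞_l → 𝓑_l` sends `G_i` to `B_{i+2}(z)` for `1 ≤ i ≤ n - 2` and
`Σ_j` to `C_j(z)` for `1 ≤ j ≤ n`, where `X(z)` is the operator by which `X` acts on `𝓜_l`. -/
def SendsGenerators (n l : ℕ) (C : ℕ → CurrentU) (η : O n l →ₐ[ℂ] betheM n l) : Prop :=
  (∀ i, 1 ≤ i → i + 2 ≤ n → ∀ v : M n l,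
    (((η (GO n l i) : Module.End ℂ (M n l)) v : M n l) : VPoly n) = act n (B n C (i + 2)) v) ∧
  (∀ j, 1 ≤ j → j ≤ n → ∀ v : M n l,
    (((η (SigmaO n l j) : Module.End ℂ (M n l)) v : M n l) : VPoly n) = act n (C j) v)

end Gaudin

end

/-! The space `(ℂ^{1|1})^{⊗ n}` is a fermionic Fock space: `e₁₂` and `e₂₁` at a site annihilate and
create a fermion, and each coefficient of `𝓣(x)` acts as a quadratic expression in these operators.
Its commutator with an annihilation operator is again an annihilation operator, so products of
annihilation operators are acted on by a derivation, and the diagonalization reduces to a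
one-particle problem on `n`-dimensional vectors.

Put `Q(x) = x^n + ∑ (-1)^j Σ_j x^{n-j}`; the definition of the `Σ_j` says that `Q' = n f g`. Over a
field containing the roots `c_i` of `f g` and the roots `ζ_s` of `Q`, the vector `w_i = (1 / (c_i -
ζ_s))_s` is a one-particle eigenvector because `∑_s 1 / (c_i - ζ_s) = Q'(c_i) / Q(c_i) = 0`
(`BetheField.sum_w`, `BetheField.eigen`). The `n - 1` vectors `w_i` and the constant vector, which
corresponds to `e₁₂[0]`, form a basis. Let `chi κ` be the vacuum coefficient after annihilation
along `w_{κ 1}, …, w_{κ l}`. By `hat_apply_of_eigen` it is a left eigenvector of all transfer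
operators, and a vector of `𝓜_l` is determined by the values `chi κ` (`BetheField.eq_zero_of_chi`).

Symmetry then reduces the family to one functional. The coordinates of a vector of `𝒱^𝔖` are the
values of one alternating polynomial with symmetric coefficients, so `chi κ` is the Vandermonde
product times one symmetric polynomial, both taken at the chosen roots (`BetheField.exists_chi_eq`).
A permutation of the roots of `f g`, even one that mixes roots of `f` with roots of `g`, does not
change `Q`; hence if `chi κ` vanishes for one injective `κ`, it vanishes for all. Choosing the roots
of `f` gives an injective map `tau : 𝓜_l → K` with image in `δ 𝓞_l`, where `δ` is the Vandermonde
product of these roots. A determinant shows that `tau` sends `u_l` to `n (-n)^l δ`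
(`BetheField.chi_uvec`).

On `tau` the element `B_{i+2}` has eigenvalue `G_i` (`BetheField.sum_coeff_mul_lam`) and `C_j` has
eigenvalue `Σ_j`. These elements generate `𝓞_l` (`mem_of_generators`), and every eigenvalue of the
Bethe algebra can be read off on `u_l`, where it lies in `𝓞_l`. Hence `𝓑_l ≅ 𝓞_l`, and `𝓜_l` is free
of rank one on `u_l`. The degrees are checked on the generators; no character of `𝓜_l` is needed. -/

open scoped BigOperators

noncomputable section

namespace Gaudin

/-! ### The fermionic Fock space with coefficients in a commutative ring -/

/-- `(ℂ^{1|1})^{⊗ n}` with coefficients in `R`. -/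
abbrev Fock (R : Type*) (n : ℕ) : Type _ := (Fin n → Fin 2) → R

/-- The operator `e_{ij}` with coefficients in `R` in the `s`-th tensor factor, with the Koszul sign. -/
def fockOp (R : Type*) [CommRing R] (n : ℕ) (i j : Fin 2) (s : Fin n) : Fock R n →ₗ[R] Fock R n where
  toFun F J :=
    if J s = i then
      (-1) ^ ((∑ k ∈ Finset.Iio s, (J k : ℕ)) * ((i : ℕ) + j)) * F (Function.update J s j)
    else 0
  map_add' F G := by
    funext J
    by_cases h : J s = i <;> simp [h, mul_add]
  map_smul' c F := by
    funext J
    by_cases h : J s = i <;> simp [h, mul_left_comm]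

/-- The relations of `siteOp` are needed over an arbitrary commutative ring, because vectors are
later transported by `mapFock` to a field containing the Bethe roots. Over `ℂ[z₁, …, z_n]` the two
operators agree definitionally. -/
theorem fockOp_mul_self (R : Type*) [CommRing R] (n : ℕ) (i j k l : Fin 2) (s : Fin n) :
    fockOp R n i j s * fockOp R n k l s = if j = k then fockOp R n i l s else 0 := by
  refine LinearMap.ext fun F => funext fun J => ?_
  have hs : ∀ m ∈ Finset.Iio s, (Function.update J s j m : ℕ) = J m := by
    intro m hm
    rw [Function.update_of_ne (Finset.mem_Iio.1 hm).ne]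
  by_cases hjk : j = k
  · subst hjk
    by_cases hJ : J s = i
    · simp only [fockOp, Module.End.mul_apply, LinearMap.coe_mk, AddHom.coe_mk, hJ, if_true,
        Function.update_self, Function.update_idem]
      rw [Finset.sum_congr rfl hs, ← mul_assoc, ← pow_add, ← mul_add]
      congr 1
      have : (i : ℕ) + j + (j + l) = (i + l) + 2 * j := by ring
      rw [this, mul_add, pow_add, mul_left_comm, pow_mul (-1) 2]
      simp
    · simp [fockOp, hJ]
  · simp [fockOp, hjk]

/-- The site `s` belongs to the Koszul string of `t`, so changing the entry at `s` changes the sign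
at `t`; the string of `s` does not contain `t`. This asymmetry is the whole commutation sign. -/
theorem fockOp_mul_of_lt (R : Type*) [CommRing R] (n : ℕ) (i j k l : Fin 2) {s t : Fin n} (h : s < t) :
    fockOp R n i j s * fockOp R n k l t =
      (-1 : R) ^ (((i : ℕ) + j) * ((k : ℕ) + l)) •
        (fockOp R n k l t * fockOp R n i j s) := by
  refine LinearMap.ext fun F => funext fun J => ?_
  simp only [fockOp, Module.End.mul_apply, LinearMap.coe_mk, AddHom.coe_mk,
    LinearMap.smul_apply, Pi.smul_apply, smul_eq_mul, Function.update_of_ne h.ne,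
    Function.update_of_ne h.ne']
  by_cases hs : J s = i
  · by_cases ht : J t = k
    · have hsum1 : ∑ m ∈ Finset.Iio s, (Function.update J t l m : ℕ)
          = ∑ m ∈ Finset.Iio s, (J m : ℕ) := by
        refine Finset.sum_congr rfl fun m hm => ?_
        rw [Function.update_of_ne ((Finset.mem_Iio.1 hm).trans h).ne]
      have hmem : s ∈ Finset.Iio t := Finset.mem_Iio.2 h
      have hsum2 : (∑ m ∈ Finset.Iio t, (Function.update J s j m : ℕ)) + i
          = (∑ m ∈ Finset.Iio t, (J m : ℕ)) + j := by
        rw [← Finset.add_sum_erase _ _ hmem, ← Finset.add_sum_erase _ (fun m => (J m : ℕ)) hmem]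
        rw [Finset.sum_congr rfl (g := fun m => (J m : ℕ))]
        · simp only [Function.update_self, hs]; ring
        · intro m hm
          rw [Function.update_of_ne (Finset.ne_of_mem_erase hm)]
      simp only [hs, ht, if_true, hsum1, Function.update_comm h.ne]
      have key : (-1 : R) ^
            ((∑ m ∈ Finset.Iio t, (Function.update J s j m : ℕ)) * ((k : ℕ) + l)) =
          (-1) ^ (((i : ℕ) + j) * ((k : ℕ) + l)) *
            (-1) ^ ((∑ m ∈ Finset.Iio t, (J m : ℕ)) * ((k : ℕ) + l)) := by
        have h1 : (-1 : R) ^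
            (∑ m ∈ Finset.Iio t, (Function.update J s j m : ℕ)) =
            (-1) ^ ((i : ℕ) + j) * (-1) ^ (∑ m ∈ Finset.Iio t, (J m : ℕ)) := by
          have h2 : (-1 : R) ^ (i : ℕ) * (-1) ^ (i : ℕ) = 1 := by
            rw [← pow_add, ← two_mul, pow_mul]; simp
          have h3 := congrArg (fun m => (-1 : R) ^ m) hsum2
          simp only [pow_add] at h3
          calc _ = (-1 : R) ^
                (∑ m ∈ Finset.Iio t, (Function.update J s j m : ℕ)) *
                ((-1) ^ (i : ℕ) * (-1) ^ (i : ℕ)) := by rw [h2, mul_one]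
            _ = _ := by rw [← mul_assoc, h3, pow_add]; ring
        rw [pow_mul, h1, mul_pow, ← pow_mul, ← pow_mul]
      rw [key]
      ring
    · simp [ht]
  · simp [hs]

theorem fockOp_mul_of_ne (R : Type*) [CommRing R] (n : ℕ) (i j k l : Fin 2) {s t : Fin n} (h : s ≠ t) :
    fockOp R n i j s * fockOp R n k l t =
      (-1 : R) ^ (((i : ℕ) + j) * ((k : ℕ) + l)) •
        (fockOp R n k l t * fockOp R n i j s) := by
  rcases lt_or_gt_of_ne h with h | h
  · exact fockOp_mul_of_lt R n i j k l h
  · rw [fockOp_mul_of_lt R n k l i j h, smul_smul, mul_comm ((k : ℕ) + l), ← mul_pow]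
    simp


section Fock

variable {R : Type*} [CommRing R] {n : ℕ}

/-- The annihilation operator with coefficients `w`. -/
def annOp (w : Fin n → R) : Module.End R (Fock R n) := ∑ s, w s • fockOp R n 0 1 s

/-- The creation operator with coefficients `h`. -/
def creOp (h : Fin n → R) : Module.End R (Fock R n) := ∑ s, h s • fockOp R n 1 0 s

/-- The weighted number operator. -/
def numOp (k : Fin n → R) : Module.End R (Fock R n) := ∑ s, k s • fockOp R n 1 1 s

theorem fockOp_add_diag (s : Fin n) : fockOp R n 0 0 s + fockOp R n 1 1 s = 1 := by
  refine LinearMap.ext fun F => funext fun J => ?_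
  have h : J s = 0 ∨ J s = 1 := by have := (J s).isLt; omega
  rcases h with h | h
  · have e : Function.update J s 0 = J := by rw [← h, Function.update_eq_self]
    simp [fockOp, h, e]
  · have e : Function.update J s 1 = J := by rw [← h, Function.update_eq_self]
    simp [fockOp, h, e, mul_comm _ 2, pow_mul]

theorem ann_anticomm (s t : Fin n) :
    fockOp R n 0 1 s * fockOp R n 0 1 t = -(fockOp R n 0 1 t * fockOp R n 0 1 s) := by
  by_cases h : s = t
  · subst h; simp [fockOp_mul_self]
  · rw [fockOp_mul_of_ne R n 0 1 0 1 h]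
    refine LinearMap.ext fun F => ?_
    simp

/-- The canonical anticommutation relations. On one site they amount to the completeness relation
`fockOp_add_diag`. -/
theorem ann_cre (s t : Fin n) :
    fockOp R n 0 1 s * fockOp R n 1 0 t =
      (if s = t then 1 else 0) - fockOp R n 1 0 t * fockOp R n 0 1 s := by
  by_cases h : s = t
  · subst h; simp [fockOp_mul_self, ← fockOp_add_diag (R := R) s]
  · rw [fockOp_mul_of_ne R n 0 1 1 0 h]
    refine LinearMap.ext fun F => ?_
    simp [h]

theorem annOp_anticomm (v w : Fin n → R) : annOp v * annOp w = -(annOp w * annOp v) := by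
  simp only [annOp, Finset.sum_mul_sum, smul_mul_smul_comm]
  rw [Finset.sum_comm, ← Finset.sum_neg_distrib]
  refine Finset.sum_congr rfl fun s _ => ?_
  rw [← Finset.sum_neg_distrib]
  refine Finset.sum_congr rfl fun t _ => ?_
  rw [ann_anticomm t s, smul_neg, mul_comm]

theorem annOp_sq (w : Fin n → R) : annOp w * annOp w = 0 := by
  simp only [annOp, Finset.sum_mul_sum, smul_mul_smul_comm]
  rw [← Finset.sum_product', ]
  -- The terms `(s, t)` and `(t, s)` cancel and the diagonal ones vanish. Anticommutation alone
  -- would give only twice the claim, and 2 need not be invertible in `R`.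
  refine Finset.sum_involution (fun p _ => (p.2, p.1)) ?_ ?_ ?_ ?_
  · rintro ⟨s, t⟩ -
    simp only
    rw [ann_anticomm s t, mul_comm (w s), smul_neg, neg_add_cancel]
  · rintro ⟨s, t⟩ - h e
    obtain rfl : s = t := by simpa using (congrArg Prod.snd e)
    exact h (by simp [fockOp_mul_self])
  · simp
  · simp

theorem annOp_creOp (w h : Fin n → R) :
    annOp w * creOp h = (∑ s, w s * h s) • 1 - creOp h * annOp w := by
  simp only [annOp, creOp, Finset.sum_mul_sum, smul_mul_smul_comm]
  rw [Finset.sum_comm (f := fun i j => (h i * w j) • (fockOp R n 1 0 i * fockOp R n 0 1 j)),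
    Finset.sum_smul, ← Finset.sum_sub_distrib]
  refine Finset.sum_congr rfl fun s _ => ?_
  simp only [ann_cre, smul_sub, Finset.sum_sub_distrib, smul_ite, smul_zero, Finset.sum_ite_eq,
    Finset.mem_univ, if_true, mul_comm (w s)]

theorem annOp_creOp_annOp (w h k : Fin n → R) :
    annOp w * (creOp h * annOp k) =
      creOp h * annOp k * annOp w + (∑ s, w s * h s) • annOp k := by
  rw [← mul_assoc, annOp_creOp, sub_mul, smul_mul_assoc, one_mul, mul_assoc, annOp_anticomm w k]
  refine LinearMap.ext fun F => ?_
  simp [add_comm]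

theorem annOp_numOp (w k : Fin n → R) :
    annOp w * numOp k = numOp k * annOp w + annOp (fun s => w s * k s) := by
  have key : ∀ s t : Fin n, fockOp R n 0 1 s * fockOp R n 1 1 t =
      fockOp R n 1 1 t * fockOp R n 0 1 s + if s = t then fockOp R n 0 1 s else 0 := by
    intro s t
    by_cases h : s = t
    · subst h; simp [fockOp_mul_self]
    · rw [fockOp_mul_of_ne R n 0 1 1 1 h]; simp [h]
  simp only [annOp, numOp, Finset.sum_mul_sum, smul_mul_smul_comm]
  rw [Finset.sum_comm (f := fun i j => (k i * w j) • (fockOp R n 1 1 i * fockOp R n 0 1 j)),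
    ← Finset.sum_add_distrib]
  refine Finset.sum_congr rfl fun s _ => ?_
  simp only [key, smul_add, Finset.sum_add_distrib, smul_ite, smul_zero, Finset.sum_ite_eq,
    Finset.mem_univ, if_true, mul_comm (w s)]

/-- The coefficient of the vacuum. -/
def vac : Fock R n →ₗ[R] R := LinearMap.proj fun _ => 0

/-- The index of the vacuum has no entry 1. Together with `vac_numOp` this makes the vacuum covector
a left eigenvector of the transfer operators, with eigenvalue 0. -/
theorem vac_creOp (h : Fin n → R) (F : Fock R n) : vac (creOp h F) = 0 := by
  simp [vac, creOp, fockOp]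

theorem vac_numOp (h : Fin n → R) (F : Fock R n) : vac (numOp h F) = 0 := by
  simp [vac, numOp, fockOp]

theorem annOp_add (v w : Fin n → R) : annOp (v + w) = annOp v + annOp w := by
  simp [annOp, add_smul, Finset.sum_add_distrib]

theorem annOp_smul (c : R) (w : Fin n → R) : annOp (c • w) = c • annOp w := by
  simp [annOp, smul_smul, Finset.smul_sum]

/-- `annOp` as a linear map to the opposite of the endomorphism algebra. -/
def annOpLin : (Fin n → R) →ₗ[R] (Module.End R (Fock R n))ᵐᵒᵖ where
  toFun w := MulOpposite.op (annOp w)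
  map_add' v w := by rw [annOp_add, MulOpposite.op_add]
  map_smul' c w := by rw [annOp_smul, MulOpposite.op_smul]; rfl

/-- Products of annihilation operators, as a homomorphism from the exterior algebra. -/
def annExt : ExteriorAlgebra R (Fin n → R) →ₐ[R] (Module.End R (Fock R n))ᵐᵒᵖ :=
  ExteriorAlgebra.lift R ⟨annOpLin, fun w => by
    rw [annOpLin, LinearMap.coe_mk, AddHom.coe_mk, ← MulOpposite.op_mul, annOp_sq,
      MulOpposite.op_zero]⟩

/-- The coefficient of the vacuum in `annOp (w (k-1)) ⋯ annOp (w 0) F`. -/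
def hat (k : ℕ) (F : Fock R n) : (Fin n → R) [⋀^Fin k]→ₗ[R] R :=
  (vac.comp ((LinearMap.applyₗ F).comp
    ((MulOpposite.opLinearEquiv R).symm.toLinearMap.comp annExt.toLinearMap))).compAlternatingMap
    (ExteriorAlgebra.ιMulti R k)

theorem hat_zero (F : Fock R n) (w : Fin 0 → Fin n → R) : hat 0 F w = vac F := by
  simp [hat]

/-- The opposite algebra in `annExt` reverses products, so the first argument of `hat` is the
operator applied first. -/
theorem hat_succ (k : ℕ) (F : Fock R n) (w : Fin (k + 1) → Fin n → R) :
    hat (k + 1) F w = hat k (annOp (w 0) F) (fun i => w i.succ) := by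
  simp only [hat, LinearMap.compAlternatingMap_apply, ExteriorAlgebra.ιMulti_succ_apply,
    LinearMap.comp_apply, AlgHom.toLinearMap_apply, map_mul, annExt, ExteriorAlgebra.lift_ι_apply,
    LinearEquiv.coe_coe, MulOpposite.coe_opLinearEquiv_symm, MulOpposite.unop_mul,
    LinearMap.applyₗ_apply_apply, Module.End.mul_apply]
  rfl

theorem hat_add (k : ℕ) (F G : Fock R n) (w : Fin k → Fin n → R) :
    hat k (F + G) w = hat k F w + hat k G w := by
  simp [hat, map_add]

theorem hat_smul (k : ℕ) (c : R) (F : Fock R n) (w : Fin k → Fin n → R) :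
    hat k (c • F) w = c * hat k F w := by
  simp [hat]

theorem hat_zero_vec (k : ℕ) (w : Fin k → Fin n → R) : hat k (0 : Fock R n) w = 0 := by
  simp [hat]

theorem hat_sum {ι : Type*} (k : ℕ) (S : Finset ι) (F : ι → Fock R n) (w : Fin k → Fin n → R) :
    hat k (∑ i ∈ S, F i) w = ∑ i ∈ S, hat k (F i) w := by
  classical
  induction S using Finset.induction_on with
  | empty => simp [hat_zero_vec]
  | insert a S ha ih => rw [Finset.sum_insert ha, hat_add, ih, Finset.sum_insert ha]

/-- A vector killed by `annOp v` is killed by `hat` with one argument `v`. -/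
theorem hat_eq_zero_of_annOp (k : ℕ) {F : Fock R n} {v : Fin n → R} (hv : annOp v F = 0)
    (w : Fin k → Fin n → R) (j : Fin k) (hj : w j = v) : hat k F w = 0 := by
  induction k generalizing F with
  | zero => exact j.elim0
  | succ k ih =>
    rw [hat_succ]
    induction j using Fin.cases with
    | zero => rw [hj, hv, hat_zero_vec]
    | succ j =>
      refine ih ?_ _ j hj
      rw [← Module.End.mul_apply, annOp_anticomm, LinearMap.neg_apply, Module.End.mul_apply, hv,
        map_zero, neg_zero]

/-- If `D` moves through `annOp (w j)` at the cost of an eigenvalue `μ j`, then `hat` turns it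
into the sum of the eigenvalues. -/
theorem hat_apply_of_eigen (k : ℕ) (D : Module.End R (Fock R n)) (hD : ∀ F, vac (D F) = 0)
    (w : Fin k → Fin n → R) (μ : Fin k → R)
    (h : ∀ j, annOp (w j) * D = D * annOp (w j) + μ j • annOp (w j)) (F : Fock R n) :
    hat k (D F) w = (∑ j, μ j) * hat k F w := by
  induction k generalizing F with
  | zero => simp [hat_zero, hD]
  | succ k ih =>
    have h0 := congrArg (fun A => A F) (h 0)
    simp only [Module.End.mul_apply, LinearMap.add_apply, LinearMap.smul_apply] at h0
    rw [hat_succ, h0, hat_add, hat_smul, ih (fun i => w i.succ) (fun i => μ i.succ)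
      (fun j => h j.succ), hat_succ, Fin.sum_univ_succ]
    ring

/-- `creOp (h 0) ⋯ creOp (h (k-1))` applied to the vacuum. -/
def creVec (k : ℕ) (h : Fin k → Fin n → R) : Fock R n :=
  ((List.ofFn fun i => creOp (h i)).prod) (Pi.single (fun _ => 0) 1)

theorem creVec_succ (k : ℕ) (h : Fin (k + 1) → Fin n → R) :
    creVec (k + 1) h = creOp (h 0) (creVec k fun i => h i.succ) := by
  simp [creVec, List.ofFn_succ]

theorem annOp_vacuum (w : Fin n → R) :
    annOp w (Pi.single (fun _ => 0) 1 : Fock R n) = 0 := by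
  funext J
  simp only [annOp, LinearMap.sum_apply, LinearMap.smul_apply, Finset.sum_apply, Pi.smul_apply,
    Pi.zero_apply]
  refine Finset.sum_eq_zero fun s _ => ?_
  have : Function.update J s 1 ≠ fun _ => 0 := fun h => by simpa using congrFun h s
  simp [fockOp, Pi.single_eq_of_ne this]

/-- The annihilation operator is moved to the right through the creation operators until it kills
the vacuum; each exchange costs a sign and leaves one contraction. -/
theorem annOp_creVec (k : ℕ) (w : Fin n → R) (h : Fin (k + 1) → Fin n → R) :
    annOp w (creVec (k + 1) h) =
      ∑ j : Fin (k + 1), ((-1) ^ (j : ℕ) * ∑ s, w s * h j s) •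
        creVec k fun i => h (j.succAbove i) := by
  induction k with
  | zero =>
    rw [creVec_succ, ← Module.End.mul_apply, annOp_creOp]
    simp [creVec, annOp_vacuum]
  | succ k ih =>
    rw [creVec_succ, ← Module.End.mul_apply, annOp_creOp, LinearMap.sub_apply,
      Module.End.mul_apply, ih, Fin.sum_univ_succ (n := k + 1), map_sum, sub_eq_add_neg,
      ← Finset.sum_neg_distrib]
    congr 1
    · simp
    · refine Finset.sum_congr rfl fun j _ => ?_
      rw [map_smul, ← neg_smul, creVec_succ k]
      simp [pow_succ]

/-- Wick's theorem: the contractions in `annOp_creVec` are the Laplace expansion of the determinant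
along its first row. -/
theorem hat_creVec (k : ℕ) (w h : Fin k → Fin n → R) :
    hat k (creVec k h) w = (Matrix.of fun i j => ∑ s, w i s * h j s).det := by
  induction k with
  | zero => simp [hat_zero, creVec, vac]
  | succ k ih =>
    rw [hat_succ, annOp_creVec, hat_sum, Matrix.det_succ_row_zero]
    refine Finset.sum_congr rfl fun j _ => ?_
    rw [hat_smul, ih]
    rfl

/-- Expansion of `hat` in coordinates. -/
theorem hat_eq_sum (k : ℕ) (F : Fock R n) (w : Fin k → Fin n → R) :
    hat k F w = ∑ t : Fin k → Fin n, (∏ j, w j (t j)) * hat k F fun j => Pi.single (t j) 1 := by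
  have hw : w = fun j => ∑ s, w j s • (Pi.single s 1 : Fin n → R) := by
    funext j
    conv_lhs => rw [pi_eq_sum_univ' (w j)]
  conv_lhs => rw [hw]
  rw [← AlternatingMap.coe_multilinearMap, MultilinearMap.map_sum]
  refine Finset.sum_congr rfl fun t _ => ?_
  rw [MultilinearMap.map_smul_univ]
  rfl

theorem annOp_single (s : Fin n) : annOp (Pi.single s (1 : R)) = fockOp R n 0 1 s := by
  rw [annOp, Finset.sum_eq_single s] <;> simp +contextual

/-- Up to sign, `hat` on distinct basis vectors reads off a coordinate. -/
theorem hat_basis (k : ℕ) (F : Fock R n) (t : Fin k → Fin n) (ht : Function.Injective t) :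
    ∃ ε : ℕ, hat k F (fun j => Pi.single (t j) 1) =
      (-1) ^ ε * F (fun s => if s ∈ Set.range t then 1 else 0) := by
  classical
  suffices H : ∀ (k : ℕ) (F : Fock R n) (t : Fin k → Fin n), Function.Injective t →
      ∃ ε : ℕ, hat k F (fun j => Pi.single (t j) 1) =
        (-1) ^ ε * F (fun s => if ∃ j, t j = s then 1 else 0) by
    simpa only [Set.mem_range] using H k F t ht
  intro k
  induction k with
  | zero => intro F t _; exact ⟨0, by simp [hat_zero, vac]⟩
  | succ k ih =>
    intro F t ht
    obtain ⟨ε, hε⟩ := ih (annOp (Pi.single (t 0) 1) F) (fun i => t i.succ)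
      (ht.comp (Fin.succ_injective _))
    rw [hat_succ, hε, annOp_single]
    have h0 : ¬ ∃ j : Fin k, t j.succ = t 0 := fun ⟨j, hj⟩ => Fin.succ_ne_zero j (ht hj)
    have hup : Function.update (fun s => if ∃ j : Fin k, t j.succ = s then (1 : Fin 2) else 0) (t 0) 1
        = fun s => if ∃ j, t j = s then 1 else 0 := by
      funext s
      by_cases hs : s = t 0
      · subst hs; simp
      · rw [Function.update_of_ne hs]
        simp [Fin.exists_fin_succ, Ne.symm hs]
    simp only [fockOp, LinearMap.coe_mk, AddHom.coe_mk, h0, if_false, if_true, hup]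
    exact ⟨ε + _, by rw [pow_add, mul_assoc]⟩

end Fock

/-! ### Coefficients of the transfer series -/

section Transfer

variable {R : Type*} [CommRing R] {n : ℕ}

theorem annOp_zero : annOp (0 : Fin n → R) = 0 := by simp [annOp]

theorem annOp_sum {ι : Type*} (S : Finset ι) (w : ι → Fin n → R) :
    annOp (∑ i ∈ S, w i) = ∑ i ∈ S, annOp (w i) := by
  classical
  induction S using Finset.induction_on with
  | empty => simp [annOp_zero]
  | insert a S ha ih => rw [Finset.sum_insert ha, annOp_add, ih, Finset.sum_insert ha]

theorem annOp_sub (v w : Fin n → R) : annOp (v - w) = annOp v - annOp w := by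
  rw [sub_eq_add_neg, annOp_add, sub_eq_add_neg, ← neg_one_smul R w, annOp_smul]
  refine congrArg _ (LinearMap.ext fun F => ?_)
  simp

/-- The coefficient of `x^{-m-2}` in the transfer series, acting on the Fock space with evaluation
parameters `ζ`. -/
def transferOp (ζ : Fin n → R) (m : ℕ) : Module.End R (Fock R n) :=
  ∑ x ∈ Finset.HasAntidiagonal.antidiagonal m,
    ((∑ s, ζ s ^ x.1) • numOp (fun s => ζ s ^ x.2) -
      creOp (fun s => ζ s ^ x.1) * annOp (fun s => ζ s ^ x.2))

theorem vac_transferOp (ζ : Fin n → R) (m : ℕ) (F : Fock R n) : vac (transferOp ζ m F) = 0 := by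
  simp [transferOp, LinearMap.sum_apply, map_sum, vac_creOp, vac_numOp]

/-- Both kinds of terms of `transferOp` are quadratic in the fermions, so their commutators with
`annOp w` are linear. The argument of the last `annOp` is the image of `w` under the one-particle
operator. -/
theorem annOp_transferOp (ζ : Fin n → R) (m : ℕ) (w : Fin n → R) :
    annOp w * transferOp ζ m = transferOp ζ m * annOp w +
      annOp (∑ x ∈ Finset.HasAntidiagonal.antidiagonal m, ((∑ s, ζ s ^ x.1) • (fun s => w s * ζ s ^ x.2) -
        (∑ s, w s * ζ s ^ x.1) • fun s => ζ s ^ x.2)) := by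
  rw [transferOp, Finset.mul_sum, Finset.sum_mul, annOp_sum, ← Finset.sum_add_distrib]
  refine Finset.sum_congr rfl fun x _ => ?_
  rw [annOp_sub, annOp_smul, annOp_smul, mul_sub, sub_mul, mul_smul_comm, annOp_numOp,
    annOp_creOp_annOp, smul_mul_assoc, smul_add]
  abel

theorem annOp_transferOp_of_eigen (ζ : Fin n → R) (m : ℕ) (w : Fin n → R) (μ : R)
    (h : ∀ t, ∑ x ∈ Finset.HasAntidiagonal.antidiagonal m, ((∑ s, ζ s ^ x.1) * (w t * ζ t ^ x.2) -
        (∑ s, w s * ζ s ^ x.1) * ζ t ^ x.2) = μ * w t) :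
    annOp w * transferOp ζ m = transferOp ζ m * annOp w + μ • annOp w := by
  rw [annOp_transferOp, ← annOp_smul]
  congr 2
  funext t
  simpa [Finset.sum_apply] using h t

/-- The transfer operators commute with `e₁₂[0]`. -/
theorem annOp_one_transferOp (ζ : Fin n → R) (m : ℕ) :
    annOp (fun _ => 1) * transferOp ζ m = transferOp ζ m * annOp fun _ => 1 := by
  -- For the constant vector the two sums in the one-particle operator agree term by term, so the
  -- eigenvalue is 0.
  rw [annOp_transferOp_of_eigen ζ m _ 0 (by simp), zero_smul, add_zero]

end Transfer

/-! ### The current algebra and the Bethe algebra in terms of Fock operators -/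

theorem currentOp_ann (n r : ℕ) (F : VPoly n) :
    currentOp n 0 1 r F = annOp (fun s => (MvPolynomial.X s : MvPolynomial (Fin n) ℂ) ^ r) F := rfl

theorem currentOp_cre (n r : ℕ) (F : VPoly n) :
    currentOp n 1 0 r F = creOp (fun s => (MvPolynomial.X s : MvPolynomial (Fin n) ℂ) ^ r) F := rfl

theorem currentOp_num (n r : ℕ) (F : VPoly n) :
    currentOp n 1 1 r F = numOp (fun s => (MvPolynomial.X s : MvPolynomial (Fin n) ℂ) ^ r) F := rfl

/-- `e₁₁[r] + e₂₂[r]` acts by the power sum. -/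
theorem currentOp_diag (n r : ℕ) (F : VPoly n) :
    currentOp n 0 0 r F + currentOp n 1 1 r F = MvPolynomial.psum (Fin n) ℂ r • F := by
  have h : ∀ s : Fin n, siteOp n 0 0 s + siteOp n 1 1 s = 1 := fockOp_add_diag
  have : polyOp n 0 0 r + polyOp n 1 1 r = MvPolynomial.psum (Fin n) ℂ r • 1 := by
    simp only [polyOp, MvPolynomial.psum, ← Finset.sum_add_distrib, ← smul_add, h, Finset.sum_smul]
  exact congrArg (fun A => A F) this

theorem neg_one_smul_current (x : CurrentU) : (-1 : ℂ) • x = -x := neg_one_smul ℂ x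

theorem coeff_smul_current (m : ℕ) (c : ℂ) (f : PowerSeries CurrentU) :
    PowerSeries.coeff m (c • f) = c • PowerSeries.coeff m f := rfl

theorem hamiltonian_eq_of_transfer {E : Type*} [AddCommGroup E] [Module ℂ E] {d s h t : E}
    (ht : t = (1 / 2 : ℂ) • d + (1 / 2 : ℂ) • s - h) : (2 : ℂ) • h = d + s - (2 : ℂ) • t := by
  rw [ht]; module

theorem transfer_eq_of_hamiltonian {E : Type*} [AddCommGroup E] [Module ℂ E] {d s h t : E}
    (ht : t = (1 / 2 : ℂ) • d + (1 / 2 : ℂ) • s - h) :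
    t = (1 / 2 : ℂ) • d + (1 / 2 : ℂ) • s - (1 / 2 : ℂ) • ((2 : ℂ) • h) := by
  rw [ht]; module

theorem transfer_coeff_identity {E : Type*} [AddCommGroup E] [Module ℂ E]
    (d a b c f : E) :
    (1 / 2 : ℂ) • -d + (1 / 2 : ℂ) • (a + b + (b + c)) -
      (1 / 2 : ℂ) • (a + f + (-(d - f) + -c)) = b + c - f := by
  module

theorem e_supercomm (i j k l : Fin 2) (r s : ℕ) :
    e i j r * e k l s - (-1 : ℂ) ^ (((i : ℕ) + j) * ((k : ℕ) + l)) • (e k l s * e i j r) =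
      (if j = k then e i l (r + s) else 0)
        - (-1 : ℂ) ^ (((i : ℕ) + j) * ((k : ℕ) + l)) • (if i = l then e k j (r + s) else 0) := by
  have h := RingQuot.mkAlgHom_rel ℂ (CurrentRel.supercomm i j k l r s)
  simp only [map_sub, map_mul, map_smul, apply_ite (RingQuot.mkAlgHom ℂ CurrentRel), map_zero] at h
  exact h

theorem coeff_eSer_mul (a b c d : Fin 2) (m : ℕ) :
    PowerSeries.coeff (m + 2) (eSer a b * eSer c d) =
      ∑ x ∈ Finset.HasAntidiagonal.antidiagonal m, e a b x.1 * e c d x.2 := by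
  have h : ∀ a b, eSer a b = PowerSeries.X * PowerSeries.mk (e a b) := by
    intro a b
    ext k
    cases k with
    | zero => simp [eSer]
    | succ k => simp [eSer, PowerSeries.coeff_succ_X_mul]
  rw [h, h, mul_assoc, ← mul_assoc (PowerSeries.mk _) PowerSeries.X, (PowerSeries.commute_X _).eq,
    mul_assoc, PowerSeries.coeff_succ_X_mul, PowerSeries.coeff_succ_X_mul, PowerSeries.coeff_mul]
  simp

theorem coeff_eSer_mul_of_lt (a b c d : Fin 2) (m : ℕ) (hm : m < 2) :
    PowerSeries.coeff m (eSer a b * eSer c d) = 0 := by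
  rw [PowerSeries.coeff_mul]
  refine Finset.sum_eq_zero fun x hx => ?_
  have := Finset.HasAntidiagonal.mem_antidiagonal.1 hx
  rcases x with ⟨p, q⟩
  have : p = 0 ∨ q = 0 := by simp only at this; omega
  rcases this with rfl | rfl <;> simp [eSer]

/-- Reordering `e₁₂ e₂₁` in `𝓗(x)` produces `(m + 1)(e₁₁[m] + e₂₂[m])`, one copy for each pair of
exponents of sum `m`. The derivative in `𝓣(x)` is there to cancel exactly this term, which leaves a
normally ordered quadratic expression. -/
theorem coeff_transferSer (m : ℕ) :
    PowerSeries.coeff (m + 2) transferSer =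
      ∑ x ∈ Finset.HasAntidiagonal.antidiagonal m, ((e 0 0 x.1 + e 1 1 x.1) * e 1 1 x.2 - e 1 0 x.1 * e 0 1 x.2) := by
  have h01 : ∀ r s, e 0 1 r * e 1 0 s = e 0 0 (r + s) + e 1 1 (r + s) - e 1 0 s * e 0 1 r := by
    intro r s
    have := e_supercomm 0 1 1 0 r s
    simp [neg_one_smul_current] at this
    rw [← this]; abel
  have hc : ∀ r s, e 0 0 r * e 1 1 s = e 1 1 s * e 0 0 r := by
    intro r s
    have := e_supercomm 0 0 1 1 r s
    simpa [sub_eq_zero] using this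
  have hdx : PowerSeries.coeff (m + 2) (dx (eSer 0 0) + dx (eSer 1 1)) =
      -(((m + 1 : ℕ) : ℂ) • (e 0 0 m + e 1 1 m)) := by
    simp [dx, eSer, smul_add]
    abel
  have hs : ∑ x ∈ Finset.HasAntidiagonal.antidiagonal m, e 0 1 x.1 * e 1 0 x.2 =
      ((m + 1 : ℕ) : ℂ) • (e 0 0 m + e 1 1 m) - ∑ x ∈ Finset.HasAntidiagonal.antidiagonal m, e 1 0 x.1 * e 0 1 x.2 := by
    rw [← Finset.Nat.sum_antidiagonal_swap (f := fun x => e 1 0 x.1 * e 0 1 x.2), eq_sub_iff_add_eq,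
      ← Finset.sum_add_distrib]
    have : ∀ x ∈ Finset.HasAntidiagonal.antidiagonal m, e 0 1 x.1 * e 1 0 x.2 + e 1 0 x.swap.1 * e 0 1 x.swap.2 =
        e 0 0 m + e 1 1 m := by
      intro x hx
      rw [h01, Finset.HasAntidiagonal.mem_antidiagonal.1 hx]
      simp
    rw [Finset.sum_congr rfl this, Finset.sum_const, Finset.Nat.card_antidiagonal, Nat.cast_smul_eq_nsmul]
  have hcs : ∑ x ∈ Finset.HasAntidiagonal.antidiagonal m, e 1 1 x.1 * e 0 0 x.2 =
      ∑ x ∈ Finset.HasAntidiagonal.antidiagonal m, e 0 0 x.1 * e 1 1 x.2 := by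
    rw [← Finset.Nat.sum_antidiagonal_swap]
    exact Finset.sum_congr rfl fun x _ => by simp [hc]
  rw [transferSer, hamSer]
  simp only [map_sub, map_add, coeff_smul_current, Fin.sum_univ_two, sq, add_mul, mul_add, coeff_eSer_mul,
    hs, hcs, Finset.sum_add_distrib, Finset.sum_sub_distrib]
  rw [← map_add (PowerSeries.coeff (m + 2)), hdx]
  simp only [Fin.val_zero, Fin.val_one, pow_zero, pow_one, neg_one_smul_current, one_smul]
  exact transfer_coeff_identity (E := CurrentU) _ _ _ _ _

theorem coeff_transferSer_of_lt (m : ℕ) (hm : m < 2) : PowerSeries.coeff m transferSer = 0 := by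
  rw [transferSer, hamSer]
  simp only [map_sub, map_add, coeff_smul_current, Fin.sum_univ_two, sq, add_mul, mul_add,
    coeff_eSer_mul_of_lt _ _ _ _ m hm, smul_zero, add_zero, sub_zero]
  interval_cases m <;> simp [dx, eSer]

/-- `transferSer` acts by the transfer operators. -/
theorem act_coeff_transferSer (n m : ℕ) (F : VPoly n) :
    act n (PowerSeries.coeff (m + 2) transferSer) F =
      transferOp (fun s => (MvPolynomial.X s : MvPolynomial (Fin n) ℂ)) m F := by
  rw [coeff_transferSer, transferOp, map_sum, LinearMap.sum_apply, LinearMap.sum_apply]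
  refine Finset.sum_congr rfl fun x _ => ?_
  simp only [map_sub, map_add, map_mul, act_e, LinearMap.sub_apply, Module.End.mul_apply,
    LinearMap.add_apply, LinearMap.smul_apply, currentOp_diag]
  rfl

/-- The coefficients of `e₁₁(x) + e₂₂(x)` and of the transfer series generate the Bethe algebra. -/
theorem bethe_eq :
    bethe = Algebra.adjoin ℂ (Set.range (fun r : ℕ => e 0 0 r + e 1 1 r) ∪
      Set.range fun m : ℕ => PowerSeries.coeff (m + 2) transferSer) := by
  have hT : (2 : ℂ) • hamSer =
      dx (eSer 0 0) + dx (eSer 1 1) + (eSer 0 0 + eSer 1 1) ^ 2 - (2 : ℂ) • transferSer := by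
    exact hamiltonian_eq_of_transfer rfl
  have hT' : transferSer = (1 / 2 : ℂ) • (dx (eSer 0 0) + dx (eSer 1 1))
      + (1 / 2 : ℂ) • (eSer 0 0 + eSer 1 1) ^ 2 - (1 / 2 : ℂ) • ((2 : ℂ) • hamSer) := by
    exact transfer_eq_of_hamiltonian rfl
  -- The derivative and the square of `e₁₁(x) + e₂₂(x)` bring in no new coefficients, so `2 𝓗(x)`
  -- and `𝓣(x)` are interchangeable as generators.
  have hsub : ∀ S : Subalgebra ℂ CurrentU,
      (∀ m, PowerSeries.coeff m (eSer 0 0 + eSer 1 1) ∈ S) →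
      (∀ m, PowerSeries.coeff m (dx (eSer 0 0) + dx (eSer 1 1)) ∈ S) ∧
      ∀ m, PowerSeries.coeff m ((eSer 0 0 + eSer 1 1) ^ 2) ∈ S := by
    intro S hS
    refine ⟨fun m => ?_, fun m => ?_⟩
    · cases m with
      | zero => simp [dx]
      | succ k =>
        have : PowerSeries.coeff (k + 1) (dx (eSer 0 0) + dx (eSer 1 1)) =
            -((k : ℂ) • PowerSeries.coeff k (eSer 0 0 + eSer 1 1)) := by
          simp [dx, smul_add]; abel
        rw [this]
        exact neg_mem (S.smul_mem (hS k) _)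
    · rw [sq, PowerSeries.coeff_mul]
      exact sum_mem fun x _ => mul_mem (hS _) (hS _)
  refine le_antisymm (Algebra.adjoin_le ?_) (Algebra.adjoin_le ?_)
  · set S := Algebra.adjoin ℂ (Set.range (fun r : ℕ => e 0 0 r + e 1 1 r) ∪
      Set.range fun m : ℕ => PowerSeries.coeff (m + 2) transferSer) with hSdef
    have h1 : ∀ m, PowerSeries.coeff m (eSer 0 0 + eSer 1 1) ∈ S := by
      intro m
      cases m with
      | zero => simp [eSer]
      | succ r => exact Algebra.subset_adjoin (Or.inl ⟨r, by simp [eSer]⟩)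
    have h2 : ∀ m, PowerSeries.coeff m transferSer ∈ S := by
      intro m
      rcases Nat.lt_or_ge m 2 with hm | hm
      · rw [coeff_transferSer_of_lt m hm]; exact zero_mem _
      · exact Algebra.subset_adjoin (Or.inr ⟨m - 2, by simp [Nat.sub_add_cancel hm]⟩)
    rintro _ (⟨m, rfl⟩ | ⟨m, rfl⟩)
    · exact h1 m
    · simp only [hT, map_sub, coeff_smul_current, map_add (PowerSeries.coeff m) (_ + _)]
      exact sub_mem (add_mem ((hsub S h1).1 m) ((hsub S h1).2 m)) (S.smul_mem (h2 m) _)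
  · have h1 : ∀ m, PowerSeries.coeff m (eSer 0 0 + eSer 1 1) ∈ bethe := fun m =>
      Algebra.subset_adjoin (Or.inl ⟨m, rfl⟩)
    rintro _ (⟨m, rfl⟩ | ⟨m, rfl⟩)
    · have := h1 (m + 1)
      simpa [eSer] using this
    · simp only
      rw [hT', map_sub, map_add, coeff_smul_current, coeff_smul_current, coeff_smul_current]
      exact sub_mem (add_mem (bethe.smul_mem ((hsub _ h1).1 _) _)
        (bethe.smul_mem ((hsub _ h1).2 _) _))
        (bethe.smul_mem (Algebra.subset_adjoin (Or.inr ⟨m + 2, rfl⟩)) _)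

/-! ### The symmetric group and the singular vectors -/

/-- Since `a` and `b` are adjacent, a third site `s` has either both of them or neither on its left.
-/
theorem sum_Iio_comp_swap {n : ℕ} {a b s : Fin n} (hab : (b : ℕ) = a + 1) (ha : s ≠ a) (hb : s ≠ b)
    (J : Fin n → Fin 2) :
    ∑ k ∈ Finset.Iio s, ((J ∘ Equiv.swap a b) k : ℕ) = ∑ k ∈ Finset.Iio s, (J k : ℕ) := by
  refine Finset.sum_equiv (Equiv.swap a b) (fun k => ?_) (fun k _ => rfl)
  have ha' : (s : ℕ) ≠ a := fun h => ha (Fin.ext h)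
  have hb' : (s : ℕ) ≠ b := fun h => hb (Fin.ext h)
  simp only [Finset.mem_Iio, Fin.lt_def]
  rw [Equiv.swap_apply_def]
  split_ifs with h1 h2
  · subst h1; omega
  · subst h2; omega
  · rfl

theorem sum_Iio_succ {n : ℕ} {a b : Fin n} (hab : (b : ℕ) = a + 1) (J : Fin n → Fin 2) :
    ∑ k ∈ Finset.Iio b, (J k : ℕ) = (∑ k ∈ Finset.Iio a, (J k : ℕ)) + J a := by
  have : Finset.Iio b = insert a (Finset.Iio a) := by
    ext k
    simp only [Finset.mem_Iio, Finset.mem_insert, Fin.lt_def, Fin.ext_iff]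
    omega
  rw [this, Finset.sum_insert (by simp), add_comm]

theorem update_comp_swap {n : ℕ} (a b s : Fin n) (J : Fin n → Fin 2) (j : Fin 2) :
    Function.update J (Equiv.swap a b s) j ∘ Equiv.swap a b =
      Function.update (J ∘ Equiv.swap a b) s j :=
  Function.update_comp_eq_of_injective _ (Equiv.swap a b).injective s j

theorem neg_one_pow_congr {R : Type*} [Ring R] {p q : ℕ} (h : p % 2 = q % 2) :
    (-1 : R) ^ p = (-1) ^ q := by
  rw [neg_one_pow_eq_pow_mod_two, h, ← neg_one_pow_eq_pow_mod_two]

/-- The graded flip of adjacent factors permutes the operators in the tensor factors. -/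
theorem flipOp_siteOp (n : ℕ) (i j : Fin 2) (s : Fin n) {a b : Fin n} (hab : (b : ℕ) = a + 1)
    (F : VPoly n) :
    flipOp n a b (siteOp n i j s F) = siteOp n i j (Equiv.swap a b s) (flipOp n a b F) := by
  funext J
  have hne : a ≠ b := fun h => by rw [h] at hab; omega
  simp only [flipOp, siteOp, LinearMap.coe_mk, AddHom.coe_mk, update_comp_swap, Function.comp_apply]
  by_cases hJ : J (Equiv.swap a b s) = i
  swap
  · simp [hJ]
  simp only [hJ, if_true, map_mul, map_pow, map_neg, map_one, ← mul_assoc, ← pow_add]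
  congr 1
  -- Moving the operator from `a` to `b` adds the occupation of `a` to its Koszul string, while the
  -- changed entry at `b` alters the sign of the flip; the two effects agree modulo 2.
  by_cases hsa : s = a
  · subst hsa
    rw [Equiv.swap_apply_left] at hJ ⊢
    rw [sum_Iio_succ hab]
    have h1 : ∑ k ∈ Finset.Iio s, (J (Equiv.swap s b k) : ℕ) = ∑ k ∈ Finset.Iio s, (J k : ℕ) := by
      refine Finset.sum_congr rfl fun k hk => ?_
      have hk := Finset.mem_Iio.1 hk
      rw [Equiv.swap_apply_of_ne_of_ne hk.ne]
      intro h; subst h; rw [Fin.lt_def] at hk; omega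
    rw [h1, Function.update_of_ne hne, Function.update_self, hJ]
    refine neg_one_pow_congr ?_
    generalize ∑ k ∈ Finset.Iio s, (J k : ℕ) = N
    have e : (N + (J s : ℕ)) * ((i : ℕ) + j) + (J s : ℕ) * j =
      (J s : ℕ) * i + N * (i + j) + 2 * (J s * j) := by ring
    rw [e]; omega
  by_cases hsb : s = b
  · subst hsb
    rw [Equiv.swap_apply_right] at hJ ⊢
    have h1 : ∑ k ∈ Finset.Iio s, (J (Equiv.swap a s k) : ℕ) =
        (∑ k ∈ Finset.Iio a, (J k : ℕ)) + J s := by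
      have := sum_Iio_succ hab (J ∘ Equiv.swap a s)
      simp only [Function.comp_apply, Equiv.swap_apply_left] at this
      rw [this]
      congr 1
      refine Finset.sum_congr rfl fun k hk => ?_
      have hk := Finset.mem_Iio.1 hk
      rw [Equiv.swap_apply_of_ne_of_ne hk.ne]
      intro h; subst h; rw [Fin.lt_def] at hk; omega
    rw [h1, Function.update_of_ne hne.symm, Function.update_self, hJ]
    refine neg_one_pow_congr ?_
    generalize ∑ k ∈ Finset.Iio a, (J k : ℕ) = N
    have e : (i : ℕ) * (J s) + (N + (J s : ℕ)) * ((i : ℕ) + j) =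
      N * (i + j) + j * J s + 2 * (i * J s) := by ring
    rw [e]; omega
  · rw [Equiv.swap_apply_of_ne_of_ne hsa hsb, Function.update_of_ne (Ne.symm hsa),
      Function.update_of_ne (Ne.symm hsb)]
    have := sum_Iio_comp_swap hab hsa hsb J
    simp only [Function.comp_apply] at this
    rw [this, add_comm]

theorem flipOp_add (n : ℕ) (a b : Fin n) (F G : VPoly n) :
    flipOp n a b (F + G) = flipOp n a b F + flipOp n a b G := by
  funext J; simp [flipOp, mul_add]

theorem flipOp_zero (n : ℕ) (a b : Fin n) : flipOp n a b 0 = 0 := by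
  funext J; simp [flipOp]

theorem flipOp_smul (n : ℕ) (a b : Fin n) (p : MvPolynomial (Fin n) ℂ) (F : VPoly n) :
    flipOp n a b (p • F) = MvPolynomial.rename (Equiv.swap a b) p • flipOp n a b F := by
  funext J; simp [flipOp, mul_left_comm]

theorem flipOp_sum {ι : Type*} (n : ℕ) (a b : Fin n) (S : Finset ι) (F : ι → VPoly n) :
    flipOp n a b (∑ i ∈ S, F i) = ∑ i ∈ S, flipOp n a b (F i) := by
  classical
  induction S using Finset.induction_on with
  | empty => simp [flipOp_zero]
  | insert a S ha ih => rw [Finset.sum_insert ha, flipOp_add, ih, Finset.sum_insert ha]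

/-- The flip carries the summand at `s` to the summand at the transposed site, and exchanges the
variables `z_s` accordingly, so it only permutes the sum over sites. -/
theorem currentOp_mem_VSym {n : ℕ} (i j : Fin 2) (r : ℕ) {F : VPoly n} (hF : F ∈ VSym n) :
    currentOp n i j r F ∈ VSym n := by
  intro a b hab
  have h : ∀ G, currentOp n i j r G =
      ∑ s : Fin n, (MvPolynomial.X s : MvPolynomial (Fin n) ℂ) ^ r • siteOp n i j s G := by
    intro G
    simp [currentOp, polyOp, LinearMap.sum_apply]
  rw [h, flipOp_sum]
  refine Fintype.sum_equiv (Equiv.swap a b) _ _ fun s => ?_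
  rw [flipOp_smul, flipOp_siteOp n i j s hab, hF a b hab, map_pow, MvPolynomial.rename_X]

theorem smul_mem_VSym {n : ℕ} {p : MvPolynomial (Fin n) ℂ} (hp : p.IsSymmetric) {F : VPoly n}
    (hF : F ∈ VSym n) : p • F ∈ VSym n := by
  intro a b hab
  rw [flipOp_smul, hp, hF a b hab]

theorem vplus_mem_VSym (n : ℕ) : vplus n ∈ VSym n := by
  intro a b _
  funext J
  have h0 : J ∘ Equiv.swap a b = (fun _ => 0) ↔ J = fun _ => 0 := by
    constructor
    · intro h
      funext k
      simpa using congrFun h (Equiv.swap a b k)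
    · rintro rfl; rfl
  by_cases hJ : J = fun _ => 0
  · subst hJ
    rw [flipOp, vplus, h0.2 rfl]
    simp
  · rw [flipOp, vplus, Pi.single_eq_of_ne hJ, Pi.single_eq_of_ne (mt h0.1 hJ)]
    simp

theorem transferOp_mem_VSym {n : ℕ} (m : ℕ) {F : VPoly n} (hF : F ∈ VSym n) :
    transferOp (fun s => (MvPolynomial.X s : MvPolynomial (Fin n) ℂ)) m F ∈ VSym n := by
  rw [transferOp, LinearMap.sum_apply]
  refine sum_mem fun x _ => ?_
  rw [LinearMap.sub_apply, LinearMap.smul_apply, Module.End.mul_apply]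
  refine sub_mem (smul_mem_VSym (MvPolynomial.psum_isSymmetric _ _ x.1) ?_) ?_
  · exact currentOp_mem_VSym 1 1 x.2 hF
  · exact currentOp_mem_VSym 1 0 x.1 (currentOp_mem_VSym 0 1 x.2 hF)

/-! ### The number of particles -/

section Fock

variable {R : Type*} [CommRing R] {n : ℕ}

theorem numOp_creOp (h : Fin n → R) :
    numOp (fun _ => 1) * creOp h = creOp h * numOp (fun _ => 1) + creOp h := by
  have key : ∀ s t : Fin n, fockOp R n 1 1 s * fockOp R n 1 0 t =
      fockOp R n 1 0 t * fockOp R n 1 1 s + if s = t then fockOp R n 1 0 t else 0 := by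
    intro s t
    by_cases h : s = t
    · subst h; simp [fockOp_mul_self]
    · rw [fockOp_mul_of_ne R n 1 1 1 0 h]; simp [h]
  simp only [creOp, numOp, Finset.sum_mul_sum, smul_mul_smul_comm]
  rw [Finset.sum_comm, ← Finset.sum_add_distrib]
  refine Finset.sum_congr rfl fun s _ => ?_
  simp only [key, smul_add, Finset.sum_add_distrib, smul_ite, smul_zero, Finset.sum_ite_eq',
    Finset.mem_univ, if_true, one_mul, mul_one]

theorem numOp_annOp (w : Fin n → R) :
    numOp (fun _ => 1) * annOp w = annOp w * numOp (fun _ => 1) - annOp w := by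
  rw [annOp_numOp]; simp

theorem numOp_comm (h k : Fin n → R) : numOp h * numOp k = numOp k * numOp h := by
  simp only [numOp, Finset.sum_mul_sum, smul_mul_smul_comm]
  rw [Finset.sum_comm]
  refine Finset.sum_congr rfl fun s _ => Finset.sum_congr rfl fun t _ => ?_
  by_cases hst : t = s
  · subst hst; rw [mul_comm]
  · rw [fockOp_mul_of_ne R n 1 1 1 1 hst, mul_comm]
    simp [Even.neg_one_pow (show Even 4 by decide)]

theorem numOp_transferOp (ζ : Fin n → R) (m : ℕ) :
    numOp (fun _ => 1) * transferOp ζ m = transferOp ζ m * numOp fun _ => 1 := by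
  rw [transferOp, Finset.mul_sum, Finset.sum_mul]
  refine Finset.sum_congr rfl fun x _ => ?_
  rw [mul_sub, sub_mul, mul_smul_comm, numOp_comm, smul_mul_assoc, ← mul_assoc, numOp_creOp,
    add_mul, mul_assoc, numOp_annOp, mul_sub, mul_assoc]
  abel

theorem numOp_one_apply (F : Fock R n) (J : Fin n → Fin 2) :
    numOp (fun _ => 1) F J = (∑ s, ((J s : ℕ) : R)) * F J := by
  simp only [numOp, LinearMap.sum_apply, one_smul, Finset.sum_apply, Finset.sum_mul]
  refine Finset.sum_congr rfl fun s _ => ?_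
  have h : J s = 0 ∨ J s = 1 := by have := (J s).isLt; omega
  rcases h with h | h
  · simp [fockOp, h]
  · have e : Function.update J s 1 = J := by rw [← h, Function.update_eq_self]
    simp [fockOp, h, e, mul_comm _ 2, pow_mul]

theorem numOp_creVec (k : ℕ) (h : Fin k → Fin n → R) :
    numOp (fun _ => 1) (creVec k h) = (k : R) • creVec k h := by
  induction k with
  | zero =>
    funext J
    rw [numOp_one_apply]
    by_cases hJ : J = fun _ => 0
    · subst hJ; simp
    · simp [creVec, Pi.single_eq_of_ne hJ]
  | succ k ih =>
    rw [creVec_succ, ← Module.End.mul_apply, numOp_creOp, LinearMap.add_apply,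
      Module.End.mul_apply, ih, map_smul]
    push_cast
    rw [add_smul, one_smul]

end Fock

/-- The condition on `e₁₁[0]` is redundant, since `e₁₁[0] + e₂₂[0]` acts by the zeroth power sum,
which is `n`. -/
theorem mem_M_iff {n l : ℕ} {F : VPoly n} : F ∈ M n l ↔ F ∈ VSym n ∧
    annOp (fun _ => (1 : MvPolynomial (Fin n) ℂ)) F = 0 ∧
    numOp (fun _ => (1 : MvPolynomial (Fin n) ℂ)) F = (l : ℂ) • F := by
  have h1 : act n (e 0 1 0) F = annOp (fun _ => (1 : MvPolynomial (Fin n) ℂ)) F := by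
    rw [act_e, currentOp_ann]; simp
  have h2 : act n (e 1 1 0) F = numOp (fun _ => (1 : MvPolynomial (Fin n) ℂ)) F := by
    rw [act_e, currentOp_num]; simp
  have h3 := currentOp_diag n 0 F
  rw [← act_e, ← act_e, MvPolynomial.psum_zero, Fintype.card_fin] at h3
  have h3' : ((n : ℕ) : MvPolynomial (Fin n) ℂ) • F = (n : ℂ) • F := by
    rw [Nat.cast_smul_eq_nsmul, Nat.cast_smul_eq_nsmul]
  rw [h3'] at h3
  change (F ∈ VSym n ∧ act n (e 0 1 0) F = 0 ∧
    act n (e 0 0 0) F = ((n : ℂ) - l) • F ∧ act n (e 1 1 0) F = (l : ℂ) • F) ↔ _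
  rw [h1, ← h2]
  refine ⟨fun h => ⟨h.1, h.2.1, h.2.2.2⟩, fun h => ⟨h.1, h.2.1, ?_, h.2.2⟩⟩
  rw [sub_smul, ← h.2.2, eq_sub_iff_add_eq, h3]

theorem transferOp_mem_M {n l : ℕ} (m : ℕ) {F : VPoly n} (hF : F ∈ M n l) :
    transferOp (fun s => (MvPolynomial.X s : MvPolynomial (Fin n) ℂ)) m F ∈ M n l := by
  rw [mem_M_iff] at hF ⊢
  refine ⟨transferOp_mem_VSym m hF.1, ?_, ?_⟩
  · rw [← Module.End.mul_apply, annOp_one_transferOp, Module.End.mul_apply, hF.2.1, map_zero]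
  · rw [← Module.End.mul_apply, numOp_transferOp, Module.End.mul_apply, hF.2.2,
      LinearMap.map_smul_of_tower]

theorem smul_mem_M {n l : ℕ} {p : MvPolynomial (Fin n) ℂ} (hp : p.IsSymmetric) {F : VPoly n}
    (hF : F ∈ M n l) : p • F ∈ M n l := by
  rw [mem_M_iff] at hF ⊢
  refine ⟨smul_mem_VSym hp hF.1, ?_, ?_⟩
  · rw [map_smul, hF.2.1, smul_zero]
  · rw [map_smul, hF.2.2, smul_comm]

theorem act_diag (n r : ℕ) (F : VPoly n) :
    act n (e 0 0 r + e 1 1 r) F = MvPolynomial.psum (Fin n) ℂ r • F := by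
  rw [map_add, LinearMap.add_apply, act_e, act_e, currentOp_diag]

/-- The Bethe algebra preserves the space of singular vectors. -/
theorem act_bethe_mem_M {n l : ℕ} {b : CurrentU} (hb : b ∈ bethe) :
    ∀ v ∈ M n l, act n b v ∈ M n l := by
  rw [bethe_eq] at hb
  induction hb using Algebra.adjoin_induction with
  | mem x hx =>
    intro v hv
    rcases hx with ⟨r, rfl⟩ | ⟨m, rfl⟩
    · simp only [act_diag]
      exact smul_mem_M (MvPolynomial.psum_isSymmetric _ _ r) hv
    · simp only [act_coeff_transferSer]
      exact transferOp_mem_M m hv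
  | algebraMap c =>
    intro v hv
    rw [AlgHom.commutes, Module.algebraMap_end_apply]
    exact Submodule.smul_mem _ c hv
  | add x y _ _ hx hy =>
    intro v hv
    rw [map_add, LinearMap.add_apply]
    exact add_mem (hx v hv) (hy v hv)
  | mul x y _ _ hx hy =>
    intro v hv
    rw [map_mul, Module.End.mul_apply]
    exact hx _ (hy v hv)

theorem uvec_eq (n l : ℕ) :
    uvec n l = annOp (fun _ => (1 : MvPolynomial (Fin n) ℂ))
      (creVec (l + 1) fun i s => MvPolynomial.X s ^ (i : ℕ)) := by
  have h : ∀ L : List ℕ, act n ((L.map fun r => e 1 0 r).prod) (vplus n) =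
      ((L.map fun r => creOp fun s => (MvPolynomial.X s : MvPolynomial (Fin n) ℂ) ^ r).prod)
        (vplus n) := by
    intro L
    induction L with
    | nil => simp
    | cons r L ih =>
      simp only [List.map_cons, List.prod_cons, map_mul, Module.End.mul_apply, ih, act_e,
        currentOp_cre]
  rw [uvec, map_mul, Module.End.mul_apply, act_e, currentOp_ann, h, creVec, vplus]
  simp only [pow_zero]
  congr 3
  rw [← List.map_coe_finRange_eq_range, List.map_map, List.ofFn_eq_map]
  rfl

theorem act_list_mem_VSym (n : ℕ) (L : List ℕ) :
    act n ((L.map fun r => e 1 0 r).prod) (vplus n) ∈ VSym n := by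
  induction L with
  | nil => simpa using vplus_mem_VSym n
  | cons r L ih =>
    simp only [List.map_cons, List.prod_cons, map_mul, Module.End.mul_apply, act_e]
    exact currentOp_mem_VSym 1 0 r ih

/-- It is singular because `e₁₂[0]` squares to zero, and of weight `l` because one of the `l + 1`
created fermions is annihilated. -/
theorem uvec_mem_M (n l : ℕ) : uvec n l ∈ M n l := by
  rw [mem_M_iff]
  refine ⟨?_, ?_, ?_⟩
  · rw [uvec, map_mul, Module.End.mul_apply, act_e]
    exact currentOp_mem_VSym 0 1 0 (act_list_mem_VSym n _)
  · rw [uvec_eq, ← Module.End.mul_apply, annOp_sq]; rfl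
  · rw [uvec_eq, ← Module.End.mul_apply, numOp_annOp, LinearMap.sub_apply, Module.End.mul_apply,
      numOp_creVec, map_smul]
    push_cast
    rw [add_smul, one_smul, add_sub_cancel_right, Nat.cast_smul_eq_nsmul, Nat.cast_smul_eq_nsmul]

/-! ### Equivariance of `hat` -/

theorem vac_flipOp (n : ℕ) (a b : Fin n) (F : VPoly n) :
    vac (flipOp n a b F) = MvPolynomial.rename (Equiv.swap a b) (vac F) := by
  simp [vac, flipOp]
  rfl

theorem hat_flipOp (n k : ℕ) {a b : Fin n} (hab : (b : ℕ) = a + 1) (F : VPoly n)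
    (t : Fin k → Fin n) :
    hat k (flipOp n a b F) (fun j => Pi.single (Equiv.swap a b (t j)) 1) =
      MvPolynomial.rename (Equiv.swap a b) (hat k F fun j => Pi.single (t j) 1) := by
  induction k generalizing F with
  | zero => rw [hat_zero, hat_zero, vac_flipOp]
  | succ k ih =>
    rw [hat_succ, hat_succ, annOp_single, annOp_single, ← ih (fockOp _ n 0 1 (t 0) F)]
    congr 1
    exact congrArg (hat k) (flipOp_siteOp n 0 1 (t 0) hab F).symm

/-- Adjacent transpositions generate the symmetric group, and `hat_flipOp` treats each of them. No
sign is left: the Koszul signs of the flips are absorbed by the order of the arguments of `hat`. -/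
theorem hat_perm {n k : ℕ} {F : VPoly n} (hF : F ∈ VSym n) (π : Equiv.Perm (Fin n))
    (t : Fin k → Fin n) :
    MvPolynomial.rename π (hat k F fun j => Pi.single (t j) 1) =
      hat k F fun j => Pi.single (π (t j)) 1 := by
  cases n with
  | zero =>
    rw [Subsingleton.elim π 1]
    simp
  | succ n =>
    have hπ : π ∈ Submonoid.closure
        (Set.range fun i : Fin n => Equiv.swap i.castSucc i.succ) := by
      rw [Equiv.Perm.mclosure_swap_castSucc_succ]; trivial
    induction hπ using Submonoid.closure_induction generalizing t with
    | mem x hx =>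
      obtain ⟨i, rfl⟩ := hx
      have := hat_flipOp (n + 1) k (a := i.castSucc) (b := i.succ) (by simp) F t
      rw [hF _ _ (by simp)] at this
      exact this.symm
    | one => simp
    | mul x y _ _ hx hy =>
      have : (⇑(x * y) : Fin (n + 1) → Fin (n + 1)) = x ∘ y := rfl
      rw [this, ← MvPolynomial.rename_rename, hy, hx]
      rfl

/-- A vector of weight `l` is determined by `hat l`. -/
theorem eq_zero_of_hat {n l : ℕ} {F : VPoly n}
    (hw : numOp (fun _ => (1 : MvPolynomial (Fin n) ℂ)) F = (l : ℂ) • F)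
    (h : ∀ t : Fin l → Fin n, hat l F (fun j => Pi.single (t j) 1) = 0) : F = 0 := by
  classical
  funext J
  -- The number operator multiplies the coordinate `F J` by the number of occupied sites, so that
  -- coordinate vanishes unless this number is `l`.
  have hJ := congrFun hw J
  rw [numOp_one_apply, Pi.smul_apply, MvPolynomial.smul_eq_C_mul, map_natCast, ← sub_eq_zero,
    ← sub_mul, mul_eq_zero, ← Nat.cast_sum, sub_eq_zero, Nat.cast_inj] at hJ
  rcases hJ with hJ | hJ
  swap
  · exact hJ
  have hcard : (Finset.univ.filter fun s => J s = 1).card = l := by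
    rw [← hJ, Finset.card_filter]
    refine Finset.sum_congr rfl fun s _ => ?_
    have h : J s = 0 ∨ J s = 1 := by have := (J s).isLt; omega
    rcases h with h | h <;> simp [h]
  let t := (Finset.univ.filter fun s => J s = 1).orderEmbOfFin hcard
  obtain ⟨ε, hε⟩ := hat_basis l F t t.injective
  have hJt : (fun s => if s ∈ Set.range t then (1 : Fin 2) else 0) = J := by
    funext s
    have : s ∈ Set.range t ↔ J s = 1 := by
      simp [t, Finset.range_orderEmbOfFin]
    have h : J s = 0 ∨ J s = 1 := by have := (J s).isLt; omega
    rcases h with h | h <;> simp only [this, h] <;> simp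
  rw [h] at hε
  have hεJ : (-1) ^ ε * F J = 0 := by rw [hε, ← hJt]
  simpa using hεJ

/-! ### Symmetric and alternating polynomials -/

section Symmetric

variable {R : Type*} [CommRing R] [Algebra ℂ R]

/-- Newton's identities, solved for the elementary symmetric polynomial; the division by `k` uses
the scalars `ℂ`. -/
theorem esymm_mem_of_psum_mem {σ : Type*} [Fintype σ] [DecidableEq σ]
    (S : Subalgebra ℂ (MvPolynomial σ R)) (h : ∀ k, MvPolynomial.psum σ R k ∈ S) (k : ℕ) :
    MvPolynomial.esymm σ R k ∈ S := by
  induction k using Nat.strong_induction_on with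
  | _ k ih =>
    rcases Nat.eq_zero_or_pos k with rfl | hk
    · rw [MvPolynomial.esymm_zero]; exact one_mem _
    · have hN := MvPolynomial.mul_esymm_eq_sum σ R k
      have hmem : (k : MvPolynomial σ R) * MvPolynomial.esymm σ R k ∈ S := by
        rw [hN]
        refine mul_mem (pow_mem (neg_mem (one_mem _)) _) (sum_mem fun a ha => ?_)
        exact mul_mem (mul_mem (pow_mem (neg_mem (one_mem _)) _)
          (ih _ (Finset.mem_filter.1 ha).2)) (h _)
      have : MvPolynomial.esymm σ R k =
          ((k : ℂ)⁻¹) • ((k : MvPolynomial σ R) * MvPolynomial.esymm σ R k) := by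
        have hk' : (k : ℂ) ≠ 0 := Nat.cast_ne_zero.2 hk.ne'
        rw [← nsmul_eq_mul, ← Nat.cast_smul_eq_nsmul ℂ, smul_smul, inv_mul_cancel₀ hk', one_smul]
      rw [this]
      exact S.smul_mem hmem _

theorem mem_of_isSymmetric {m : ℕ} (S : Subalgebra ℂ (MvPolynomial (Fin m) R))
    (hC : ∀ r, MvPolynomial.C r ∈ S) (h : ∀ k, MvPolynomial.psum (Fin m) R k ∈ S)
    {p : MvPolynomial (Fin m) R} (hp : p.IsSymmetric) : p ∈ S := by
  obtain ⟨q, hq⟩ := (MvPolynomial.esymmAlgEquiv (Fin m) R (Fintype.card_fin m)).surjective ⟨p, hp⟩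
  have hq' : MvPolynomial.aeval (fun i : Fin m => MvPolynomial.esymm (Fin m) R (i + 1)) q = p := by
    rw [← MvPolynomial.esymmAlgHom_apply]
    exact congrArg Subtype.val hq
  rw [← hq']
  induction q using MvPolynomial.induction_on generalizing p with
  | C r => rw [MvPolynomial.aeval_C]; exact hC r
  | add a b ha hb =>
    rw [map_add]
    refine add_mem (ha (MvPolynomial.esymmAlgHom (Fin m) R m a).2 ?_ ?_)
      (hb (MvPolynomial.esymmAlgHom (Fin m) R m b).2 ?_ ?_)
    all_goals first | rfl | skip
    all_goals rw [← MvPolynomial.esymmAlgHom_apply]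
  | mul_X a i ha =>
    rw [map_mul, MvPolynomial.aeval_X]
    refine mul_mem (ha (MvPolynomial.esymmAlgHom (Fin m) R m a).2 ?_ ?_)
      (esymm_mem_of_psum_mem S h _)
    · rfl
    · rw [← MvPolynomial.esymmAlgHom_apply]

end Symmetric

/-- As a polynomial in the first `m` variables over the ring of the other ones, `q` is symmetric.
The power sums of the first `m` variables are the full power sums minus powers of the others. -/
theorem mem_of_fixed_sum {m l : ℕ} (B : Subalgebra ℂ (MvPolynomial (Fin m ⊕ Fin l) ℂ))
    (hX : ∀ i, MvPolynomial.X (Sum.inr i) ∈ B)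
    (hp : ∀ k, MvPolynomial.psum (Fin m ⊕ Fin l) ℂ k ∈ B) {q : MvPolynomial (Fin m ⊕ Fin l) ℂ}
    (hq : ∀ π : Equiv.Perm (Fin m), MvPolynomial.rename (Sum.map π id) q = q) : q ∈ B := by
  let E := MvPolynomial.sumAlgEquiv ℂ (Fin m) (Fin l)
  have hsymm : (E q).IsSymmetric := by
    intro π
    conv_rhs => rw [← hq π]
    have : ((MvPolynomial.rename π :
        MvPolynomial (Fin m) (MvPolynomial (Fin l) ℂ) →ₐ[MvPolynomial (Fin l) ℂ] _).restrictScalars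
          ℂ).comp E.toAlgHom = E.toAlgHom.comp (MvPolynomial.rename (Sum.map π id)) := by
      refine MvPolynomial.algHom_ext fun i => ?_
      rcases i with i | i <;> simp [E]
    exact congrArg (fun f => f q) this
  have hC : ∀ r, MvPolynomial.C r ∈ B.comap E.symm.toAlgHom := by
    intro r
    change E.symm (MvPolynomial.C r) ∈ B
    induction r using MvPolynomial.induction_on with
    | C c =>
      have : E.symm (MvPolynomial.C (MvPolynomial.C c)) = algebraMap ℂ _ c := by
        rw [AlgEquiv.symm_apply_eq, AlgEquiv.commutes]; rfl
      rw [this]; exact B.algebraMap_mem c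
    | add a b ha hb =>
      rw [map_add, map_add]
      exact add_mem ha hb
    | mul_X a i ha =>
      have : E.symm (MvPolynomial.C (MvPolynomial.X i)) = MvPolynomial.X (Sum.inr i) := by
        rw [AlgEquiv.symm_apply_eq]; simp [E]
      rw [map_mul, map_mul, this]
      exact mul_mem ha (hX i)
  have hps : ∀ k, MvPolynomial.psum (Fin m) (MvPolynomial (Fin l) ℂ) k ∈
      B.comap E.symm.toAlgHom := by
    intro k
    change E.symm _ ∈ B
    have : E.symm (MvPolynomial.psum (Fin m) (MvPolynomial (Fin l) ℂ) k) =
        MvPolynomial.psum (Fin m ⊕ Fin l) ℂ k - ∑ i, MvPolynomial.X (Sum.inr i) ^ k := by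
      rw [AlgEquiv.symm_apply_eq]
      simp [E, MvPolynomial.psum]
    rw [this]
    exact sub_mem (hp k) (sum_mem fun i _ => pow_mem (hX i) k)
  have := mem_of_isSymmetric (B.comap E.symm.toAlgHom) hC hps hsymm
  change E.symm (E q) ∈ B at this
  rwa [E.symm_apply_apply] at this

/-- A polynomial invariant under the permutations that fix the first `l` variables is a polynomial
in these variables and the power sums. -/
theorem mem_of_fixed {n l : ℕ} (hl : l ≤ n) (B : Subalgebra ℂ (MvPolynomial (Fin n) ℂ))
    (hX : ∀ i : Fin l, MvPolynomial.X (Fin.castLE hl i) ∈ B)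
    (hp : ∀ k, MvPolynomial.psum (Fin n) ℂ k ∈ B) {q : MvPolynomial (Fin n) ℂ}
    (hq : ∀ π : Equiv.Perm (Fin n), (∀ i : Fin l, π (Fin.castLE hl i) = Fin.castLE hl i) →
      MvPolynomial.rename π q = q) : q ∈ B := by
  obtain ⟨m, rfl⟩ := Nat.exists_eq_add_of_le hl
  let ε : Fin m ⊕ Fin l ≃ Fin (l + m) := (Equiv.sumComm _ _).trans finSumFinEquiv
  have hε : ∀ i : Fin l, ε (Sum.inr i) = Fin.castLE hl i := fun i => by
    ext; simp [ε]
  have := mem_of_fixed_sum (B.comap (MvPolynomial.rename ε)) (fun i => ?_) (fun k => ?_)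
    (q := MvPolynomial.rename ε.symm q) fun π => ?_
  · change MvPolynomial.rename ε (MvPolynomial.rename ε.symm q) ∈ B at this
    rwa [MvPolynomial.rename_rename, Equiv.self_comp_symm, MvPolynomial.rename_id_apply] at this
  · change MvPolynomial.rename ε (MvPolynomial.X _) ∈ B
    rw [MvPolynomial.rename_X, hε]
    exact hX i
  · change MvPolynomial.rename ε (MvPolynomial.psum _ ℂ k) ∈ B
    rw [MvPolynomial.rename_psum]
    exact hp k
  · let πτ : Equiv.Perm (Fin (l + m)) := (ε.symm.trans (Equiv.sumCongr π 1)).trans ε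
    have h := hq πτ fun i => by
      rw [← hε]
      simp [πτ]
    conv_rhs => rw [← h]
    rw [MvPolynomial.rename_rename, MvPolynomial.rename_rename]
    congr 2
    funext s
    simp [πτ]

/-- The polynomial ring in place of the elementary symmetric polynomials. -/
abbrev SymRing (n : ℕ) : Type := MvPolynomial (Fin n) ℂ

/-- The isomorphism of `SymRing` with the symmetric polynomials, as a map to all polynomials. -/
def symToPoly (n : ℕ) : SymRing n →ₐ[ℂ] MvPolynomial (Fin n) ℂ :=
  MvPolynomial.aeval fun j : Fin n => MvPolynomial.esymm (Fin n) ℂ (j + 1)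

theorem exists_symToPoly {n : ℕ} {p : MvPolynomial (Fin n) ℂ} (hp : p.IsSymmetric) :
    ∃ a, symToPoly n a = p := by
  obtain ⟨q, hq⟩ := (MvPolynomial.esymmAlgEquiv (Fin n) ℂ (Fintype.card_fin n)).surjective ⟨p, hp⟩
  refine ⟨q, ?_⟩
  rw [symToPoly, ← MvPolynomial.esymmAlgHom_apply]
  exact congrArg Subtype.val hq

/-- Substitution of `z_{t 1}, …, z_{t l}` in a polynomial with symmetric coefficients. -/
def substAt {n l : ℕ} (t : Fin l → Fin n) :
    MvPolynomial (Fin l) (SymRing n) →+* MvPolynomial (Fin n) ℂ :=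
  MvPolynomial.eval₂Hom (symToPoly n).toRingHom fun i => MvPolynomial.X (t i)

theorem substAt_rename {n l : ℕ} (t : Fin l → Fin n) (σ : Equiv.Perm (Fin l))
    (P : MvPolynomial (Fin l) (SymRing n)) :
    substAt t (MvPolynomial.rename σ P) = substAt (t ∘ σ) P := by
  simp only [substAt, MvPolynomial.coe_eval₂Hom, MvPolynomial.eval₂_rename]
  rfl

theorem rename_symToPoly {n : ℕ} (π : Equiv.Perm (Fin n)) (a : SymRing n) :
    MvPolynomial.rename π (symToPoly n a) = symToPoly n a := by
  have : (MvPolynomial.rename π).comp (symToPoly n) = symToPoly n := by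
    refine MvPolynomial.algHom_ext fun i => ?_
    simp [symToPoly, MvPolynomial.rename_esymm]
  exact congrArg (fun f => f a) this

theorem rename_substAt {n l : ℕ} (t : Fin l → Fin n) (π : Equiv.Perm (Fin n))
    (P : MvPolynomial (Fin l) (SymRing n)) :
    MvPolynomial.rename π (substAt t P) = substAt (π ∘ t) P := by
  have : (MvPolynomial.rename π : MvPolynomial (Fin n) ℂ →ₐ[ℂ] _).toRingHom.comp (substAt t) =
      substAt (π ∘ t) := by
    refine MvPolynomial.ringHom_ext (fun a => ?_) fun i => ?_
    · simp [substAt, rename_symToPoly]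
    · simp [substAt]
  exact congrArg (fun f => f P) this

/-- The signed sum over all permutations of the variables. -/
def alternization {R : Type*} [CommRing R] {l : ℕ} (P : MvPolynomial (Fin l) R) :
    MvPolynomial (Fin l) R :=
  ∑ σ : Equiv.Perm (Fin l), Equiv.Perm.sign σ • MvPolynomial.rename σ P

theorem rename_alternization {R : Type*} [CommRing R] {l : ℕ} (P : MvPolynomial (Fin l) R)
    (σ : Equiv.Perm (Fin l)) :
    MvPolynomial.rename σ (alternization P) = Equiv.Perm.sign σ • alternization P := by
  rw [alternization, map_sum, Finset.smul_sum]
  refine Fintype.sum_equiv (Equiv.mulLeft σ) _ _ fun τ => ?_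
  rw [Equiv.coe_mulLeft, Equiv.Perm.sign_mul, smul_smul, ← mul_assoc, Int.units_mul_self,
    one_mul, Units.smul_def, map_zsmul, MvPolynomial.rename_rename]
  rfl

/-- The coordinates of a symmetric vector are the values of an alternating polynomial with
symmetric coefficients. -/
theorem exists_alternating {n l : ℕ} (hl : l ≤ n) {F : VPoly n} (hF : F ∈ VSym n) :
    ∃ P : MvPolynomial (Fin l) (SymRing n),
      (∀ σ : Equiv.Perm (Fin l), MvPolynomial.rename σ P = Equiv.Perm.sign σ • P) ∧
      ∀ t : Fin l → Fin n, substAt t P = hat l F fun j => Pi.single (t j) 1 := by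
  classical
  -- The polynomials in the first `l` variables with symmetric coefficients.
  let B : Subalgebra ℂ (MvPolynomial (Fin n) ℂ) :=
    { (substAt (Fin.castLE hl)).range with
      algebraMap_mem' := fun c => ⟨MvPolynomial.C (MvPolynomial.C c), by
        simp [substAt]⟩ }
  have hB : hat l F (fun j => Pi.single (Fin.castLE hl j) 1) ∈ B := by
    refine mem_of_fixed hl B (fun i => ⟨MvPolynomial.X i, by simp [substAt]⟩) (fun k => ?_) ?_
    · obtain ⟨a, ha⟩ := exists_symToPoly (MvPolynomial.psum_isSymmetric (Fin n) ℂ k)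
      exact ⟨MvPolynomial.C a, by simp [substAt, ha]⟩
    · intro π hπ
      rw [hat_perm hF]
      simp only [hπ]
  obtain ⟨P, hP⟩ := hB
  -- The symmetric group acts transitively on injective `l`-tuples, so the polynomial found at the
  -- first `l` sites gives the coordinates at every tuple of distinct sites.
  have hinj : ∀ t : Fin l → Fin n, Function.Injective t →
      substAt t P = hat l F fun j => Pi.single (t j) 1 := by
    intro t ht
    have := Equiv.Perm.isMultiplyPretransitive (Fin n) l
    obtain ⟨π, hπ⟩ := MulAction.exists_smul_eq (Equiv.Perm (Fin n))
      (Fin.castLEEmb hl : Fin l ↪ Fin n) ⟨t, ht⟩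
    have hπτ : ∀ j, π (Fin.castLE hl j) = t j := fun j => congrArg (fun f => f j) hπ
    have h1 := rename_substAt (Fin.castLE hl) π P
    have h2 : (π ∘ Fin.castLE hl) = t := funext hπτ
    change substAt _ P = _ at hP
    rw [hP, hat_perm hF, h2] at h1
    rw [← h1]
    simp only [hπτ]
  -- The polynomial `P` itself need not be alternating. Its signed average has the same values at
  -- injective tuples, because `hat` is alternating; this explains the factor `1 / l!`.
  let c : MvPolynomial (Fin l) (SymRing n) := MvPolynomial.C (MvPolynomial.C (Nat.factorial l : ℂ)⁻¹)
  have halt : ∀ σ : Equiv.Perm (Fin l), MvPolynomial.rename σ (c * alternization P) =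
      Equiv.Perm.sign σ • (c * alternization P) := by
    intro σ
    rw [map_mul, rename_alternization, MvPolynomial.rename_C, mul_smul_comm]
  refine ⟨c * alternization P, halt, fun t => ?_⟩
  by_cases ht : Function.Injective t
  · have e2 : ∀ σ : Equiv.Perm (Fin l), substAt t (Equiv.Perm.sign σ • MvPolynomial.rename σ P) =
        hat l F fun j => Pi.single (t j) 1 := by
      intro σ
      rw [Units.smul_def, map_zsmul, substAt_rename, hinj _ (ht.comp σ.injective)]
      have := (hat l F).map_perm (fun j => Pi.single (t j) 1) σ
      simp only [Function.comp_def] at this ⊢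
      rw [this, ← Units.smul_def, smul_smul, Int.units_mul_self, one_smul]
    have e3 : substAt t c = MvPolynomial.C (Nat.factorial l : ℂ)⁻¹ := by
      simp [substAt, c, MvPolynomial.algebraMap_eq]
    rw [map_mul, e3, alternization, map_sum, Finset.sum_congr rfl fun σ _ => e2 σ, Finset.sum_const,
      Finset.card_univ, Fintype.card_perm, Fintype.card_fin, nsmul_eq_mul, ← mul_assoc,
      ← map_natCast MvPolynomial.C, ← map_mul, inv_mul_cancel₀, map_one, one_mul]
    exact Nat.cast_ne_zero.2 (Nat.factorial_ne_zero l)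
  -- At a repeated site both sides vanish by alternation.
  · obtain ⟨i, j, hij, hne⟩ : ∃ i j, t i = t j ∧ i ≠ j := by
      simpa [Function.Injective] using ht
    rw [AlternatingMap.map_eq_zero_of_eq (hat l F) (fun j => Pi.single (t j) 1) (i := i) (j := j)
      (by simp [hij]) hne]
    have h := congrArg (substAt t) (halt (Equiv.swap i j))
    rw [substAt_rename, Equiv.Perm.sign_swap hne, Units.smul_def] at h
    have ht' : t ∘ Equiv.swap i j = t := by
      funext k
      rw [Function.comp_apply, Equiv.swap_apply_def]
      split_ifs with h1 h2
      · rw [h1, hij]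
      · rw [h2, hij]
      · rfl
    rw [ht'] at h
    simpa [eq_neg_iff_add_eq_zero, ← two_mul] using h

section Alternating

variable {R : Type*} [CommRing R] [IsDomain R] {l : ℕ}

/-- The Vandermonde product. -/
def vdm {S : Type*} [CommRing S] {l : ℕ} (x : Fin l → S) : S := (Matrix.vandermonde x).det

theorem vdm_perm {S : Type*} [CommRing S] (x : Fin l → S) (σ : Equiv.Perm (Fin l)) :
    vdm (x ∘ σ) = Equiv.Perm.sign σ • vdm x := by
  rw [vdm, vdm, Units.smul_def, zsmul_eq_mul, ← Matrix.det_permute]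
  rfl

/-- A shear automorphism of the polynomial ring carries the variable `X i` to this difference. -/
theorem prime_X_sub_X {i j : Fin l} (hij : i ≠ j) :
    Prime (MvPolynomial.X i - MvPolynomial.X j : MvPolynomial (Fin l) R) := by
  let f : MvPolynomial (Fin l) R →ₐ[R] MvPolynomial (Fin l) R :=
    MvPolynomial.aeval fun k => if k = i then MvPolynomial.X i + MvPolynomial.X j else MvPolynomial.X k
  let g : MvPolynomial (Fin l) R →ₐ[R] MvPolynomial (Fin l) R :=
    MvPolynomial.aeval fun k => if k = i then MvPolynomial.X i - MvPolynomial.X j else MvPolynomial.X k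
  have hfg : f.comp g = AlgHom.id R _ := by
    refine MvPolynomial.algHom_ext fun k => ?_
    by_cases hk : k = i
    · subst hk; simp [f, g, hij.symm]
    · simp [f, g, hk]
  have hgf : g.comp f = AlgHom.id R _ := by
    refine MvPolynomial.algHom_ext fun k => ?_
    by_cases hk : k = i
    · subst hk; simp [f, g, hij.symm]
    · simp [f, g, hk]
  have := (MulEquiv.prime_iff (AlgEquiv.ofAlgHom g f hgf hfg)).2
    (MvPolynomial.X_prime (R := R) (i := i))
  simpa [g] using this

/-- The substitution `X i ↦ X j` changes a polynomial by a multiple of `X i - X j`, and it turns an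
alternating polynomial into its own negative. -/
theorem X_sub_X_dvd_of_alternating [CharZero R] {P : MvPolynomial (Fin l) R}
    (hP : ∀ σ : Equiv.Perm (Fin l), MvPolynomial.rename σ P = Equiv.Perm.sign σ • P)
    {i j : Fin l} (hij : i ≠ j) : (MvPolynomial.X i - MvPolynomial.X j) ∣ P := by
  let f : MvPolynomial (Fin l) R →ₐ[R] MvPolynomial (Fin l) R :=
    MvPolynomial.aeval fun k => if k = i then MvPolynomial.X j else MvPolynomial.X k
  have hmod : ∀ Q : MvPolynomial (Fin l) R, (MvPolynomial.X i - MvPolynomial.X j) ∣ Q - f Q := by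
    intro Q
    induction Q using MvPolynomial.induction_on with
    | C c => simp [f]
    | add a b ha hb =>
      rw [map_add, add_sub_add_comm]; exact dvd_add ha hb
    | mul_X a k ha =>
      have : a * MvPolynomial.X k - f (a * MvPolynomial.X k) =
          (a - f a) * MvPolynomial.X k + f a * (MvPolynomial.X k - f (MvPolynomial.X k)) := by
        rw [map_mul]; ring
      rw [this]
      refine dvd_add (ha.mul_right _) (Dvd.dvd.mul_left ?_ _)
      by_cases hk : k = i
      · subst hk; simp [f]
      · simp [f, hk]
  have hz : f P = 0 := by
    have h := congrArg f (hP (Equiv.swap i j))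
    have hf : f.comp (MvPolynomial.rename (Equiv.swap i j)) = f := by
      refine MvPolynomial.algHom_ext fun k => ?_
      simp only [AlgHom.comp_apply, MvPolynomial.rename_X, f, MvPolynomial.aeval_X]
      rw [Equiv.swap_apply_def]
      by_cases h1 : k = i
      · simp [h1]
      · by_cases h2 : k = j
        · simp [h2]
        · simp [h1, h2]
    have hf' : f (MvPolynomial.rename (Equiv.swap i j) P) = f P := congrArg (fun f => f P) hf
    rw [hf', Equiv.Perm.sign_swap hij, Units.smul_def] at h
    simpa [eq_neg_iff_add_eq_zero, ← two_mul] using h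
  have := hmod P
  rwa [hz, sub_zero] at this

/-- Alternating polynomials are the products of symmetric ones with the Vandermonde product. -/
theorem exists_eq_vdm_mul [UniqueFactorizationMonoid R] [CharZero R] {P : MvPolynomial (Fin l) R}
    (hP : ∀ σ : Equiv.Perm (Fin l), MvPolynomial.rename σ P = Equiv.Perm.sign σ • P) :
    ∃ S : MvPolynomial (Fin l) R, S.IsSymmetric ∧ P = vdm MvPolynomial.X * S := by
  have hv : (vdm MvPolynomial.X : MvPolynomial (Fin l) R) =
      ∏ p ∈ (Finset.univ : Finset (Fin l × Fin l)).filter (fun p => p.1 < p.2),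
        (MvPolynomial.X p.2 - MvPolynomial.X p.1) := by
    rw [vdm, Matrix.det_vandermonde, Finset.prod_sigma', ]
    refine Finset.prod_bij' (fun p _ => (p.1, p.2)) (fun p _ => ⟨p.1, p.2⟩) ?_ ?_ ?_ ?_ ?_ <;> simp
  have hdvd : (vdm MvPolynomial.X : MvPolynomial (Fin l) R) ∣ P := by
    rw [hv]
    refine Finset.prod_dvd_of_isRelPrime ?_ fun p hp =>
      X_sub_X_dvd_of_alternating hP (Finset.mem_filter.1 hp).2.ne'
    rintro ⟨i, j⟩ hp ⟨i', j'⟩ hp' hne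
    have hp : i < j := by simpa using hp
    have hp' : i' < j' := by simpa using hp'
    refine ((prime_X_sub_X hp.ne').irreducible.isRelPrime_iff_not_dvd).2 fun hd => ?_
    -- Identifying the two variables of one factor kills that factor and no other factor of the
    -- Vandermonde product.
    let f : MvPolynomial (Fin l) R →ₐ[R] MvPolynomial (Fin l) R :=
      MvPolynomial.aeval fun k => if k = j then MvPolynomial.X i else MvPolynomial.X k
    have h0 : f (MvPolynomial.X j' - MvPolynomial.X i') = 0 := by
      obtain ⟨c, hc⟩ := hd
      simp only at hc
      rw [hc, map_mul]
      simp [f]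
    simp only [f, map_sub, MvPolynomial.aeval_X, sub_eq_zero] at h0
    split_ifs at h0 with h1 h2 h2 <;> have h0 := MvPolynomial.X_injective h0 <;> subst_vars <;>
      simp_all [lt_asymm]
  obtain ⟨S, hS⟩ := hdvd
  refine ⟨S, fun σ => ?_, hS⟩
  have hv0 : (vdm MvPolynomial.X : MvPolynomial (Fin l) R) ≠ 0 :=
    Matrix.det_vandermonde_ne_zero_iff.2 MvPolynomial.X_injective
  have h := hP σ
  have hr : MvPolynomial.rename σ (vdm MvPolynomial.X : MvPolynomial (Fin l) R) =
      Equiv.Perm.sign σ • vdm MvPolynomial.X := by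
    rw [← vdm_perm, vdm, AlgHom.map_det]
    rw [vdm]
    congr 1
    ext i j
    simp [Matrix.vandermonde]
  rw [hS, map_mul, hr, smul_mul_assoc, Units.smul_def, Units.smul_def] at h
  rcases Int.units_eq_one_or (Equiv.Perm.sign σ) with hs | hs <;> rw [hs] at h <;>
    simpa [hv0] using h

end Alternating

/-! ### Central elements -/

/-- The sum is the identity matrix times `t ^ r`. It suffices to commute it with the generators, and
it is even, so no signs occur. -/
theorem diag_mem_center (r : ℕ) : e 0 0 r + e 1 1 r ∈ Subalgebra.center ℂ CurrentU := by
  have hgen : ∀ (k l : Fin 2) (s : ℕ), Commute (e k l s) (e 0 0 r + e 1 1 r) := by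
    intro k l s
    have h0 := e_supercomm k l 0 0 s r
    have h1 := e_supercomm k l 1 1 s r
    have hz : ∀ a b c d : CurrentU, a - b = c → (c = d) → a = b + d := by
      intro a b c d h1 h2; rw [← h2, ← h1]; abel
    have e0 : e k l s * e 0 0 r = e 0 0 r * e k l s + _ := hz _ _ _ _ (by simpa using h0) rfl
    have e1 : e k l s * e 1 1 r = e 1 1 r * e k l s + _ := hz _ _ _ _ (by simpa using h1) rfl
    rw [commute_iff_eq, mul_add, add_mul, e0, e1]
    have h01 : (0 : Fin 2) ≠ 1 := by decide
    have hk : k = 0 ∨ k = 1 := by have := k.isLt; omega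
    have hl : l = 0 ∨ l = 1 := by have := l.isLt; omega
    rcases hk with rfl | rfl <;> rcases hl with rfl | rfl <;>
      simp [h01, h01.symm] <;> abel
  rw [Subalgebra.mem_center_iff]
  intro b
  obtain ⟨b, rfl⟩ := RingQuot.mkAlgHom_surjective ℂ CurrentRel b
  induction b using FreeAlgebra.induction with
  | grade0 c => rw [AlgHom.commutes, Algebra.commutes]
  | grade1 x => exact hgen x.1 x.2.1 x.2.2
  | mul a b ha hb => rw [map_mul, mul_assoc, hb, ← mul_assoc, ha, mul_assoc]
  | add a b ha hb => rw [map_add, add_mul, ha, hb, ← mul_add]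

/-- The elements `e₁₁[r] + e₂₂[r]` act by power sums, and Newton's identities do the rest. This lift
also lies in the Bethe algebra, which is not part of `IsCentralLift`; it serves to show that the
`Σ_j` are eigenvalues of `𝓑_l`. -/
theorem exists_centralLift (n : ℕ) : ∃ C : ℕ → CurrentU, IsCentralLift n C ∧ ∀ j, C j ∈ bethe := by
  let S : Subalgebra ℂ (MvPolynomial (Fin n) ℂ) :=
    { carrier := {p | ∃ c ∈ Subalgebra.center ℂ CurrentU ⊓ bethe, ∀ F : VPoly n, act n c F = p • F}
      mul_mem' := by
        rintro p q ⟨c, hc, hp⟩ ⟨d, hd, hq⟩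
        refine ⟨c * d, mul_mem hc hd, fun F => ?_⟩
        rw [map_mul, Module.End.mul_apply, hq, hp, smul_smul]
      add_mem' := by
        rintro p q ⟨c, hc, hp⟩ ⟨d, hd, hq⟩
        refine ⟨c + d, add_mem hc hd, fun F => ?_⟩
        rw [map_add, LinearMap.add_apply, hq, hp, add_smul]
      algebraMap_mem' := fun c => ⟨algebraMap ℂ _ c, Subalgebra.algebraMap_mem _ c, fun F => by
        rw [AlgHom.commutes, Module.algebraMap_end_apply, algebraMap_smul]⟩ }
  have hS : ∀ k, MvPolynomial.psum (Fin n) ℂ k ∈ S := fun k => by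
    refine ⟨e 0 0 k + e 1 1 k, ⟨diag_mem_center k, ?_⟩, act_diag n k⟩
    rw [bethe_eq]
    exact Algebra.subset_adjoin (Or.inl ⟨k, rfl⟩)
  choose C hC hact using fun k => esymm_mem_of_psum_mem S hS k
  exact ⟨C, fun j _ _ => ⟨(hC j).1, fun v _ => hact j v⟩, fun j => (hC j).2⟩

/-! ### Generators of `𝓞_l` -/

/-- `x^m + ∑ a_i x^{m-i-1}`. -/
def monicPoly {R : Type*} [CommRing R] {m : ℕ} (a : Fin m → R) : Polynomial R :=
  Polynomial.X ^ m + ∑ i : Fin m, Polynomial.C (a i) * Polynomial.X ^ (m - ((i : ℕ) + 1))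

/-- `1 + ∑ a_i x^{i+1}`. -/
def unitPoly {R : Type*} [CommRing R] {m : ℕ} (a : Fin m → R) : Polynomial R :=
  1 + ∑ i : Fin m, Polynomial.C (a i) * Polynomial.X ^ ((i : ℕ) + 1)

section Poly

variable {R : Type*} [CommRing R] {m : ℕ}

/-- Reversal puts the coordinate of weight `k` in degree `k`, so that degrees in the auxiliary
variable match the grading of `𝓞_l`. -/
theorem reflect_monicPoly (a : Fin m → R) : Polynomial.reflect m (monicPoly a) = unitPoly a := by
  have hs : ∀ S : Finset (Fin m), Polynomial.reflect m
      (∑ i ∈ S, Polynomial.C (a i) * Polynomial.X ^ (m - ((i : ℕ) + 1))) =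
      ∑ i ∈ S, Polynomial.C (a i) * Polynomial.X ^ ((i : ℕ) + 1) := by
    intro S
    induction S using Finset.induction_on with
    | empty => simp
    | insert i S hi ih =>
      rw [Finset.sum_insert hi, Polynomial.reflect_add, ih, Finset.sum_insert hi,
        Polynomial.reflect_C_mul_X_pow, Polynomial.revAt_le (Nat.sub_le _ _)]
      congr 3
      have := i.isLt
      omega
  rw [monicPoly, unitPoly, Polynomial.reflect_add, hs, Polynomial.reflect_monomial]
  simp

theorem coeff_unitPoly_zero (a : Fin m → R) : (unitPoly a).coeff 0 = 1 := by
  simp [unitPoly, Polynomial.coeff_X_pow]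

theorem coeff_unitPoly_succ (a : Fin m → R) (i : Fin m) : (unitPoly a).coeff (i + 1) = a i := by
  simp [unitPoly, Polynomial.coeff_X_pow, Polynomial.coeff_one, Fin.val_inj, Finset.sum_ite_eq]

theorem coeff_unitPoly_of_lt (a : Fin m → R) {k : ℕ} (hk : m < k) : (unitPoly a).coeff k = 0 := by
  have h : ∀ i : Fin m, k ≠ i + 1 := fun i => by have := i.isLt; omega
  have h0 : k ≠ 0 := by omega
  simp [unitPoly, Polynomial.coeff_X_pow, Polynomial.coeff_one, h, h0]

theorem natDegree_monicPoly_le (a : Fin m → R) : (monicPoly a).natDegree ≤ m := by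
  refine Polynomial.natDegree_add_le_of_degree_le (Polynomial.natDegree_X_pow_le m) ?_
  refine Polynomial.natDegree_sum_le_of_forall_le _ _ fun i _ => ?_
  exact (Polynomial.natDegree_C_mul_X_pow_le _ _).trans (Nat.sub_le _ _)

theorem coeff_monicPoly (a : Fin m → R) {k : ℕ} (hk : k ≤ m) :
    (monicPoly a).coeff (m - k) = (unitPoly a).coeff k := by
  rw [← reflect_monicPoly, Polynomial.coeff_reflect, Polynomial.revAt_le hk]

theorem coeff_monicPoly_mul {q : ℕ} (a : Fin m → R) (b : Fin q → R) {k : ℕ} (hk : k ≤ m + q) :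
    (monicPoly a * monicPoly b).coeff (m + q - k) = (unitPoly a * unitPoly b).coeff k := by
  rw [← reflect_monicPoly, ← reflect_monicPoly,
    ← Polynomial.reflect_mul _ _ (natDegree_monicPoly_le a) (natDegree_monicPoly_le b),
    Polynomial.coeff_reflect, Polynomial.revAt_le hk]

/-- The reflection of the derivative. -/
theorem coeff_derivative_monicPoly_mul {q : ℕ} (a : Fin m → R) (b : Fin q → R) {k : ℕ}
    (hk : k + 1 ≤ m + q) :
    (Polynomial.derivative (monicPoly a) * monicPoly b).coeff (m + q - 1 - k) =
      ((Polynomial.C (m : R) * unitPoly a - Polynomial.X * Polynomial.derivative (unitPoly a)) *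
        unitPoly b).coeff k := by
  -- For `m = 0` the truncated `m - 1` is not the degree to reflect at, but then the derivative is
  -- zero.
  rcases Nat.eq_zero_or_pos m with rfl | hm
  · simp [monicPoly, unitPoly]
  have hd : Polynomial.reflect (m - 1) (Polynomial.derivative (monicPoly a)) =
      Polynomial.C (m : R) * unitPoly a - Polynomial.X * Polynomial.derivative (unitPoly a) := by
    ext i
    have hR : (Polynomial.C (m : R) * unitPoly a -
        Polynomial.X * Polynomial.derivative (unitPoly a)).coeff i =
        ((m : R) - i) * (unitPoly a).coeff i := by
      rw [Polynomial.coeff_sub, Polynomial.coeff_C_mul]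
      cases i with
      | zero => simp
      | succ i =>
        rw [Polynomial.coeff_X_mul, Polynomial.coeff_derivative]
        push_cast
        ring
    rw [hR, Polynomial.coeff_reflect]
    rcases Nat.lt_or_ge i m with hi | hi
    · rw [Polynomial.revAt_le (by omega), Polynomial.coeff_derivative,
        ← coeff_monicPoly a hi.le]
      have h1 : m - 1 - i + 1 = m - i := by omega
      have h2 : ((m - 1 - i : ℕ) : R) + 1 = (m : R) - i := by
        rw [← Nat.cast_sub hi.le, ← h1]; push_cast; ring
      rw [h1, h2, mul_comm]
    · rw [Polynomial.revAt_eq_self_of_lt (by omega), Polynomial.coeff_derivative,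
        Polynomial.coeff_eq_zero_of_natDegree_lt ((natDegree_monicPoly_le a).trans_lt (by omega)),
        zero_mul]
      rcases hi.eq_or_lt with rfl | hi
      · simp
      · rw [coeff_unitPoly_of_lt a hi, mul_zero]
  have hdeg : (Polynomial.derivative (monicPoly a)).natDegree ≤ m - 1 :=
    (Polynomial.natDegree_derivative_le _).trans (Nat.sub_le_sub_right (natDegree_monicPoly_le a) 1)
  rw [← hd, ← reflect_monicPoly b, ← Polynomial.reflect_mul _ _ hdeg (natDegree_monicPoly_le b),
    Polynomial.coeff_reflect, Polynomial.revAt_le (by omega)]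
  congr 1
  omega

theorem coeff_euler_mul {q : ℕ} (a : Fin m → R) (b : Fin q → R) (k : ℕ) :
    ((Polynomial.C (m : R) * unitPoly a - Polynomial.X * Polynomial.derivative (unitPoly a)) *
        unitPoly b).coeff k =
      ∑ x ∈ Finset.HasAntidiagonal.antidiagonal k,
        ((m : R) - x.1) * ((unitPoly a).coeff x.1 * (unitPoly b).coeff x.2) := by
  rw [Polynomial.coeff_mul]
  refine Finset.sum_congr rfl fun x _ => ?_
  rw [← mul_assoc]
  congr 1
  rw [Polynomial.coeff_sub, Polynomial.coeff_C_mul]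
  rcases x with ⟨i, j⟩
  cases i with
  | zero => simp
  | succ i =>
    simp only [Polynomial.coeff_X_mul, Polynomial.coeff_derivative]
    push_cast
    ring

end Poly

/-- The coordinates `f_i`. -/
def fVar (n l : ℕ) (i : Fin l) : O n l := MvPolynomial.X (Sum.inl i)

/-- The coordinates `g_j`. -/
def gVar (n l : ℕ) (j : Fin (n - l - 1)) : O n l := MvPolynomial.X (Sum.inr (Sum.inl j))

theorem fPoly_eq (n l : ℕ) : fPoly n l = monicPoly (fVar n l) := rfl

theorem gPoly_eq (n l : ℕ) : gPoly n l = monicPoly (gVar n l) := rfl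

theorem SigmaO_eq {n l j : ℕ} (hl : l < n) (hj : j < n) :
    SigmaO n l j = ((-1 : ℂ) ^ j / ((n : ℂ) - j)) • ((n : ℂ) •
      (unitPoly (fVar n l) * unitPoly (gVar n l)).coeff j) := by
  rw [SigmaO, if_neg hj.ne, fPoly_eq, gPoly_eq, mul_assoc, Polynomial.coeff_C_mul,
    ← coeff_monicPoly_mul _ _ (by omega), Nat.cast_smul_eq_nsmul, nsmul_eq_mul]
  congr 4
  omega

theorem GO_eq {n l i : ℕ} (hl : l < n) (hi : i + 2 ≤ n) :
    GO n l i = (n : ℂ) • ((Polynomial.C (l : O n l) * unitPoly (fVar n l) -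
      Polynomial.X * Polynomial.derivative (unitPoly (fVar n l))) * unitPoly (gVar n l)).coeff i := by
  rw [GO, fPoly_eq, gPoly_eq, mul_assoc, Polynomial.coeff_C_mul,
    ← coeff_derivative_monicPoly_mul _ _ (by omega), Nat.cast_smul_eq_nsmul, nsmul_eq_mul]
  congr 2
  omega

/-- A multiplicative family of subspaces of `𝓞_l` that contains the `G_i` and the `Σ_j` contains
all weighted homogeneous elements. -/
theorem mem_of_generators {n l : ℕ} (hl : l < n) (A : ℕ → Submodule ℂ (O n l))
    (h1 : 1 ∈ A 0) (hmul : ∀ c d x y, x ∈ A c → y ∈ A d → x * y ∈ A (c + d))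
    (hG : ∀ i, 1 ≤ i → i + 2 ≤ n → GO n l i ∈ A i)
    (hS : ∀ j, 1 ≤ j → j ≤ n → SigmaO n l j ∈ A j)
    {d : ℕ} {F : O n l} (hF : MvPolynomial.IsWeightedHomogeneous (OWeight n l) F d) : F ∈ A d := by
  set f := unitPoly (fVar n l) with hf
  set g := unitPoly (gVar n l) with hg
  have hn : (n : ℂ) ≠ 0 := Nat.cast_ne_zero.2 (by omega)
  -- Modulo products of lower coefficients, `Σ_i` is a nonzero multiple of `f_i + g_i` and `G_i` is
  -- a nonzero multiple of `(l - i) f_i + l g_i`. This system has determinant `i`, so it can be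
  -- solved for `f_i` and `g_i`.
  have key : ∀ i, f.coeff i ∈ A i ∧ g.coeff i ∈ A i := by
    intro i
    induction i using Nat.strong_induction_on with
    | _ i ih =>
      rcases Nat.eq_zero_or_pos i with rfl | hi
      · rw [hf, hg, coeff_unitPoly_zero, coeff_unitPoly_zero]; exact ⟨h1, h1⟩
      rcases Nat.lt_or_ge i n with hin | hin
      swap
      · rw [hf, hg, coeff_unitPoly_of_lt _ (by omega), coeff_unitPoly_of_lt _ (by omega)]
        exact ⟨zero_mem _, zero_mem _⟩
      have hlow : ∀ c : ℕ × ℕ → ℂ, (∑ x ∈ Finset.HasAntidiagonal.antidiagonal i,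
          c x • (f.coeff x.1 * g.coeff x.2)) - c (i, 0) • f.coeff i - c (0, i) • g.coeff i ∈ A i := by
        intro c
        have hne : ((i, 0) : ℕ × ℕ) ≠ (0, i) := by simp [hi.ne']
        have hmem1 : ((i, 0) : ℕ × ℕ) ∈ Finset.HasAntidiagonal.antidiagonal i := by simp
        have hmem2 : ((0, i) : ℕ × ℕ) ∈ (Finset.HasAntidiagonal.antidiagonal i).erase (i, 0) := by
          simp [hi.ne]
        rw [← Finset.add_sum_erase _ _ hmem1, ← Finset.add_sum_erase _ _ hmem2]
        simp only [hf, hg, coeff_unitPoly_zero, mul_one, one_mul, add_sub_cancel_left]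
        refine Submodule.sum_mem _ fun x hx => Submodule.smul_mem _ _ ?_
        rw [Finset.mem_erase, Finset.mem_erase, Finset.HasAntidiagonal.mem_antidiagonal] at hx
        obtain ⟨hx1, hx2, hx3⟩ := hx
        rcases x with ⟨p, q⟩
        simp only [ne_eq, Prod.mk.injEq, not_and] at hx1 hx2 hx3
        have := hmul p q _ _ (ih p (by by_contra; apply hx2 <;> omega)).1
          (ih q (by by_contra; apply hx1 <;> omega)).2
        rwa [hx3] at this
      have hsum : f.coeff i + g.coeff i ∈ A i := by
        have hs := hS i hi hin.le
        rw [SigmaO_eq hl hin, smul_smul, Polynomial.coeff_mul] at hs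
        have hne : (-1 : ℂ) ^ i / ((n : ℂ) - i) * n ≠ 0 := by
          refine mul_ne_zero (div_ne_zero (pow_ne_zero _ (by norm_num)) ?_) hn
          rw [sub_ne_zero]
          exact_mod_cast hin.ne'
        have hs' := (Submodule.smul_mem_iff _ hne).1 hs
        have h := hlow fun _ => 1
        simp only [one_smul] at h
        have := sub_mem hs' h
        convert this using 1
        rw [sub_sub, sub_sub_cancel]
      rcases Nat.lt_or_ge (i + 1) n with hin' | hin'
      · have hg' := hG i hi hin'
        rw [GO_eq hl hin', coeff_euler_mul] at hg'
        have hs' := (Submodule.smul_mem_iff _ hn).1 hg'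
        have h := hlow fun x => (l : ℂ) - x.1
        have e : ∑ x ∈ Finset.HasAntidiagonal.antidiagonal i,
            ((l : O n l) - x.1) * (f.coeff x.1 * g.coeff x.2) =
            ∑ x ∈ Finset.HasAntidiagonal.antidiagonal i,
            ((l : ℂ) - x.1) • (f.coeff x.1 * g.coeff x.2) := by
          refine Finset.sum_congr rfl fun x _ => ?_
          rw [sub_smul, sub_mul, Nat.cast_smul_eq_nsmul, Nat.cast_smul_eq_nsmul, nsmul_eq_mul,
            nsmul_eq_mul]
        rw [e] at hs'
        have h2 := sub_mem hs' h
        rw [sub_sub, sub_sub_cancel] at h2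
        have h3 : (i : ℂ) • f.coeff i ∈ A i := by
          have := sub_mem (Submodule.smul_mem _ (l : ℂ) hsum) h2
          convert this using 1
          simp only [Nat.cast_zero, sub_zero, smul_add, sub_smul]
          abel
        have h4 := (Submodule.smul_mem_iff _ (Nat.cast_ne_zero.2 hi.ne')).1 h3
        refine ⟨h4, ?_⟩
        have := sub_mem hsum h4
        rwa [add_sub_cancel_left] at this
      -- Here `i = n - 1`, for which there is no `G_i`; but then `i > l` or `i > n - l - 1`, so one
      -- of the two coefficients is zero.
      · rcases Nat.lt_or_ge l i with hli | hli
        · have h0 : f.coeff i = 0 := coeff_unitPoly_of_lt _ hli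
          rw [h0, zero_add] at hsum
          rw [h0]
          exact ⟨zero_mem _, hsum⟩
        · have h0 : g.coeff i = 0 := coeff_unitPoly_of_lt _ (by omega)
          rw [h0, add_zero] at hsum
          rw [h0]
          exact ⟨hsum, zero_mem _⟩
  have hX : ∀ i, (MvPolynomial.X i : O n l) ∈ A (OWeight n l i) := by
    rintro (i | i | i)
    · have := (key (i + 1)).1
      rwa [hf, coeff_unitPoly_succ] at this
    · have := (key (i + 1)).2
      rwa [hg, coeff_unitPoly_succ] at this
    · have := hS n (by omega) le_rfl
      rwa [SigmaO, if_pos rfl] at this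
  have hmon : ∀ m : OIdx n l →₀ ℕ,
      (MvPolynomial.monomial m (1 : ℂ)) ∈ A (Finsupp.weight (OWeight n l) m) := by
    intro m
    induction m using Finsupp.induction_linear with
    | zero => simpa using h1
    | add a b ha hb =>
      have := hmul _ _ _ _ ha hb
      rwa [MvPolynomial.monomial_mul, one_mul, ← map_add] at this
    | single i k =>
      rw [← MvPolynomial.X_pow_eq_monomial, Finsupp.weight_single]
      induction k with
      | zero => simpa using h1
      | succ k ih =>
        have := hmul _ _ _ _ ih (hX i)
        rwa [← pow_succ, ← succ_nsmul] at this
  rw [F.as_sum]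
  refine Submodule.sum_mem _ fun m hm => ?_
  rw [← hF (MvPolynomial.mem_support_iff.1 hm), ← mul_one (F.coeff m), ← smul_eq_mul,
    ← MvPolynomial.smul_monomial]
  exact Submodule.smul_mem _ _ (hmon m)

/-! ### Polynomials with given roots -/

section Roots

variable {R : Type*} [CommRing R] {ι : Type*} [Fintype ι]

/-- `∏ (1 - x_i X)`. -/
def oneSub (x : ι → R) : Polynomial R := ∏ i, (1 - Polynomial.C (x i) * Polynomial.X)

theorem reflect_prod_X_sub_C [DecidableEq ι] (x : ι → R) :
    Polynomial.reflect (Fintype.card ι) (∏ i, (Polynomial.X - Polynomial.C (x i))) = oneSub x := by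
  have hdeg : ∀ S : Finset ι, (∏ i ∈ S, (Polynomial.X - Polynomial.C (x i))).natDegree ≤ S.card := by
    intro S
    refine (Polynomial.natDegree_prod_le _ _).trans ?_
    refine (Finset.sum_le_card_nsmul _ _ 1 fun i _ => Polynomial.natDegree_X_sub_C_le _).trans ?_
    simp
  have h : ∀ S : Finset ι, Polynomial.reflect S.card (∏ i ∈ S, (Polynomial.X - Polynomial.C (x i))) =
      ∏ i ∈ S, (1 - Polynomial.C (x i) * Polynomial.X) := by
    intro S
    induction S using Finset.induction_on with
    | empty => simp
    | insert i S hi ih =>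
      rw [Finset.prod_insert hi, Finset.prod_insert hi, Finset.card_insert_of_notMem hi, add_comm,
        Polynomial.reflect_mul _ _ (Polynomial.natDegree_X_sub_C_le _) (hdeg S), ih,
        Polynomial.reflect_sub, Polynomial.reflect_C, pow_one, Polynomial.reflect_one_X]
  exact h Finset.univ

theorem coeff_oneSub_zero (x : ι → R) : (oneSub x).coeff 0 = 1 := by
  rw [Polynomial.coeff_zero_eq_eval_zero, oneSub, Polynomial.eval_prod]
  simp

theorem natDegree_oneSub_le (x : ι → R) : (oneSub x).natDegree ≤ Fintype.card ι := by
  refine (Polynomial.natDegree_prod_le _ _).trans ?_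
  refine (Finset.sum_le_card_nsmul _ _ 1 fun i _ => ?_).trans ?_
  · refine (Polynomial.natDegree_sub_le _ _).trans ?_
    rw [Polynomial.natDegree_one, Nat.zero_max]
    simpa using Polynomial.natDegree_C_mul_X_pow_le (x i) 1
  · simp [Finset.card_univ]

/-- Since the product has constant term 1 and degree at most the number of factors, it is determined
by these `m` coefficients. -/
theorem unitPoly_coeff_oneSub {m : ℕ} (hm : Fintype.card ι = m) (x : ι → R) :
    unitPoly (fun i : Fin m => (oneSub x).coeff (i + 1)) = oneSub x := by
  ext k
  rcases Nat.eq_zero_or_pos k with rfl | hk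
  · rw [coeff_unitPoly_zero, coeff_oneSub_zero]
  · rcases Nat.lt_or_ge m k with hmk | hmk
    · rw [coeff_unitPoly_of_lt _ hmk,
        Polynomial.coeff_eq_zero_of_natDegree_lt ((natDegree_oneSub_le x).trans_lt (by omega))]
    · obtain ⟨k, rfl⟩ : ∃ j, k = j + 1 := ⟨k - 1, by omega⟩
      exact coeff_unitPoly_succ _ (⟨k, by omega⟩ : Fin m)

theorem monicPoly_eq_prod [DecidableEq ι] {m : ℕ} (hm : Fintype.card ι = m) (x : ι → R) (d : Fin m → R)
    (h : unitPoly d = oneSub x) : monicPoly d = ∏ i, (Polynomial.X - Polynomial.C (x i)) := by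
  have h1 := reflect_monicPoly d
  rw [h, ← reflect_prod_X_sub_C, hm] at h1
  have := congrArg (Polynomial.reflect m) h1
  rwa [Polynomial.reflect_reflect, Polynomial.reflect_reflect] at this

theorem coeff_oneSub [DecidableEq ι] (x : ι → R) [Algebra ℂ R] (k : ℕ) :
    (oneSub x).coeff k = (-1) ^ k * MvPolynomial.aeval x (MvPolynomial.esymm ι ℂ k) := by
  have h : oneSub x = ∑ s ∈ (Finset.univ : Finset ι).powerset,
      Polynomial.C (∏ i ∈ s, -x i) * Polynomial.X ^ s.card := by
    have : oneSub x = ∏ i, (Polynomial.C (-x i) * Polynomial.X + 1) := by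
      refine Finset.prod_congr rfl fun i _ => ?_
      rw [map_neg]; ring
    rw [this, Finset.prod_add]
    refine Finset.sum_congr rfl fun s _ => ?_
    rw [Finset.prod_const_one, mul_one, Finset.prod_mul_distrib, Finset.prod_const, map_prod]
  rw [h, Polynomial.finsetSum_coeff]
  simp only [Polynomial.coeff_C_mul, Polynomial.coeff_X_pow, mul_ite, mul_one, mul_zero]
  rw [← Finset.sum_filter, MvPolynomial.esymm, map_sum, Finset.mul_sum]
  refine Finset.sum_congr ?_ fun s hs => ?_
  · ext s; simp [Finset.mem_powersetCard, eq_comm]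
  · rw [map_prod]
    simp only [MvPolynomial.aeval_X]
    rw [Finset.prod_neg, (Finset.mem_powersetCard.1 hs).2]

/-- The logarithmic derivative of `∏ (1 - x_i X)`. -/
theorem sum_prod_erase_oneSub [DecidableEq ι] (x : ι → R) :
    ∑ i, ∏ j ∈ Finset.univ.erase i, (1 - Polynomial.C (x j) * Polynomial.X) =
      Polynomial.C (Fintype.card ι : R) * oneSub x -
        Polynomial.X * Polynomial.derivative (oneSub x) := by
  have h1 : Polynomial.C (Fintype.card ι : R) * oneSub x = ∑ i,
      (∏ j ∈ Finset.univ.erase i, (1 - Polynomial.C (x j) * Polynomial.X)) *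
        (1 - Polynomial.C (x i) * Polynomial.X) := by
    have : ∀ i ∈ (Finset.univ : Finset ι),
        (∏ j ∈ Finset.univ.erase i, (1 - Polynomial.C (x j) * Polynomial.X)) *
        (1 - Polynomial.C (x i) * Polynomial.X) = oneSub x := fun i hi =>
      Finset.prod_erase_mul _ _ hi
    rw [Finset.sum_congr rfl this, Finset.sum_const, Finset.card_univ, nsmul_eq_mul, map_natCast]
  rw [h1, oneSub, Polynomial.derivative_prod_finset, Finset.mul_sum, ← Finset.sum_sub_distrib]
  refine Finset.sum_congr rfl fun i _ => ?_
  simp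
  ring

theorem map_oneSub {S : Type*} [CommRing S] (φ : R →+* S) (x : ι → R) :
    (oneSub x).map φ = oneSub fun i => φ (x i) := by
  simp [oneSub, Polynomial.map_prod]

theorem map_unitPoly {S : Type*} [CommRing S] {m : ℕ} (φ : R →+* S) (x : Fin m → R) :
    (unitPoly x).map φ = unitPoly fun i => φ (x i) := by
  simp [unitPoly, Polynomial.map_sum]

theorem map_monicPoly {S : Type*} [CommRing S] {m : ℕ} (φ : R →+* S) (x : Fin m → R) :
    (monicPoly x).map φ = monicPoly fun i => φ (x i) := by
  simp [monicPoly, Polynomial.map_sum]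

theorem monic_monicPoly [Nontrivial R] {m : ℕ} (x : Fin m → R) : (monicPoly x).Monic := by
  refine Polynomial.monic_of_natDegree_le_of_coeff_eq_one m (natDegree_monicPoly_le x) ?_
  have := coeff_monicPoly x (Nat.zero_le m)
  rwa [Nat.sub_zero, coeff_unitPoly_zero] at this

end Roots

/-- The target is integral over the image, so the images of the variables span it algebraically.
They are as many as its transcendence degree, hence they form a transcendence basis and satisfy no
relation. -/
theorem injective_of_isIntegral {ι κ : Type} [Finite ι] [Finite κ] (h : Nat.card ι = Nat.card κ)
    (f : MvPolynomial ι ℂ →ₐ[ℂ] MvPolynomial κ ℂ)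
    (hf : ∀ i, f.toRingHom.IsIntegralElem (MvPolynomial.X i)) : Function.Injective f := by
  have hfa : f = MvPolynomial.aeval fun i => f (MvPolynomial.X i) :=
    MvPolynomial.algHom_ext fun i => by simp
  have hrange : Algebra.adjoin ℂ (Set.range fun i => f (MvPolynomial.X i)) = f.range := by
    conv_rhs => rw [hfa]
    rw [Algebra.adjoin_range_eq_range_aeval]
  have hint : Algebra.IsIntegral (Algebra.adjoin ℂ (Set.range fun i => f (MvPolynomial.X i)))
      (MvPolynomial κ ℂ) := by
    rw [hrange]
    refine ⟨fun x => ?_⟩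
    induction x using MvPolynomial.induction_on with
    | C c =>
      let y : f.range := ⟨MvPolynomial.C c, f.range.algebraMap_mem c⟩
      exact isIntegral_algebraMap (x := y)
    | add a b ha hb => exact ha.add hb
    | mul_X a i ha =>
      refine ha.mul ?_
      obtain ⟨p, hp, hp0⟩ := hf i
      refine ⟨p.map f.rangeRestrict.toRingHom, hp.map _, ?_⟩
      rw [Polynomial.eval₂_map]
      exact hp0
  have hb := Algebra.IsAlgebraic.isTranscendenceBasis_of_lift_le_trdeg_of_finite
    (R := ℂ) (fun i => f (MvPolynomial.X i)) (by
      rw [MvPolynomial.trdeg_of_isDomain]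
      have : Cardinal.mk ι = Cardinal.mk κ := by
        rw [← Nat.cast_card, ← Nat.cast_card, h]
      simp [this])
  have := hb.1
  rw [AlgebraicIndependent, ← hfa] at this
  exact this

/-! ### Adjoining the roots of `f` and `g` -/

/-- The index set of the roots of `f` and `g`. -/
abbrev RootIdx (n l : ℕ) : Type := Fin l ⊕ Fin (n - l - 1)

/-- The polynomial ring in the roots of `f`, the roots of `g`, and `Σ_n`. -/
abbrev RootRing (n l : ℕ) : Type := MvPolynomial (RootIdx n l ⊕ Unit) ℂ

/-- The roots of `f` and `g`. -/
def rootVar (n l : ℕ) (i : RootIdx n l) : RootRing n l := MvPolynomial.X (Sum.inl i)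

/-- The embedding of `𝓞_l` with `f = ∏ (x - a_i)` and `g = ∏ (x - b_j)`. -/
def rootHom (n l : ℕ) : O n l →ₐ[ℂ] RootRing n l :=
  MvPolynomial.aeval (Sum.elim
    (fun i : Fin l => (oneSub fun k : Fin l => rootVar n l (Sum.inl k)).coeff (i + 1))
    (Sum.elim (fun j : Fin (n - l - 1) =>
      (oneSub fun k : Fin (n - l - 1) => rootVar n l (Sum.inr k)).coeff (j + 1))
      fun _ => MvPolynomial.X (Sum.inr ())))

theorem rootHom_f (n l : ℕ) : (unitPoly (fVar n l)).map (rootHom n l).toRingHom =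
    oneSub fun k : Fin l => rootVar n l (Sum.inl k) := by
  rw [map_unitPoly, ← unitPoly_coeff_oneSub (Fintype.card_fin l)]
  congr 1
  funext i
  simp [rootHom, fVar]

theorem rootHom_g (n l : ℕ) : (unitPoly (gVar n l)).map (rootHom n l).toRingHom =
    oneSub fun k : Fin (n - l - 1) => rootVar n l (Sum.inr k) := by
  rw [map_unitPoly, ← unitPoly_coeff_oneSub (Fintype.card_fin (n - l - 1))]
  congr 1
  funext i
  simp [rootHom, gVar]

theorem oneSub_rootVar (n l : ℕ) : oneSub (rootVar n l) =
    (oneSub fun k : Fin l => rootVar n l (Sum.inl k)) *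
      oneSub fun k : Fin (n - l - 1) => rootVar n l (Sum.inr k) := by
  rw [oneSub, Fintype.prod_sum_type]; rfl

theorem rootHom_coeff_fg (n l k : ℕ) :
    rootHom n l ((unitPoly (fVar n l) * unitPoly (gVar n l)).coeff k) =
      (oneSub (rootVar n l)).coeff k := by
  rw [oneSub_rootVar, ← rootHom_f, ← rootHom_g, ← Polynomial.map_mul, Polynomial.coeff_map]
  rfl

/-- The composition of `ℂ[z]^𝔖 → 𝓞_l` with the embedding of `𝓞_l`. -/
def symRoot (n l : ℕ) : SymRing n →ₐ[ℂ] RootRing n l :=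
  (rootHom n l).comp (MvPolynomial.aeval fun j : Fin n => SigmaO n l (j + 1))

theorem symRoot_X (n l : ℕ) (j : Fin n) :
    symRoot n l (MvPolynomial.X j) = rootHom n l (SigmaO n l (j + 1)) := by
  simp [symRoot]

theorem rootHom_SigmaO {n l j : ℕ} (hl : l < n) (hj : j < n) :
    rootHom n l (SigmaO n l j) =
      ((-1 : ℂ) ^ j / ((n : ℂ) - j)) • ((n : ℂ) • (oneSub (rootVar n l)).coeff j) := by
  rw [SigmaO_eq hl hj, map_smul, map_smul, rootHom_coeff_fg]

theorem rootHom_SigmaO_last (n l : ℕ) :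
    rootHom n l (SigmaO n l n) = MvPolynomial.X (Sum.inr ()) := by
  rw [SigmaO, if_pos rfl]
  simp [rootHom]

theorem card_rootIdx {n l : ℕ} (hl : l < n) : Fintype.card (RootIdx n l) = n - 1 := by
  simp; omega

/-- The definition of `Σ_j` for `j < n` is inverted: the coefficients of `f g` come from symmetric
polynomials, which makes the roots integral over them. -/
theorem coeff_oneSub_rootVar {n l : ℕ} (hl : l < n) (j : Fin (n - 1)) :
    (oneSub (rootVar n l)).coeff (j + 1) = symRoot n l
      (((-1 : ℂ) ^ ((j : ℕ) + 1) * ((n : ℂ) - ((j : ℕ) + 1 : ℕ)) / n) •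
        MvPolynomial.X (⟨j, by omega⟩ : Fin n)) := by
  have hj := j.isLt
  rw [map_smul, symRoot_X, rootHom_SigmaO hl (by simp; omega), smul_smul, smul_smul]
  have hn : (n : ℂ) ≠ 0 := Nat.cast_ne_zero.2 (by omega)
  have hnj : (n : ℂ) - ((j : ℕ) + 1 : ℕ) ≠ 0 := by
    rw [sub_ne_zero]; exact_mod_cast (by omega : n ≠ j + 1)
  have h1 : ((-1 : ℂ) ^ ((j : ℕ) + 1)) * (-1 : ℂ) ^ ((j : ℕ) + 1) = 1 := by
    rw [← mul_pow]; simp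
  have : (-1 : ℂ) ^ ((j : ℕ) + 1) * ((n : ℂ) - ((j : ℕ) + 1 : ℕ)) / n *
      ((-1 : ℂ) ^ ((j : ℕ) + 1) / ((n : ℂ) - ((j : ℕ) + 1 : ℕ)) * n) = 1 := by
    field_simp
    rw [sq]; exact h1
  rw [← mul_assoc] at this
  rw [this, one_smul]

/-- A root of `f` or `g` is a root of the monic polynomial `f g`, and `Σ_n` is the image of the last
variable. -/
theorem isIntegralElem_symRoot {n l : ℕ} (hl : l < n) (i : RootIdx n l ⊕ Unit) :
    (symRoot n l).toRingHom.IsIntegralElem (MvPolynomial.X i) := by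
  rcases i with i | ⟨⟩
  · refine ⟨monicPoly fun j : Fin (n - 1) =>
      ((-1 : ℂ) ^ ((j : ℕ) + 1) * ((n : ℂ) - ((j : ℕ) + 1 : ℕ)) / n) •
        (MvPolynomial.X (⟨j, by omega⟩ : Fin n) : SymRing n), monic_monicPoly _, ?_⟩
    rw [← Polynomial.eval_map, map_monicPoly]
    have : (fun j : Fin (n - 1) => (symRoot n l).toRingHom
        (((-1 : ℂ) ^ ((j : ℕ) + 1) * ((n : ℂ) - ((j : ℕ) + 1 : ℕ)) / n) •
        (MvPolynomial.X (⟨j, by omega⟩ : Fin n) : SymRing n))) =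
        fun j : Fin (n - 1) => (oneSub (rootVar n l)).coeff (j + 1) :=
      funext fun j => (coeff_oneSub_rootVar hl j).symm
    rw [this, monicPoly_eq_prod (card_rootIdx hl) (rootVar n l) _
      (unitPoly_coeff_oneSub (card_rootIdx hl) _), Polynomial.eval_prod]
    exact Finset.prod_eq_zero (Finset.mem_univ i) (by simp [rootVar])
  · refine ⟨Polynomial.X - Polynomial.C (MvPolynomial.X (⟨n - 1, by omega⟩ : Fin n)),
      Polynomial.monic_X_sub_C _, ?_⟩
    have h : symRoot n l (MvPolynomial.X (⟨n - 1, by omega⟩ : Fin n)) =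
        MvPolynomial.X (Sum.inr ()) := by
      rw [symRoot_X, ← rootHom_SigmaO_last]
      congr 2
      simp; omega
    simp only [Polynomial.eval₂_sub, Polynomial.eval₂_X, Polynomial.eval₂_C]
    rw [sub_eq_zero]
    exact h.symm

/-- Both rings have `n` variables, since `l + (n - l - 1) + 1 = n`. -/
theorem symRoot_injective {n l : ℕ} (hl : l < n) : Function.Injective (symRoot n l) := by
  refine injective_of_isIntegral ?_ _ (isIntegralElem_symRoot hl)
  simp; omega

theorem rootHom_injective {n l : ℕ} (hl : l < n) : Function.Injective (rootHom n l) := by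
  refine injective_of_isIntegral ?_ _ fun i => ?_
  · simp; omega
  · obtain ⟨p, hp, h0⟩ := isIntegralElem_symRoot hl i
    refine ⟨p.map (MvPolynomial.aeval fun j : Fin n => SigmaO n l (j + 1) :
      SymRing n →ₐ[ℂ] O n l).toRingHom, hp.map _, ?_⟩
    rw [Polynomial.eval₂_map]
    exact h0

/-- Only the product `f g` and `Σ_n` enter `Q`, so the whole symmetric group of the roots of `f g`
acts trivially, including permutations that do not preserve `𝓞_l`. -/
theorem rename_symRoot {n l : ℕ} (hl : l < n) (π : Equiv.Perm (RootIdx n l)) (a : SymRing n) :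
    MvPolynomial.rename (Sum.map π id) (symRoot n l a) = symRoot n l a := by
  have hone : (oneSub (rootVar n l)).map
      (MvPolynomial.rename (Sum.map π id) : RootRing n l →ₐ[ℂ] RootRing n l).toRingHom =
      oneSub (rootVar n l) := by
    rw [map_oneSub]
    simp only [oneSub]
    refine Fintype.prod_equiv π _ _ fun i => ?_
    simp [rootVar]
  have : (MvPolynomial.rename (Sum.map π id)).comp (symRoot n l) = symRoot n l := by
    refine MvPolynomial.algHom_ext fun j => ?_
    rw [AlgHom.comp_apply, symRoot_X]
    rcases Nat.lt_or_ge (j + 1) n with hj | hj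
    · rw [rootHom_SigmaO hl hj, map_smul, map_smul]
      congr 2
      conv_rhs => rw [← hone, Polynomial.coeff_map]
      rfl
    · have : (j : ℕ) + 1 = n := by have := j.isLt; omega
      rw [this, rootHom_SigmaO_last]
      simp
  exact congrArg (fun f => f a) this

/-! ### The roots of `Q` -/

/-- A field containing the roots `ζ` of the polynomial `Q` with `Q' = n f g`. -/
structure BetheField (n l : ℕ) (K : Type*) [Field K] [Algebra ℂ K] where
  /-- The embedding of the ring of roots. -/
  φ : RootRing n l →ₐ[ℂ] K
  injective : Function.Injective φ
  /-- The roots of `Q`. -/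
  ζ : Fin n → K
  esymm_ζ : ∀ j : Fin n, MvPolynomial.aeval ζ (MvPolynomial.esymm (Fin n) ℂ (j + 1)) =
    φ (symRoot n l (MvPolynomial.X j))

theorem neg_one_pow_mul_self_mul {R : Type*} [CommRing R] (k : ℕ) (x : R) :
    (-1) ^ k * ((-1) ^ k * x) = x := by
  rw [← mul_assoc, ← mul_pow]; simp

theorem exists_betheField (n l : ℕ) :
    ∃ (K : Type) (_ : Field K) (_ : Algebra ℂ K), Nonempty (BetheField n l K) := by
  let K := AlgebraicClosure (FractionRing (RootRing n l))
  let φ : RootRing n l →ₐ[ℂ] K :=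
    (Algebra.ofId (FractionRing (RootRing n l)) K |>.restrictScalars ℂ).comp
      (Algebra.ofId (RootRing n l) (FractionRing (RootRing n l)) |>.restrictScalars ℂ)
  have hφ : Function.Injective φ :=
    (algebraMap (FractionRing (RootRing n l)) K).injective.comp
      (IsFractionRing.injective (RootRing n l) (FractionRing (RootRing n l)))
  -- The lower coefficients of `Q`, which splits over the algebraic closure of the fraction field;
  -- its multiset of roots is then listed to give `ζ`.
  let d : Fin n → K := fun j => (-1) ^ ((j : ℕ) + 1) * φ (symRoot n l (MvPolynomial.X j))
  have hsplit := (IsAlgClosed.splits (monicPoly d)).eq_prod_roots_of_monic (monic_monicPoly d)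
  have hcard : Multiset.card (monicPoly d).roots = n := by
    rw [← (IsAlgClosed.splits (monicPoly d)).natDegree_eq_card_roots]
    refine le_antisymm (natDegree_monicPoly_le d) ?_
    refine Polynomial.le_natDegree_of_ne_zero ?_
    have := coeff_monicPoly d (Nat.zero_le n)
    rw [Nat.sub_zero, coeff_unitPoly_zero] at this
    rw [this]; exact one_ne_zero
  obtain ⟨L, hL⟩ := Quot.exists_rep (monicPoly d).roots
  have hL' : (L : Multiset K) = (monicPoly d).roots := hL
  have hlen : L.length = n := by rw [← hcard, ← hL']; rfl
  have hprod : monicPoly d = ∏ s, (Polynomial.X - Polynomial.C (L.get s)) := by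
    rw [hsplit, ← hL', Multiset.map_coe, Multiset.prod_coe, ← List.prod_ofFn]
    congr 1
    have := List.map_ofFn (f := L.get) (g := fun a => Polynomial.X - Polynomial.C a)
    rwa [List.ofFn_get] at this
  let ζ : Fin n → K := fun s => L.get (Fin.cast hlen.symm s)
  have hprod' : monicPoly d = ∏ s, (Polynomial.X - Polynomial.C (ζ s)) := by
    rw [hprod]
    exact Fintype.prod_equiv (finCongr hlen) _ _ fun s => rfl
  have hunit : unitPoly d = oneSub ζ := by
    rw [← reflect_monicPoly, hprod', ← reflect_prod_X_sub_C, Fintype.card_fin]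
  refine ⟨K, inferInstance, inferInstance, ⟨⟨φ, hφ, ζ, fun j => ?_⟩⟩⟩
  have h := coeff_unitPoly_succ d j
  rw [hunit, coeff_oneSub] at h
  have h2 := congrArg (fun x => (-1) ^ ((j : ℕ) + 1) * x) h
  simpa only [d, neg_one_pow_mul_self_mul] using h2

/-! ### Base change of the Fock space -/

section MapFock

variable {R S : Type*} [CommRing R] [CommRing S] {n : ℕ} (f : R →+* S)

/-- Base change along a ring homomorphism. -/
def mapFock (F : Fock R n) : Fock S n := fun J => f (F J)

theorem mapFock_fockOp (i j : Fin 2) (s : Fin n) (F : Fock R n) :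
    mapFock f (fockOp R n i j s F) = fockOp S n i j s (mapFock f F) := by
  funext J
  by_cases h : J s = i <;> simp [mapFock, fockOp, h]

theorem mapFock_add (F G : Fock R n) : mapFock f (F + G) = mapFock f F + mapFock f G := by
  funext J; simp [mapFock]

theorem mapFock_sub (F G : Fock R n) : mapFock f (F - G) = mapFock f F - mapFock f G := by
  funext J; simp [mapFock]

theorem mapFock_smul (c : R) (F : Fock R n) : mapFock f (c • F) = f c • mapFock f F := by
  funext J; simp [mapFock]

theorem mapFock_zero : mapFock f (0 : Fock R n) = 0 := by
  funext J; simp [mapFock]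

theorem mapFock_sum {ι : Type*} (T : Finset ι) (F : ι → Fock R n) :
    mapFock f (∑ i ∈ T, F i) = ∑ i ∈ T, mapFock f (F i) := by
  funext J; simp [mapFock]

theorem mapFock_annOp (w : Fin n → R) (F : Fock R n) :
    mapFock f (annOp w F) = annOp (fun s => f (w s)) (mapFock f F) := by
  simp [annOp, mapFock_sum, mapFock_smul, mapFock_fockOp]

theorem mapFock_creOp (w : Fin n → R) (F : Fock R n) :
    mapFock f (creOp w F) = creOp (fun s => f (w s)) (mapFock f F) := by
  simp [creOp, mapFock_sum, mapFock_smul, mapFock_fockOp]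

theorem mapFock_numOp (w : Fin n → R) (F : Fock R n) :
    mapFock f (numOp w F) = numOp (fun s => f (w s)) (mapFock f F) := by
  simp [numOp, mapFock_sum, mapFock_smul, mapFock_fockOp]

theorem mapFock_transferOp (z : Fin n → R) (m : ℕ) (F : Fock R n) :
    mapFock f (transferOp z m F) = transferOp (fun s => f (z s)) m (mapFock f F) := by
  simp [transferOp, mapFock_sum, mapFock_sub, mapFock_smul, mapFock_annOp, mapFock_creOp,
    mapFock_numOp]

theorem mapFock_creVec (k : ℕ) (h : Fin k → Fin n → R) :
    mapFock f (creVec k h) = creVec k fun i s => f (h i s) := by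
  induction k with
  | zero =>
    funext J
    by_cases hJ : J = fun _ => 0
    · subst hJ; simp [mapFock, creVec]
    · simp [mapFock, creVec, Pi.single_eq_of_ne hJ]
  | succ k ih => rw [creVec_succ, mapFock_creOp, ih, creVec_succ]

theorem hat_mapFock (k : ℕ) (F : Fock R n) (w : Fin k → Fin n → R) :
    hat k (mapFock f F) (fun j s => f (w j s)) = f (hat k F w) := by
  induction k generalizing F with
  | zero => rw [hat_zero, hat_zero]; rfl
  | succ k ih => rw [hat_succ, hat_succ, ← mapFock_annOp, ih]

end MapFock

/-- `mk (x ^ k)` is the inverse of `1 - x X`. -/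
theorem mk_pow_mul {K : Type*} [Field K] (x : K) : PowerSeries.mk (fun k => x ^ k) *
    (1 - PowerSeries.C x * PowerSeries.X) = 1 := by
  ext k
  cases k with
  | zero => simp
  | succ k =>
    rw [mul_sub, mul_one, ← mul_assoc, map_sub, PowerSeries.coeff_succ_mul_X,
      PowerSeries.coeff_mul_C]
    simp [PowerSeries.coeff_one, pow_succ]

/-! ### One-particle eigenvectors and eigenfunctionals -/

namespace BetheField

variable {K : Type*} [Field K] [Algebra ℂ K] {n l : ℕ} (D : BetheField n l K)

/-- The roots of `f` and `g` in the field. -/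
def c (i : RootIdx n l) : K := D.φ (rootVar n l i)

/-- Evaluation at the roots of `Q`. -/
def ev : MvPolynomial (Fin n) ℂ →ₐ[ℂ] K := MvPolynomial.aeval D.ζ

theorem ev_X (s : Fin n) : D.ev (MvPolynomial.X s) = D.ζ s := by simp [ev]

theorem ev_symToPoly (a : SymRing n) : D.ev (symToPoly n a) = D.φ (symRoot n l a) := by
  have : D.ev.comp (symToPoly n) = D.φ.comp (symRoot n l) := by
    refine MvPolynomial.algHom_ext fun j => ?_
    rw [AlgHom.comp_apply, AlgHom.comp_apply, ← D.esymm_ζ, symToPoly, MvPolynomial.aeval_X, ev]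
  exact congrArg (fun f => f a) this

theorem coeff_oneSub_ζ (j : Fin n) :
    (oneSub D.ζ).coeff (j + 1) = (-1) ^ ((j : ℕ) + 1) * D.φ (symRoot n l (MvPolynomial.X j)) := by
  rw [coeff_oneSub, D.esymm_ζ]

/-- The identity `Q' = n f g` in reversed form. The `k`-th coefficient on the left is `n - k` times
that of the reversed `Q`, and this factor is the one in the definition of `Σ_k`; at `k = n` it
vanishes, so `Σ_n` stays free. -/
theorem sum_prod_erase_ζ (hl : l < n) :
    ∑ s, ∏ t ∈ Finset.univ.erase s, (1 - Polynomial.C (D.ζ t) * Polynomial.X) =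
      Polynomial.C (n : K) * oneSub D.c := by
  rw [sum_prod_erase_oneSub, Fintype.card_fin]
  ext k
  have hL : (Polynomial.C (n : K) * oneSub D.ζ -
      Polynomial.X * Polynomial.derivative (oneSub D.ζ)).coeff k =
      ((n : K) - k) * (oneSub D.ζ).coeff k := by
    rw [Polynomial.coeff_sub, Polynomial.coeff_C_mul]
    cases k with
    | zero => simp
    | succ k =>
      rw [Polynomial.coeff_X_mul, Polynomial.coeff_derivative]
      push_cast
      ring
  have hc : (oneSub D.c).coeff k = D.φ ((oneSub (rootVar n l)).coeff k) := by
    have := map_oneSub D.φ.toRingHom (rootVar n l)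
    change _ = oneSub D.c at this
    rw [← this, Polynomial.coeff_map]
    rfl
  rw [hL, Polynomial.coeff_C_mul, hc]
  rcases Nat.eq_zero_or_pos k with rfl | hk
  · simp [coeff_oneSub_zero]
  rcases Nat.lt_or_ge k n with hkn | hkn
  · obtain ⟨k, rfl⟩ : ∃ j, k = j + 1 := ⟨k - 1, by omega⟩
    have h := D.coeff_oneSub_ζ ⟨k, by omega⟩
    simp only at h
    rw [h, symRoot_X, rootHom_SigmaO hl hkn, map_smul, map_smul, Algebra.smul_def,
      Algebra.smul_def]
    have hnk : ((n : ℂ) - (k + 1 : ℕ)) ≠ 0 := by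
      rw [sub_ne_zero]; exact_mod_cast hkn.ne'
    have e1 : ((n : K) - (k + 1 : ℕ)) = algebraMap ℂ K ((n : ℂ) - (k + 1 : ℕ)) := by simp
    have e2 : ((-1 : K)) ^ (k + 1) = algebraMap ℂ K ((-1) ^ (k + 1)) := by simp
    have e3 : (n : K) = algebraMap ℂ K n := by simp
    rw [e1, e2, ← mul_assoc, ← mul_assoc, ← mul_assoc, ← map_mul, ← map_mul, ← map_mul, e3]
    congr 2
    have h1 : ((-1 : ℂ) ^ (k + 1)) * (-1 : ℂ) ^ (k + 1) = 1 := by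
      rw [← mul_pow]; simp
    field_simp
    rw [sq, h1, mul_one]
  · have h1 : (oneSub (rootVar n l)).coeff k = 0 := by
      refine Polynomial.coeff_eq_zero_of_natDegree_lt ((natDegree_oneSub_le _).trans_lt ?_)
      rw [card_rootIdx hl]; omega
    rw [h1, map_zero, mul_zero]
    rcases hkn.eq_or_lt with rfl | hkn
    · simp
    · rw [Polynomial.coeff_eq_zero_of_natDegree_lt, mul_zero]
      refine (natDegree_oneSub_le _).trans_lt ?_
      rwa [Fintype.card_fin]

theorem c_ne_zero (i : RootIdx n l) : D.c i ≠ 0 := by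
  rw [c, Ne, map_eq_zero_iff _ D.injective]
  exact MvPolynomial.X_ne_zero _

theorem c_injective : Function.Injective D.c :=
  D.injective.comp ((MvPolynomial.X_injective (R := ℂ)).comp Sum.inl_injective)

/-- Otherwise `Q` vanishes at a root of `f g`, already in the ring of roots. Specializing all these
roots to 0 and `Σ_n` to 1 turns this value into the constant term `(-1)^n`. -/
theorem c_ne_ζ (hl : l < n) (i : RootIdx n l) (s : Fin n) : D.c i ≠ D.ζ s := by
  intro h
  let d : Fin n → RootRing n l := fun j => (-1) ^ ((j : ℕ) + 1) * symRoot n l (MvPolynomial.X j)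
  have hd : unitPoly (fun j => D.φ.toRingHom (d j)) = oneSub D.ζ := by
    rw [← unitPoly_coeff_oneSub (Fintype.card_fin n) D.ζ]
    congr 1
    funext j
    rw [coeff_oneSub_ζ]
    simp [d]
  have hprod := monicPoly_eq_prod (Fintype.card_fin n) D.ζ _ hd
  have h0 : D.φ ((monicPoly d).eval (rootVar n l i)) = 0 := by
    have h1 : D.φ ((monicPoly d).eval (rootVar n l i)) =
        ((monicPoly d).map D.φ.toRingHom).eval (D.c i) := by
      rw [Polynomial.eval_map]
      exact Polynomial.hom_eval₂ _ _ D.φ.toRingHom _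
    rw [h1, map_monicPoly, hprod, Polynomial.eval_prod]
    exact Finset.prod_eq_zero (Finset.mem_univ s) (by simp [h])
  rw [map_eq_zero_iff _ D.injective] at h0
  let θ : RootRing n l →ₐ[ℂ] ℂ := MvPolynomial.aeval (Sum.elim (fun _ => 0) fun _ => 1)
  have h2 : ((monicPoly d).map θ.toRingHom).eval 0 = 0 := by
    have h1 : θ ((monicPoly d).eval (rootVar n l i)) =
        ((monicPoly d).map θ.toRingHom).eval (θ (rootVar n l i)) := by
      rw [Polynomial.eval_map]
      exact Polynomial.hom_eval₂ _ _ θ.toRingHom _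
    have hθ : θ (rootVar n l i) = 0 := by simp [θ, rootVar]
    rw [h0, map_zero, hθ] at h1
    exact h1.symm
  rw [map_monicPoly, ← Polynomial.coeff_zero_eq_eval_zero] at h2
  have h3 := coeff_monicPoly (fun j => θ.toRingHom (d j)) le_rfl
  rw [Nat.sub_self, h2] at h3
  have h4 := coeff_unitPoly_succ (fun j => θ.toRingHom (d j)) ⟨n - 1, by omega⟩
  have h5 : n - 1 + 1 = n := by omega
  simp only [h5] at h4
  rw [← h3] at h4
  have h6 : symRoot n l (MvPolynomial.X (⟨n - 1, by omega⟩ : Fin n)) =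
      MvPolynomial.X (Sum.inr ()) := by
    rw [symRoot_X, ← rootHom_SigmaO_last]
    simp [h5]
  simp only [d, h6] at h4
  simp [θ] at h4
  exact pow_ne_zero _ (neg_ne_zero.2 one_ne_zero) h4.symm

/-- The eigenvectors `1 / (c_i - ζ_s)`. -/
def w (i : RootIdx n l) (s : Fin n) : K := (D.c i - D.ζ s)⁻¹

theorem w_mul (hl : l < n) (i : RootIdx n l) (s : Fin n) : D.w i s * (D.c i - D.ζ s) = 1 :=
  inv_mul_cancel₀ (sub_ne_zero.2 (D.c_ne_ζ hl i s))

/-- The Bethe ansatz equations. -/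
theorem sum_w (hl : l < n) (i : RootIdx n l) : ∑ s, D.w i s = 0 := by
  have hc := D.c_ne_zero i
  -- The reversed polynomials are evaluated at `1 / c_i`: the right side vanishes, and the left side
  -- is `∑_s w_i(s)` times a nonzero factor.
  have h := congrArg (Polynomial.eval (D.c i)⁻¹) (D.sum_prod_erase_ζ hl)
  have hR : Polynomial.eval (D.c i)⁻¹ (Polynomial.C (n : K) * oneSub D.c) = 0 := by
    rw [Polynomial.eval_mul, oneSub, Polynomial.eval_prod,
      Finset.prod_eq_zero (Finset.mem_univ i), mul_zero]
    simp [hc]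
  rw [hR, Polynomial.eval_finsetSum] at h
  have hfac : ∀ t, 1 - D.ζ t * (D.c i)⁻¹ = (D.c i - D.ζ t) * (D.c i)⁻¹ := fun t => by
    field_simp
  have hne : ∀ t, 1 - D.ζ t * (D.c i)⁻¹ ≠ 0 := fun t => by
    rw [hfac]
    exact mul_ne_zero (sub_ne_zero.2 (D.c_ne_ζ hl i t)) (inv_ne_zero hc)
  have hE : ∀ s, Polynomial.eval (D.c i)⁻¹
      (∏ t ∈ Finset.univ.erase s, (1 - Polynomial.C (D.ζ t) * Polynomial.X)) =
      (∏ t, (1 - D.ζ t * (D.c i)⁻¹)) * D.c i * D.w i s := by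
    intro s
    rw [Polynomial.eval_prod, ← Finset.mul_prod_erase _ _ (Finset.mem_univ s), hfac s]
    have h1 : (D.c i - D.ζ s) * (D.c i)⁻¹ * D.c i * D.w i s = 1 := by
      rw [inv_mul_cancel_right₀ hc, mul_comm, D.w_mul hl]
    simp only [Polynomial.eval_sub, Polynomial.eval_one, Polynomial.eval_mul, Polynomial.eval_C,
      Polynomial.eval_X]
    linear_combination (-∏ t ∈ Finset.univ.erase s, (1 - D.ζ t * (D.c i)⁻¹)) * h1
  simp only [hE] at h
  rw [← Finset.mul_sum] at h
  exact (mul_eq_zero.1 h).resolve_left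
    (mul_ne_zero (Finset.prod_ne_zero_iff.2 fun t _ => hne t) hc)

/-- The power sums of the roots of `Q`. -/
def p (q : ℕ) : K := ∑ s, D.ζ s ^ q

/-- The moments of the eigenvectors. -/
def γ (i : RootIdx n l) (q : ℕ) : K := ∑ s, D.w i s * D.ζ s ^ q

theorem γ_zero (hl : l < n) (i : RootIdx n l) : D.γ i 0 = 0 := by
  simp [γ, D.sum_w hl]

/-- From `w_i(s) (c_i - ζ_s) = 1`, a factor `ζ_s` can be traded for `c_i` at the cost of a power
sum. -/
theorem γ_succ (hl : l < n) (i : RootIdx n l) (q : ℕ) :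
    D.γ i (q + 1) = D.c i * D.γ i q - D.p q := by
  rw [γ, γ, p, Finset.mul_sum, ← Finset.sum_sub_distrib]
  refine Finset.sum_congr rfl fun s _ => ?_
  linear_combination (-D.ζ s ^ q) * D.w_mul hl i s

/-- The eigenvalue of the transfer operator. -/
def lam (m : ℕ) (i : RootIdx n l) : K :=
  ∑ x ∈ Finset.HasAntidiagonal.antidiagonal m, D.p x.1 * D.c i ^ x.2

theorem eigen (hl : l < n) (i : RootIdx n l) (m : ℕ) (t : Fin n) :
    ∑ x ∈ Finset.HasAntidiagonal.antidiagonal m, ((∑ s, D.ζ s ^ x.1) * (D.w i t * D.ζ t ^ x.2) -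
      (∑ s, D.w i s * D.ζ s ^ x.1) * D.ζ t ^ x.2) = D.lam m i * D.w i t := by
  set P := PowerSeries.mk D.p with hP
  set G := PowerSeries.mk (D.γ i) with hG
  set Z := PowerSeries.mk fun k => D.ζ t ^ k with hZ
  set W := PowerSeries.mk fun k => D.c i ^ k with hW
  have hZ1 := mk_pow_mul (D.ζ t)
  have hW1 := mk_pow_mul (D.c i)
  rw [← hZ] at hZ1
  rw [← hW] at hW1
  -- The Bethe equations enter here: the zeroth moment is 0, so the recursion has no constant term
  -- and determines `G = -X P W`.
  have hG1 : G = PowerSeries.X * (PowerSeries.C (D.c i) * G - P) := by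
    ext k
    cases k with
    | zero => simp [hG, D.γ_zero hl]
    | succ k =>
      rw [PowerSeries.coeff_succ_X_mul, map_sub, PowerSeries.coeff_C_mul]
      simp [hG, hP, D.γ_succ hl]
  have hw : PowerSeries.C (D.w i t) * (PowerSeries.C (D.c i) - PowerSeries.C (D.ζ t)) = 1 := by
    rw [← map_sub, ← map_mul, D.w_mul hl, map_one]
  -- With `G` known, this is the partial fraction identity for `1 / (1 - c_i X)` and `1 / (1 - ζ_t
  -- X)`, the difference `c_i - ζ_t` being cancelled by `w_i(t)`.
  have key : PowerSeries.C (D.w i t) * (P * Z) - G * Z = PowerSeries.C (D.w i t) * (P * W) := by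
    have hG2 : G = -(PowerSeries.X * P * W) := by
      linear_combination W * hG1 - G * hW1
    rw [hG2]
    linear_combination (PowerSeries.C (D.w i t) * P * W) * hZ1
      - (PowerSeries.C (D.w i t) * P * Z) * hW1 - (P * W * Z * PowerSeries.X) * hw
  have h := congrArg (PowerSeries.coeff m) key
  rw [map_sub, PowerSeries.coeff_C_mul, PowerSeries.coeff_C_mul, PowerSeries.coeff_mul,
    PowerSeries.coeff_mul, PowerSeries.coeff_mul] at h
  simp only [hP, hZ, hG, hW, PowerSeries.coeff_mk] at h
  rw [lam, mul_comm _ (D.w i t), ← h, Finset.mul_sum, ← Finset.sum_sub_distrib]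
  refine Finset.sum_congr rfl fun x _ => ?_
  simp only [p, γ]
  ring

/-- The functional `e₁₂(c_{κ 1}) ⋯ e₁₂(c_{κ l})`. -/
def chi {k : ℕ} (κ : Fin k → RootIdx n l) (F : VPoly n) : K :=
  hat k (mapFock D.ev.toRingHom F) fun j => D.w (κ j)

theorem chi_transferOp (hl : l < n) {k : ℕ} (κ : Fin k → RootIdx n l) (m : ℕ) (F : VPoly n) :
    D.chi κ (transferOp (fun s => MvPolynomial.X s) m F) = (∑ j, D.lam m (κ j)) * D.chi κ F := by
  rw [chi, mapFock_transferOp]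
  have : (fun s => D.ev.toRingHom (MvPolynomial.X s)) = D.ζ := funext D.ev_X
  rw [this]
  exact hat_apply_of_eigen k _ (vac_transferOp _ _) _ _
    (fun j => annOp_transferOp_of_eigen _ _ _ _ (D.eigen hl (κ j) m)) _

theorem chi_smul {k : ℕ} (κ : Fin k → RootIdx n l) (q : MvPolynomial (Fin n) ℂ) (F : VPoly n) :
    D.chi κ (q • F) = D.ev q * D.chi κ F := by
  rw [chi, mapFock_smul, hat_smul]
  rfl

theorem chi_add {k : ℕ} (κ : Fin k → RootIdx n l) (F G : VPoly n) :
    D.chi κ (F + G) = D.chi κ F + D.chi κ G := by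
  rw [chi, mapFock_add, hat_add]
  rfl

/-- All polynomials are integral over the symmetric ones, and on these the evaluation is injective
because `symRoot` is. A prime ideal of an integral extension of domains that contracts to zero is
zero. -/
theorem ev_injective (hl : l < n) : Function.Injective D.ev := by
  let S := MvPolynomial.symmetricSubalgebra (Fin n) ℂ
  have hint : Algebra.IsIntegral S (MvPolynomial (Fin n) ℂ) := by
    refine ⟨fun x => ?_⟩
    induction x using MvPolynomial.induction_on with
    | C a =>
      let y : S := ⟨MvPolynomial.C a, S.algebraMap_mem a⟩
      exact isIntegral_algebraMap (x := y)
    | add a b ha hb => exact ha.add hb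
    | mul_X a s ha =>
      refine ha.mul ?_
      let d : Fin n → S := fun j => ⟨(-1) ^ ((j : ℕ) + 1) * MvPolynomial.esymm (Fin n) ℂ (j + 1),
        mul_mem (pow_mem (neg_mem (one_mem _)) _) (MvPolynomial.esymm_isSymmetric _ _ _)⟩
      refine ⟨monicPoly d, monic_monicPoly d, ?_⟩
      rw [← Polynomial.eval_map, map_monicPoly, monicPoly_eq_prod (Fintype.card_fin n)
        (MvPolynomial.X : Fin n → MvPolynomial (Fin n) ℂ), Polynomial.eval_prod]
      · exact Finset.prod_eq_zero (Finset.mem_univ s) (by simp)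
      · rw [← unitPoly_coeff_oneSub (Fintype.card_fin n) MvPolynomial.X]
        congr 1
        funext j
        rw [coeff_oneSub, MvPolynomial.aeval_X_left]
        rfl
  rw [injective_iff_map_eq_zero]
  have hker : RingHom.ker D.ev = ⊥ := by
    have : (RingHom.ker D.ev).IsPrime := RingHom.ker_isPrime _
    refine Ideal.eq_bot_of_comap_eq_bot (R := S) ?_
    rw [eq_bot_iff]
    rintro ⟨q, hq⟩ hq0
    obtain ⟨a, ha⟩ := exists_symToPoly hq
    change D.ev q = 0 at hq0
    rw [← ha, D.ev_symToPoly, map_eq_zero_iff _ D.injective,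
      map_eq_zero_iff _ (symRoot_injective hl)] at hq0
    rw [Ideal.mem_bot]
    ext1
    change q = 0
    rw [← ha, hq0, map_zero]
  intro q hq
  have : q ∈ RingHom.ker D.ev := hq
  rwa [hker] at this

end BetheField

theorem natCast_ne_zero (K : Type*) [Field K] [Algebra ℂ K] {n l : ℕ} (hl : l < n) : (n : K) ≠ 0 := by
  have : (n : K) = algebraMap ℂ K n := by simp
  rw [this, Ne, map_eq_zero_iff _ (algebraMap ℂ K).injective]
  exact Nat.cast_ne_zero.2 (by omega)

/-! ### Completeness of the eigenfunctionals -/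

namespace BetheField

variable {K : Type*} [Field K] [Algebra ℂ K] {n l : ℕ} (D : BetheField n l K)

theorem p_zero : D.p 0 = n := by simp [p]

/-- The moment with `q = 1` equals `-n` for every root, so the relation forces `∑ g_i = 0`. With
this, the recursion for the moments gives the same relation for `g_i c_i`, and iteration reaches a
Vandermonde system in the distinct `c_i`. -/
theorem eq_zero_of_sum_mul_γ (hl : l < n) {g : RootIdx n l → K}
    (h : ∀ q, ∑ i, g i * D.γ i q = 0) : g = 0 := by
  have hstep : ∀ r, ∑ i, g i * D.c i ^ r = 0 := by
    have key : ∀ r, (∀ q, ∑ i, g i * D.c i ^ r * D.γ i q = 0) → ∑ i, g i * D.c i ^ r = 0 := by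
      intro r hr
      have h1 := hr 1
      simp only [D.γ_succ hl, D.γ_zero hl, D.p_zero, mul_zero, zero_sub, mul_neg,
        Finset.sum_neg_distrib, neg_eq_zero] at h1
      rw [← Finset.sum_mul] at h1
      exact (mul_eq_zero.1 h1).resolve_right (natCast_ne_zero K hl)
    intro r
    refine key r ?_
    induction r with
    | zero => simpa using h
    | succ r ih =>
      intro q
      have h1 := ih (q + 1)
      have h2 := key r ih
      simp only [D.γ_succ hl] at h1
      have : ∑ i, g i * D.c i ^ (r + 1) * D.γ i q =
          ∑ i, g i * D.c i ^ r * (D.c i * D.γ i q - D.p q) + (∑ i, g i * D.c i ^ r) * D.p q := by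
        rw [Finset.sum_mul, ← Finset.sum_add_distrib]
        refine Finset.sum_congr rfl fun i _ => ?_
        ring
      rw [this, h1, h2, zero_mul, add_zero]
  let ε := (Fintype.equivFin (RootIdx n l)).symm
  have := Matrix.eq_zero_of_forall_pow_sum_mul_pow_eq_zero (f := D.c ∘ ε) (v := g ∘ ε)
    (D.c_injective.comp ε.injective) (fun r => by
      have := hstep r
      rw [← ε.sum_comp] at this
      exact this)
  funext i
  have h2 := congrFun this (ε.symm i)
  simpa using h2

/-- A relation is paired with the powers of `ζ`. The zeroth power isolates the coefficient of the
constant vector, because the zeroth moments vanish and `p 0 = n`; the moments then eliminate the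
others. -/
theorem linearIndependent_w (hl : l < n) : LinearIndependent K
    (Sum.elim D.w fun _ : Unit => fun _ : Fin n => (1 : K)) := by
  rw [Fintype.linearIndependent_iff]
  intro g hg
  have hs : ∀ s, ∑ i, g (Sum.inl i) * D.w i s + g (Sum.inr ()) = 0 := by
    intro s
    have := congrFun hg s
    simpa [Finset.sum_apply, Fintype.sum_sum_type] using this
  have hq : ∀ q, ∑ i, g (Sum.inl i) * D.γ i q + g (Sum.inr ()) * D.p q = 0 := by
    intro q
    have h1 : ∑ s, (∑ i, g (Sum.inl i) * D.w i s + g (Sum.inr ())) * D.ζ s ^ q = 0 := by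
      exact Finset.sum_eq_zero fun s _ => by rw [hs, zero_mul]
    simp only [add_mul, Finset.sum_add_distrib, Finset.sum_mul] at h1
    rw [Finset.sum_comm] at h1
    simpa only [γ, p, Finset.mul_sum, mul_assoc] using h1
  have hβ : g (Sum.inr ()) = 0 := by
    have := hq 0
    simp only [D.γ_zero hl, D.p_zero, mul_zero, Finset.sum_const_zero, zero_add] at this
    exact (mul_eq_zero.1 this).resolve_right (natCast_ne_zero K hl)
  simp only [hβ, zero_mul, add_zero] at hq
  have := D.eq_zero_of_sum_mul_γ hl hq
  rintro (i | ⟨⟩)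
  · exact congrFun this i
  · exact hβ

theorem hat_mapFock_single {k : ℕ} (F : VPoly n) (t : Fin k → Fin n) :
    hat k (mapFock D.ev.toRingHom F) (fun j => Pi.single (t j) 1) =
      D.ev (hat k F fun j => Pi.single (t j) 1) := by
  have h := hat_mapFock D.ev.toRingHom k F fun j => Pi.single (t j) 1
  rw [← show (fun j s => D.ev.toRingHom ((Pi.single (t j) 1 : Fin n → MvPolynomial (Fin n) ℂ) s)) =
    fun j => (Pi.single (t j) 1 : Fin n → K) from ?_]
  · exact h
  · funext j s
    by_cases hs : s = t j
    · subst hs; simp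
    · simp [Pi.single_eq_of_ne hs]

/-- A singular vector on which all the functionals vanish is zero. -/
theorem eq_zero_of_chi (hl : l < n) {F : VPoly n} (hF : F ∈ M n l)
    (h : ∀ κ : Fin l → RootIdx n l, Function.Injective κ → D.chi κ F = 0) : F = 0 := by
  rw [mem_M_iff] at hF
  refine eq_zero_of_hat hF.2.2 fun t => D.ev_injective hl ?_
  rw [map_zero, ← D.hat_mapFock_single]
  have : Nonempty (RootIdx n l ⊕ Unit) := ⟨Sum.inr ()⟩
  let b := basisOfLinearIndependentOfCardEqFinrank (D.linearIndependent_w hl) (by simp; omega)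
  have hb : ⇑b = Sum.elim D.w fun _ : Unit => fun _ : Fin n => (1 : K) :=
    coe_basisOfLinearIndependentOfCardEqFinrank _ _
  have h0 : hat l (mapFock D.ev.toRingHom F) = 0 := by
    refine Module.Basis.ext_alternating b fun v hv => ?_
    rw [AlternatingMap.zero_apply]
    -- On a basis tuple containing the constant vector the form vanishes because `F` is singular;
    -- every other injective tuple gives one of the functionals `chi κ`.
    by_cases hr : ∃ j, v j = Sum.inr ()
    · obtain ⟨j, hj⟩ := hr
      refine hat_eq_zero_of_annOp l (v := fun _ => 1) ?_ _ j ?_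
      · have := congrArg (mapFock D.ev.toRingHom) hF.2.1
        rw [mapFock_annOp, mapFock_zero] at this
        simpa using this
      · rw [hb, hj]; rfl
    · have hv' : ∀ j, ∃ i, v j = Sum.inl i := by
        intro j
        rcases hvj : v j with i | ⟨⟩
        · exact ⟨i, rfl⟩
        · exact absurd ⟨j, hvj⟩ hr
      choose κ hκ using hv'
      have h1 := h κ (fun i j hij => hv (by rw [hκ, hκ, hij]))
      rw [← h1, chi]
      congr 1
      funext j
      rw [hb, hκ]; rfl
  rw [h0]; rfl

end BetheField

/-! ### The values of the functionals on symmetric vectors -/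

theorem exists_symPsum (n q : ℕ) : ∃ a, symToPoly n a = MvPolynomial.psum (Fin n) ℂ q :=
  exists_symToPoly (MvPolynomial.psum_isSymmetric _ _ _)

/-- The power sums as elements of `SymRing`. -/
def symPsum (n q : ℕ) : SymRing n := (exists_symPsum n q).choose

theorem symToPoly_symPsum (n q : ℕ) : symToPoly n (symPsum n q) = MvPolynomial.psum (Fin n) ℂ q :=
  (exists_symPsum n q).choose_spec

/-- The moments as polynomials in the root. -/
def momentVar (n : ℕ) {l : ℕ} (j : Fin l) : ℕ → MvPolynomial (Fin l) (SymRing n)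
  | 0 => 0
  | q + 1 => MvPolynomial.X j * momentVar n j q - MvPolynomial.C (symPsum n q)

/-- The linear map sending `∏ u_j ^ m_j` to the product of the moments of degree `m_j`. -/
def momentMap (n l : ℕ) : MvPolynomial (Fin l) (SymRing n) →ₗ[SymRing n]
    MvPolynomial (Fin l) (SymRing n) :=
  (MvPolynomial.basisMonomials (Fin l) (SymRing n)).constr (SymRing n) fun m =>
    ∏ j, momentVar n j (m j)

theorem momentMap_monomial (n : ℕ) {l : ℕ} (m : Fin l →₀ ℕ) (a : SymRing n) :
    momentMap n l (MvPolynomial.monomial m a) = MvPolynomial.C a * ∏ j, momentVar n j (m j) := by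
  have h := (MvPolynomial.basisMonomials (Fin l) (SymRing n)).constr_basis (SymRing n)
    (fun m => ∏ j, momentVar n j (m j)) m
  rw [MvPolynomial.coe_basisMonomials] at h
  have : MvPolynomial.monomial m a = a • MvPolynomial.monomial m (1 : SymRing n) := by
    rw [MvPolynomial.smul_monomial, smul_eq_mul, mul_one]
  rw [this, map_smul, momentMap, h, MvPolynomial.smul_eq_C_mul]

theorem rename_momentVar {n l : ℕ} (σ : Equiv.Perm (Fin l)) (j : Fin l) (q : ℕ) :
    MvPolynomial.rename σ (momentVar n j q) = momentVar n (σ j) q := by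
  induction q with
  | zero => simp [momentVar]
  | succ q ih => simp [momentVar, ih]

/-- The same substitution is made in every variable, so alternating polynomials go to alternating
polynomials. -/
theorem rename_momentMap {n l : ℕ} (σ : Equiv.Perm (Fin l)) (P : MvPolynomial (Fin l) (SymRing n)) :
    MvPolynomial.rename σ (momentMap n l P) = momentMap n l (MvPolynomial.rename σ P) := by
  induction P using MvPolynomial.induction_on' with
  | monomial m a =>
    rw [MvPolynomial.rename_monomial, momentMap_monomial, momentMap_monomial, map_mul, map_prod,
      MvPolynomial.rename_C]
    congr 1
    rw [← Equiv.prod_comp σ (fun j => momentVar n j (Finsupp.mapDomain σ m j))]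
    refine Finset.prod_congr rfl fun j _ => ?_
    rw [rename_momentVar, Finsupp.mapDomain_apply σ.injective]
  | add p q hp hq => simp only [map_add, hp, hq]

/-- Evaluation at chosen roots. -/
def evalAt {n l : ℕ} (κ : Fin l → RootIdx n l) :
    MvPolynomial (Fin l) (SymRing n) →+* RootRing n l :=
  MvPolynomial.eval₂Hom (symRoot n l).toRingHom fun j => rootVar n l (κ j)

theorem evalAt_C {n l : ℕ} (κ : Fin l → RootIdx n l) (a : SymRing n) :
    evalAt κ (MvPolynomial.C a) = symRoot n l a := by simp [evalAt]

theorem evalAt_X {n l : ℕ} (κ : Fin l → RootIdx n l) (j : Fin l) :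
    evalAt κ (MvPolynomial.X j) = rootVar n l (κ j) := by simp [evalAt]

namespace BetheField

variable {K : Type*} [Field K] [Algebra ℂ K] {n l : ℕ} (D : BetheField n l K)

theorem ev_psum (q : ℕ) : D.ev (MvPolynomial.psum (Fin n) ℂ q) = D.p q := by
  simp [MvPolynomial.psum, p, ev_X]

theorem evalAt_momentVar (hl : l < n) (κ : Fin l → RootIdx n l) (j : Fin l) (q : ℕ) :
    D.φ (evalAt κ (momentVar n j q)) = D.γ (κ j) q := by
  induction q with
  | zero => simp [momentVar, D.γ_zero hl]
  | succ q ih =>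
    rw [momentVar, map_sub, map_mul, map_sub, map_mul, ih, D.γ_succ hl, evalAt_C, evalAt_X,
      ← D.ev_symToPoly, symToPoly_symPsum, ev_psum]
    rfl

/-- When `hat` is expanded in coordinates, a monomial makes the sum over all tuples `t` factor into
sums over single sites, and these are the moments. -/
theorem chi_of_substAt (hl : l < n) {F : VPoly n} {P : MvPolynomial (Fin l) (SymRing n)}
    (hP : ∀ t : Fin l → Fin n, substAt t P = hat l F fun j => Pi.single (t j) 1)
    (κ : Fin l → RootIdx n l) : D.chi κ F = D.φ (evalAt κ (momentMap n l P)) := by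
  rw [chi, hat_eq_sum]
  simp only [hat_mapFock_single, ← hP]
  clear hP
  induction P using MvPolynomial.induction_on' with
  | monomial m a =>
    have h : ∀ t : Fin l → Fin n, D.ev (substAt t (MvPolynomial.monomial m a)) =
        D.φ (symRoot n l a) * ∏ j, D.ζ (t j) ^ m j := by
      intro t
      rw [substAt, MvPolynomial.coe_eval₂Hom, MvPolynomial.eval₂_monomial, map_mul,
        Finsupp.prod_fintype _ _ (fun i => pow_zero _), map_prod]
      congr 1
      · exact D.ev_symToPoly a
      · refine Finset.prod_congr rfl fun j _ => ?_
        rw [map_pow, ev_X]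
    simp only [h, momentMap_monomial, map_mul, map_prod, evalAt_C, D.evalAt_momentVar hl]
    simp only [γ, Finset.prod_univ_sum, Finset.mul_sum, Fintype.piFinset_univ,
      Finset.prod_mul_distrib]
    refine Finset.sum_congr rfl fun t _ => ?_
    ring
  | add p q hp hq =>
    simp only [map_add, mul_add, Finset.sum_add_distrib, hp, hq]

/-- The same alternating polynomial serves all `κ`, and so does its quotient by the Vandermonde
product. This is what allows different choices of roots to be compared. -/
theorem exists_chi_eq (hl : l < n) {F : VPoly n} (hF : F ∈ VSym n) :
    ∃ S : MvPolynomial (Fin l) (SymRing n), S.IsSymmetric ∧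
      ∀ κ, D.chi κ F = D.φ (evalAt κ (vdm MvPolynomial.X * S)) := by
  obtain ⟨P, hP, hPt⟩ := exists_alternating hl.le hF
  obtain ⟨S, hS, hPS⟩ := exists_eq_vdm_mul (P := momentMap n l P) fun σ => by
    rw [rename_momentMap, hP, Units.smul_def, map_zsmul, Units.smul_def]
  refine ⟨S, hS, fun κ => ?_⟩
  rw [D.chi_of_substAt hl hPt, hPS]

end BetheField

theorem evalAt_vdm {n l : ℕ} (κ : Fin l → RootIdx n l) :
    evalAt κ (vdm MvPolynomial.X) = vdm fun j => rootVar n l (κ j) := by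
  rw [vdm, vdm, RingHom.map_det]
  congr 1
  ext i j
  simp [Matrix.vandermonde_apply, evalAt_X]

/-- A symmetric polynomial in the roots of `f` is a polynomial in the `f_i`, and its coefficients
come from `SymRing`, whose image already factors through `𝓞_l`. -/
theorem evalAt_mem_range {n l : ℕ} {S : MvPolynomial (Fin l) (SymRing n)} (hS : S.IsSymmetric) :
    ∃ F : O n l, evalAt Sum.inl S = rootHom n l F := by
  obtain ⟨q, hq⟩ := (MvPolynomial.esymmAlgEquiv (Fin l) (SymRing n)
    (Fintype.card_fin l)).surjective ⟨S, hS⟩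
  have hq' : MvPolynomial.aeval (fun i : Fin l => MvPolynomial.esymm (Fin l) (SymRing n) (i + 1)) q
      = S := by
    rw [← MvPolynomial.esymmAlgHom_apply]
    exact congrArg Subtype.val hq
  rw [← hq']
  clear hq' hq hS
  suffices h : evalAt Sum.inl (MvPolynomial.aeval
      (fun i : Fin l => MvPolynomial.esymm (Fin l) (SymRing n) (i + 1)) q) ∈ (rootHom n l).range by
    obtain ⟨F, hF⟩ := h
    exact ⟨F, hF.symm⟩
  induction q using MvPolynomial.induction_on with
  | C a =>
    rw [MvPolynomial.aeval_C, MvPolynomial.algebraMap_eq, evalAt_C]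
    exact ⟨_, rfl⟩
  | add a b ha hb => rw [map_add, map_add]; exact add_mem ha hb
  | mul_X a i ha =>
    rw [map_mul, map_mul, MvPolynomial.aeval_X]
    refine mul_mem ha ?_
    have h1 : evalAt Sum.inl (MvPolynomial.esymm (Fin l) (SymRing n) (i + 1)) =
        MvPolynomial.aeval (fun k : Fin l => rootVar n l (Sum.inl k))
          (MvPolynomial.esymm (Fin l) ℂ (i + 1)) := by
      simp only [MvPolynomial.esymm, map_sum, map_prod, evalAt_X, MvPolynomial.aeval_X]
    have h2 := coeff_oneSub (fun k : Fin l => rootVar n l (Sum.inl k)) (i + 1)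
    rw [← h1, ← rootHom_f, Polynomial.coeff_map] at h2
    refine ⟨(-1) ^ ((i : ℕ) + 1) * (unitPoly (fVar n l)).coeff (i + 1), ?_⟩
    have h3 := congrArg (fun x => (-1) ^ ((i : ℕ) + 1) * x) h2
    simp only [neg_one_pow_mul_self_mul] at h3
    rw [← h3]
    simp

theorem rename_evalAt {n l : ℕ} (hl : l < n) (π : Equiv.Perm (RootIdx n l))
    (κ : Fin l → RootIdx n l) (Q : MvPolynomial (Fin l) (SymRing n)) :
    MvPolynomial.rename (Sum.map π id) (evalAt κ Q) = evalAt (π ∘ κ) Q := by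
  have : (MvPolynomial.rename (Sum.map π id) : RootRing n l →ₐ[ℂ] RootRing n l).toRingHom.comp
      (evalAt κ) = evalAt (π ∘ κ) := by
    refine MvPolynomial.ringHom_ext (fun a => ?_) fun i => ?_
    · rw [RingHom.comp_apply, evalAt_C, evalAt_C]
      exact rename_symRoot hl π a
    · rw [RingHom.comp_apply, evalAt_X, evalAt_X]
      simp [rootVar]
  exact congrArg (fun f => f Q) this

theorem exists_perm_comp_eq {α β : Type*} [Finite α] {f g : β → α} (hf : Function.Injective f)
    (hg : Function.Injective g) : ∃ π : Equiv.Perm α, π ∘ f = g := by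
  classical
  have := Fintype.ofFinite α
  let ε : {x // x ∈ Set.range f} ≃ {x // x ∈ Set.range g} :=
    (Equiv.ofInjective f hf).symm.trans (Equiv.ofInjective g hg)
  refine ⟨ε.extendSubtype, funext fun b => ?_⟩
  rw [Function.comp_apply, Equiv.extendSubtype_apply_of_mem _ _ ⟨b, rfl⟩]
  have : (Equiv.ofInjective f hf).symm ⟨f b, ⟨b, rfl⟩⟩ = b :=
    (Equiv.ofInjective f hf).symm_apply_apply b
  simp [ε, this]

/-! ### The functional of the roots of `f` and its value on the cyclic vector -/

namespace BetheField

variable {K : Type*} [Field K] [Algebra ℂ K] {n l : ℕ} (D : BetheField n l K)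

/-- The Vandermonde product of the roots of `f`. -/
def delta : K := D.φ (vdm fun j : Fin l => rootVar n l (Sum.inl j))

theorem delta_ne_zero : D.delta ≠ 0 := by
  rw [delta, Ne, map_eq_zero_iff _ D.injective, vdm, ← Ne, Matrix.det_vandermonde_ne_zero_iff]
  exact (MvPolynomial.X_injective (R := ℂ)).comp (Sum.inl_injective.comp Sum.inl_injective)

theorem exists_chi_inl_eq (hl : l < n) {F : VPoly n} (hF : F ∈ VSym n) :
    ∃ H : O n l, D.chi Sum.inl F = D.delta * D.φ (rootHom n l H) := by
  obtain ⟨S, hS, h⟩ := D.exists_chi_eq hl hF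
  obtain ⟨H, hH⟩ := evalAt_mem_range hS
  exact ⟨H, by rw [h, map_mul, map_mul, evalAt_vdm, hH, delta]⟩

/-- A singular vector is determined by the functional attached to the roots of `f`. -/
theorem eq_zero_of_chi_inl (hl : l < n) {F : VPoly n} (hF : F ∈ M n l)
    (h : D.chi Sum.inl F = 0) : F = 0 := by
  refine D.eq_zero_of_chi hl hF fun κ hκ => ?_
  obtain ⟨S, hS, hc⟩ := D.exists_chi_eq hl (mem_M_iff.1 hF).1
  -- A permutation of all roots of `f g` carries the roots of `f` to the choice `κ`. It fixes the
  -- coefficients that come from `SymRing`, so it carries one value of the functional to the other.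
  obtain ⟨π, hπ⟩ := exists_perm_comp_eq (Sum.inl_injective (α := Fin l) (β := Fin (n - l - 1))) hκ
  rw [hc, map_eq_zero_iff _ D.injective] at h
  rw [hc, ← hπ, ← rename_evalAt hl, h, map_zero, map_zero]

/-- The polynomials expressing the moments through the root. -/
def momentPoly : ℕ → Polynomial K
  | 0 => 1
  | q + 1 => Polynomial.X * momentPoly q + Polynomial.C (D.p (q + 1) / n)

theorem momentPoly_monic (q : ℕ) :
    (D.momentPoly q).Monic ∧ (D.momentPoly q).natDegree = q := by
  induction q with
  | zero => exact ⟨Polynomial.monic_one, Polynomial.natDegree_one⟩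
  | succ q ih =>
    have h1 : (Polynomial.X * D.momentPoly q).Monic := Polynomial.monic_X.mul ih.1
    have h2 : (Polynomial.X * D.momentPoly q).natDegree = q + 1 := by
      rw [Polynomial.Monic.natDegree_mul Polynomial.monic_X ih.1, Polynomial.natDegree_X, ih.2,
        add_comm]
    have h3 : (Polynomial.C (D.p (q + 1) / n)).degree < (Polynomial.X * D.momentPoly q).degree := by
      rw [Polynomial.degree_eq_natDegree h1.ne_zero, h2]
      refine Polynomial.degree_C_le.trans_lt ?_
      exact_mod_cast Nat.succ_pos q
    exact ⟨h1.add_of_left h3, by rw [momentPoly, Polynomial.natDegree_add_C, h2]⟩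

/-- Each moment is `-n` times a monic polynomial in the root, of degree one less than its index,
which is what a Vandermonde determinant requires. -/
theorem γ_eq_eval (hl : l < n) (i : RootIdx n l) (q : ℕ) :
    D.γ i (q + 1) = -(n : K) * (D.momentPoly q).eval (D.c i) := by
  have hn := natCast_ne_zero K hl
  induction q with
  | zero => simp [D.γ_succ hl, D.γ_zero hl, momentPoly, D.p_zero]
  | succ q ih =>
    rw [D.γ_succ hl, ih, momentPoly]
    simp only [Polynomial.eval_add, Polynomial.eval_mul, Polynomial.eval_X, Polynomial.eval_C]
    field_simp
    ring

/-- By `hat_creVec` the value is a determinant of size `l + 1`. By the Bethe equations its first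
column is `n` followed by zeros, and the remaining block is `-n` times the values of monic
polynomials of degrees `0, …, l - 1` at the roots of `f`. -/
theorem chi_uvec (hl : l < n) :
    D.chi Sum.inl (uvec n l) = (n : K) * ((-(n : K)) ^ l * D.delta) := by
  have h1 : D.chi Sum.inl (uvec n l) = hat (l + 1) (creVec (l + 1) fun i s => D.ζ s ^ (i : ℕ))
      (Fin.cons (fun _ => 1) fun j => D.w (Sum.inl j)) := by
    rw [hat_succ, chi, uvec_eq, mapFock_annOp, mapFock_creVec]
    have h : ∀ s, D.ev.toRingHom (MvPolynomial.X s) = D.ζ s := D.ev_X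
    simp only [map_pow, map_one, h, Fin.cons_zero, Fin.cons_succ]
  rw [h1, hat_creVec, Matrix.det_succ_column_zero, Fin.sum_univ_succ]
  have h2 : ∀ i : Fin l, ∑ s, D.w (Sum.inl i) s = 0 := fun i => D.sum_w hl _
  simp only [Matrix.of_apply, Fin.cons_zero, Fin.cons_succ, Fin.val_zero, pow_zero, mul_one, one_mul,
    h2, mul_zero, zero_mul, Finset.sum_const_zero, add_zero, Finset.sum_const, Finset.card_univ,
    Fintype.card_fin, nsmul_eq_mul]
  congr 1
  have h3 : (Matrix.of fun (i j : Fin (l + 1)) => ∑ s,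
      (Fin.cons (fun _ => 1) (fun j => D.w (Sum.inl j)) : Fin (l + 1) → Fin n → K) i s *
        D.ζ s ^ (j : ℕ)).submatrix (Fin.succAbove 0) Fin.succ =
      (-(n : K)) • Matrix.of fun i j : Fin l => (D.momentPoly j).eval (D.c (Sum.inl i)) := by
    ext i j
    simp only [Matrix.submatrix_apply, Matrix.of_apply, Fin.succAbove_zero, Fin.cons_succ,
      Matrix.smul_apply, smul_eq_mul, Fin.val_succ]
    exact D.γ_eq_eval hl _ _
  rw [h3, Matrix.det_smul, Fintype.card_fin]
  congr 1
  rw [← Matrix.det_eval_matrixOfPolynomials_eq_det_vandermonde _ (fun j : Fin l => D.momentPoly j)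
    (fun j => (D.momentPoly_monic j).2) fun j => (D.momentPoly_monic j).1, delta, vdm]
  rw [← AlgHom.coe_toRingHom, RingHom.map_det]
  congr 1
  ext i j
  simp [Matrix.vandermonde_apply, c]

end BetheField

/-! ### The eigenvalues of the elements `B_i` -/

/-- Each geometric series is the inverse of one factor of the product, which leaves the product of
the other factors. -/
theorem oneSub_mul_sum_mk {K : Type*} [Field K] {ι : Type*} [Fintype ι] [DecidableEq ι]
    (x : ι → K) : (oneSub x : PowerSeries K) * ∑ i, PowerSeries.mk (fun k => x i ^ k) =
      ((∑ i, ∏ j ∈ Finset.univ.erase i, (1 - Polynomial.C (x j) * Polynomial.X) : Polynomial K) :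
        PowerSeries K) := by
  rw [← Polynomial.coeToPowerSeries.ringHom_apply, ← Polynomial.coeToPowerSeries.ringHom_apply,
    map_sum, Finset.mul_sum]
  refine Finset.sum_congr rfl fun i _ => ?_
  have h : oneSub x = (∏ j ∈ Finset.univ.erase i, (1 - Polynomial.C (x j) * Polynomial.X)) *
      (1 - Polynomial.C (x i) * Polynomial.X) := (Finset.prod_erase_mul _ _ (Finset.mem_univ i)).symm
  have h1 := mk_pow_mul (x i)
  rw [h, map_mul]
  have h2 : Polynomial.coeToPowerSeries.ringHom (1 - Polynomial.C (x i) * Polynomial.X) =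
      1 - PowerSeries.C (x i) * PowerSeries.X := by
    simp
  rw [h2, mul_assoc, mul_comm (1 - _), h1, mul_one]

/-- The coefficients of `∏ (1 - z_s x)`. -/
def charCoeff (n k : ℕ) : MvPolynomial (Fin n) ℂ :=
  (oneSub (MvPolynomial.X : Fin n → MvPolynomial (Fin n) ℂ)).coeff k

theorem charCoeff_eq (n k : ℕ) :
    charCoeff n k = (-1) ^ k * MvPolynomial.esymm (Fin n) ℂ k := by
  rw [charCoeff, coeff_oneSub, MvPolynomial.aeval_X_left]; rfl

theorem charCoeff_isSymmetric (n k : ℕ) : (charCoeff n k).IsSymmetric := by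
  rw [charCoeff_eq]
  exact mul_mem (pow_mem (neg_mem (one_mem (MvPolynomial.symmetricSubalgebra (Fin n) ℂ))) k)
    (MvPolynomial.esymm_isSymmetric (Fin n) ℂ k)

/-- The operator by which `B_{i+2}` acts. -/
def bOp (n i : ℕ) (F : VPoly n) : VPoly n :=
  ∑ x ∈ Finset.HasAntidiagonal.antidiagonal i,
    charCoeff n x.1 • transferOp (fun s => (MvPolynomial.X s : MvPolynomial (Fin n) ℂ)) x.2 F

theorem act_centralSer {n : ℕ} {C : ℕ → CurrentU} (hC : IsCentralLift n C) (j : ℕ) {F : VPoly n}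
    (hF : F ∈ VSym n) : act n (PowerSeries.coeff j (centralSer n C)) F = charCoeff n j • F := by
  rw [centralSer, map_add, map_sum, charCoeff_eq]
  simp only [PowerSeries.coeff_monomial]
  rcases Nat.eq_zero_or_pos j with rfl | hj
  · rw [Finset.sum_eq_zero]
    · simp
    · intro k hk
      have := (Finset.mem_Icc.1 hk).1
      rw [if_neg (by omega)]
  · rw [PowerSeries.coeff_one, if_neg (by omega), zero_add, Finset.sum_ite_eq]
    by_cases hjn : j ≤ n
    · rw [if_pos (Finset.mem_Icc.2 ⟨hj, hjn⟩), map_smul, LinearMap.smul_apply, (hC j hj hjn).2 F hF,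
        mul_smul]
      rcases Nat.even_or_odd j with h | h
      · simp [h.neg_one_pow]
      · simp [h.neg_one_pow]
    · rw [if_neg (fun h => hjn (Finset.mem_Icc.1 h).2), map_zero, MvPolynomial.esymm,
        Finset.powersetCard_eq_empty.2 (by simp; omega), Finset.sum_empty, mul_zero, zero_smul]
      rfl

theorem act_B {n : ℕ} {C : ℕ → CurrentU} (hC : IsCentralLift n C) (i : ℕ) {F : VPoly n}
    (hF : F ∈ VSym n) : act n (B n C (i + 2)) F = bOp n i F := by
  rw [B, PowerSeries.coeff_mul, map_sum, LinearMap.sum_apply]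
  rw [Finset.Nat.sum_antidiagonal_succ', Finset.Nat.sum_antidiagonal_succ']
  -- The transfer series begins in degree 2; this is the shift between `B_{i+2}` and `G_i`.
  rw [coeff_transferSer_of_lt 0 (by omega), coeff_transferSer_of_lt 1 (by omega), mul_zero,
    mul_zero, map_zero, LinearMap.zero_apply, zero_add, zero_add, bOp]
  refine Finset.sum_congr rfl fun x _ => ?_
  -- The elements `C_j` are known to act by `σ_j` only on `𝒱^𝔖`, so it matters that the transfer
  -- operator maps into that space.
  rw [map_mul, Module.End.mul_apply, act_coeff_transferSer,
    act_centralSer hC _ (transferOp_mem_VSym _ hF)]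

theorem bOp_mem_M {n l : ℕ} (i : ℕ) {F : VPoly n} (hF : F ∈ M n l) : bOp n i F ∈ M n l :=
  sum_mem fun _ _ => smul_mem_M (charCoeff_isSymmetric _ _) (transferOp_mem_M _ hF)

namespace BetheField

variable {K : Type*} [Field K] [Algebra ℂ K] {n l : ℕ} (D : BetheField n l K)

theorem chi_sum {k : ℕ} (κ : Fin k → RootIdx n l) {ι : Type*} (T : Finset ι) (F : ι → VPoly n) :
    D.chi κ (∑ i ∈ T, F i) = ∑ i ∈ T, D.chi κ (F i) := by
  simp only [chi, mapFock_sum, hat_sum]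

theorem ev_charCoeff (k : ℕ) : D.ev (charCoeff n k) = (oneSub D.ζ).coeff k := by
  have h := map_oneSub D.ev.toRingHom (MvPolynomial.X : Fin n → MvPolynomial (Fin n) ℂ)
  have h2 : (fun s => D.ev.toRingHom (MvPolynomial.X s)) = D.ζ := funext D.ev_X
  rw [h2] at h
  rw [← h, Polynomial.coeff_map]
  rfl

theorem mk_lam (i : RootIdx n l) : PowerSeries.mk (fun m => D.lam m i) =
    PowerSeries.mk D.p * PowerSeries.mk fun k => D.c i ^ k := by
  ext m
  rw [PowerSeries.coeff_mul]
  simp [lam]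

theorem coeff_map_rootHom_euler (i : ℕ) :
    D.φ (rootHom n l (((Polynomial.C (l : O n l) * unitPoly (fVar n l) -
      Polynomial.X * Polynomial.derivative (unitPoly (fVar n l))) * unitPoly (gVar n l)).coeff i)) =
    ((∑ j : Fin l, ∏ k ∈ Finset.univ.erase j,
      (1 - Polynomial.C (D.c (Sum.inl k)) * Polynomial.X)) *
        oneSub fun k => D.c (Sum.inr k)).coeff i := by
  have hf := congrArg (Polynomial.map D.φ.toRingHom) (rootHom_f n l)
  have hg := congrArg (Polynomial.map D.φ.toRingHom) (rootHom_g n l)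
  rw [map_oneSub] at hf hg
  change _ = oneSub fun k => D.c (Sum.inl k) at hf
  change _ = oneSub fun k => D.c (Sum.inr k) at hg
  rw [sum_prod_erase_oneSub, Fintype.card_fin, ← hf, ← hg, Polynomial.map_map, Polynomial.map_map]
  set Φ := D.φ.toRingHom.comp (rootHom n l).toRingHom with hΦ
  have h : Polynomial.C (l : K) * (unitPoly (fVar n l)).map Φ -
      Polynomial.X * Polynomial.derivative ((unitPoly (fVar n l)).map Φ) =
      (Polynomial.C (l : O n l) * unitPoly (fVar n l) -
        Polynomial.X * Polynomial.derivative (unitPoly (fVar n l))).map Φ := by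
    simp [Polynomial.derivative_map]
  rw [h, ← Polynomial.map_mul, Polynomial.coeff_map]
  rfl

/-- In reversed form, `Q` times the series of power sums is `Q' = n f g`. Multiplying by `∑_j 1 / (1
- c_j X)` over the roots of `f` replaces `f` by `f'` and gives `n f' g`, whose coefficients are the
`G_i`. -/
theorem sum_coeff_mul_lam (hl : l < n) {i : ℕ} (hi : i + 2 ≤ n) :
    ∑ x ∈ Finset.HasAntidiagonal.antidiagonal i,
      (oneSub D.ζ).coeff x.1 * ∑ j : Fin l, D.lam x.2 (Sum.inl j) =
    D.φ (rootHom n l (GO n l i)) := by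
  rw [GO_eq hl hi, map_smul, map_smul, D.coeff_map_rootHom_euler, Algebra.smul_def, map_natCast]
  have hP : PowerSeries.mk D.p = ∑ s, PowerSeries.mk fun k => D.ζ s ^ k := by
    ext k; simp [p]
  have hL : PowerSeries.mk (fun m => ∑ j : Fin l, D.lam m (Sum.inl j)) =
      PowerSeries.mk D.p * ∑ j : Fin l, PowerSeries.mk fun k => D.c (Sum.inl j) ^ k := by
    rw [Finset.mul_sum]
    simp only [← D.mk_lam]
    ext k; simp
  have h1 : (oneSub D.ζ : PowerSeries K) * PowerSeries.mk D.p =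
      ((Polynomial.C (n : K) * oneSub D.c : Polynomial K) : PowerSeries K) := by
    rw [hP, oneSub_mul_sum_mk, D.sum_prod_erase_ζ hl]
  have h2 : oneSub D.c = (oneSub fun k => D.c (Sum.inl k)) * oneSub fun k => D.c (Sum.inr k) := by
    rw [oneSub, Fintype.prod_sum_type]; rfl
  have h3 : (oneSub D.ζ : PowerSeries K) * PowerSeries.mk (fun m => ∑ j : Fin l, D.lam m (Sum.inl j)) =
      ((Polynomial.C (n : K) * ((∑ j : Fin l, ∏ k ∈ Finset.univ.erase j,
      (1 - Polynomial.C (D.c (Sum.inl k)) * Polynomial.X)) *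
        oneSub fun k => D.c (Sum.inr k)) : Polynomial K) : PowerSeries K) := by
    rw [hL, ← mul_assoc, h1, h2, Polynomial.coe_mul, Polynomial.coe_mul, Polynomial.coe_mul,
      Polynomial.coe_mul, ← oneSub_mul_sum_mk]
    ring
  have h4 := congrArg (PowerSeries.coeff i) h3
  rw [PowerSeries.coeff_mul, Polynomial.coeff_coe, Polynomial.coeff_C_mul] at h4
  simpa using h4

theorem chi_bOp (hl : l < n) {i : ℕ} (hi : i + 2 ≤ n) (F : VPoly n) :
    D.chi Sum.inl (bOp n i F) = D.φ (rootHom n l (GO n l i)) * D.chi Sum.inl F := by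
  rw [bOp, chi_sum, ← D.sum_coeff_mul_lam hl hi, Finset.sum_mul]
  refine Finset.sum_congr rfl fun x _ => ?_
  rw [chi_smul, D.chi_transferOp hl, ev_charCoeff, mul_assoc]

theorem ev_esymm {j : ℕ} (hj : 1 ≤ j) (hjn : j ≤ n) :
    D.ev (MvPolynomial.esymm (Fin n) ℂ j) = D.φ (rootHom n l (SigmaO n l j)) := by
  obtain ⟨j, rfl⟩ : ∃ k, j = k + 1 := ⟨j - 1, by omega⟩
  have := D.esymm_ζ ⟨j, by omega⟩
  rwa [symRoot_X] at this

theorem ev_symToO (q : MvPolynomial.symmetricSubalgebra (Fin n) ℂ) :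
    D.ev q = D.φ (rootHom n l (symToO n l q)) := by
  obtain ⟨a, rfl⟩ := (MvPolynomial.esymmAlgEquiv (Fin n) ℂ (Fintype.card_fin n)).surjective q
  have h : (((MvPolynomial.esymmAlgEquiv (Fin n) ℂ (Fintype.card_fin n)) a :
      MvPolynomial.symmetricSubalgebra (Fin n) ℂ) : MvPolynomial (Fin n) ℂ) = symToPoly n a := by
    rw [symToPoly, ← MvPolynomial.esymmAlgHom_apply]; rfl
  have h2 : (MvPolynomial.esymmAlgEquiv (Fin n) ℂ (Fintype.card_fin n)).symm.toAlgHom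
      (MvPolynomial.esymmAlgEquiv (Fin n) ℂ (Fintype.card_fin n) a) = a :=
    AlgEquiv.symm_apply_apply _ _
  rw [h, D.ev_symToPoly, symToO, AlgHom.comp_apply, h2]
  rfl

end BetheField

/-! ### Degrees -/

theorem smul_mem_VHom {n d m : ℕ} {q : MvPolynomial (Fin n) ℂ} (hq : q.IsHomogeneous d)
    {F : VPoly n} (hF : F ∈ VHom n m) : q • F ∈ VHom n (m + d) := fun J => by
  rw [add_comm]; exact hq.mul (hF J)

theorem fockOp_mem_VHom {n m : ℕ} (i j : Fin 2) (s : Fin n) {F : VPoly n} (hF : F ∈ VHom n m) :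
    fockOp (MvPolynomial (Fin n) ℂ) n i j s F ∈ VHom n m := fun J => by
  have h : fockOp (MvPolynomial (Fin n) ℂ) n i j s F J = if J s = i then
      (-1) ^ ((∑ k ∈ Finset.Iio s, (J k : ℕ)) * ((i : ℕ) + j)) * F (Function.update J s j)
    else 0 := rfl
  rw [h]
  split_ifs
  · rcases neg_one_pow_eq_or (MvPolynomial (Fin n) ℂ)
      ((∑ k ∈ Finset.Iio s, (J k : ℕ)) * ((i : ℕ) + j)) with h1 | h1
    · rw [h1, one_mul]; exact hF _
    · rw [h1, neg_one_mul]
      exact (MvPolynomial.homogeneousSubmodule (Fin n) ℂ m).neg_mem (hF _)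
  · exact MvPolynomial.isHomogeneous_zero _ _ _

theorem isHomogeneous_X_pow' {n : ℕ} (s : Fin n) (r : ℕ) :
    (MvPolynomial.X s ^ r : MvPolynomial (Fin n) ℂ).IsHomogeneous r := by
  simpa using (MvPolynomial.isHomogeneous_X ℂ s).pow r

theorem annOp_mem_VHom {n m : ℕ} (r : ℕ) {F : VPoly n} (hF : F ∈ VHom n m) :
    annOp (fun s => (MvPolynomial.X s : MvPolynomial (Fin n) ℂ) ^ r) F ∈ VHom n (m + r) := by
  rw [annOp, LinearMap.sum_apply]
  exact sum_mem fun s _ => smul_mem_VHom (isHomogeneous_X_pow' s r) (fockOp_mem_VHom _ _ _ hF)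

theorem creOp_mem_VHom {n m : ℕ} (r : ℕ) {F : VPoly n} (hF : F ∈ VHom n m) :
    creOp (fun s => (MvPolynomial.X s : MvPolynomial (Fin n) ℂ) ^ r) F ∈ VHom n (m + r) := by
  rw [creOp, LinearMap.sum_apply]
  exact sum_mem fun s _ => smul_mem_VHom (isHomogeneous_X_pow' s r) (fockOp_mem_VHom _ _ _ hF)

theorem numOp_mem_VHom {n m : ℕ} (r : ℕ) {F : VPoly n} (hF : F ∈ VHom n m) :
    numOp (fun s => (MvPolynomial.X s : MvPolynomial (Fin n) ℂ) ^ r) F ∈ VHom n (m + r) := by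
  rw [numOp, LinearMap.sum_apply]
  exact sum_mem fun s _ => smul_mem_VHom (isHomogeneous_X_pow' s r) (fockOp_mem_VHom _ _ _ hF)

theorem transferOp_mem_VHom {n m : ℕ} (r : ℕ) {F : VPoly n} (hF : F ∈ VHom n m) :
    transferOp (fun s => (MvPolynomial.X s : MvPolynomial (Fin n) ℂ)) r F ∈ VHom n (m + r) := by
  rw [transferOp, LinearMap.sum_apply]
  refine sum_mem fun x hx => ?_
  rw [LinearMap.sub_apply, LinearMap.smul_apply, Module.End.mul_apply]
  have hx' := Finset.HasAntidiagonal.mem_antidiagonal.1 hx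
  refine sub_mem ?_ ?_
  · rw [← hx', add_comm x.1, ← add_assoc]
    refine smul_mem_VHom ?_ (numOp_mem_VHom _ hF)
    exact MvPolynomial.IsHomogeneous.sum _ _ _ fun s _ => isHomogeneous_X_pow' s _
  · rw [← hx', add_comm x.1, ← add_assoc]
    exact creOp_mem_VHom _ (annOp_mem_VHom _ hF)

theorem isHomogeneous_esymm (n k : ℕ) : (MvPolynomial.esymm (Fin n) ℂ k).IsHomogeneous k := by
  refine MvPolynomial.IsHomogeneous.sum _ _ _ fun s hs => ?_
  have h := MvPolynomial.IsHomogeneous.prod s (fun i : Fin n => (MvPolynomial.X i : MvPolynomial _ ℂ))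
    (fun _ => 1) fun i _ => MvPolynomial.isHomogeneous_X ℂ i
  rwa [Finset.sum_const, (Finset.mem_powersetCard.1 hs).2, smul_eq_mul, mul_one] at h

theorem isHomogeneous_charCoeff (n k : ℕ) : (charCoeff n k).IsHomogeneous k := by
  have h : charCoeff n k = MvPolynomial.C ((-1) ^ k) * MvPolynomial.esymm (Fin n) ℂ k := by
    rw [charCoeff_eq]; simp
  rw [h]
  exact (isHomogeneous_esymm n k).C_mul _

theorem bOp_mem_VHom {n m : ℕ} (i : ℕ) {F : VPoly n} (hF : F ∈ VHom n m) :
    bOp n i F ∈ VHom n (m + i) := by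
  refine sum_mem fun x hx => ?_
  rw [← Finset.HasAntidiagonal.mem_antidiagonal.1 hx, add_comm x.1, ← add_assoc]
  exact smul_mem_VHom (isHomogeneous_charCoeff n _) (transferOp_mem_VHom _ hF)

theorem creVec_mem_VHom {n : ℕ} (k : ℕ) (a : Fin k → ℕ) :
    creVec k (fun i s => (MvPolynomial.X s : MvPolynomial (Fin n) ℂ) ^ a i) ∈
      VHom n (∑ i, a i) := by
  induction k with
  | zero =>
    intro J
    have h : creVec 0 (fun i s => (MvPolynomial.X s : MvPolynomial (Fin n) ℂ) ^ a i) =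
        Pi.single (fun _ => 0) 1 := by simp [creVec]
    rw [h, Finset.univ_eq_empty, Finset.sum_empty]
    by_cases hJ : J = fun _ => 0
    · subst hJ; simpa using MvPolynomial.isHomogeneous_one _ _
    · rw [Pi.single_eq_of_ne hJ]; exact MvPolynomial.isHomogeneous_zero _ _ _
  | succ k ih =>
    rw [creVec_succ, Fin.sum_univ_succ, add_comm]
    exact creOp_mem_VHom _ (ih fun i => a i.succ)

theorem uvec_mem_VHom (n l : ℕ) : uvec n l ∈ VHom n (l * (l + 1) / 2) := by
  have h := annOp_mem_VHom 0 (creVec_mem_VHom (n := n) (l + 1) fun i => (i : ℕ))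
  have hs : ∑ i : Fin (l + 1), (i : ℕ) = l * (l + 1) / 2 := by
    rw [Fin.sum_univ_eq_sum_range (fun i => i), Finset.sum_range_id, Nat.add_sub_cancel, mul_comm]
  rw [hs, add_zero] at h
  rw [uvec_eq]
  simpa using h

/-! ### The Bethe algebra -/

/-- A subalgebra of `𝓞_l` that contains the elements `G_i` and `Σ_j` is everything. -/
theorem eq_top_of_generators {n l : ℕ} (hl : l < n) (A : Subalgebra ℂ (O n l))
    (hG : ∀ i, 1 ≤ i → i + 2 ≤ n → GO n l i ∈ A)
    (hS : ∀ j, 1 ≤ j → j ≤ n → SigmaO n l j ∈ A) : A = ⊤ := by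
  rw [eq_top_iff, ← MvPolynomial.adjoin_range_X]
  refine Algebra.adjoin_le ?_
  rintro _ ⟨i, rfl⟩
  -- The grading is forgotten by taking the same subspace in every degree.
  exact mem_of_generators hl (fun _ => Subalgebra.toSubmodule A) A.one_mem
    (fun _ _ _ _ hx hy => A.mul_mem hx hy) hG hS
    (MvPolynomial.isWeightedHomogeneous_X ℂ (OWeight n l) i)

/-- The operator on `𝓜_l` given by an element of the Bethe algebra. -/
def actM {n l : ℕ} {b : CurrentU} (hb : b ∈ bethe) : betheM n l :=
  ⟨(act n b).restrict (act_bethe_mem_M hb), b, hb, fun _ => rfl⟩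

theorem coeff_transferSer_mem_bethe (m : ℕ) : PowerSeries.coeff m transferSer ∈ bethe := by
  rcases Nat.lt_or_ge m 2 with hm | hm
  · rw [coeff_transferSer_of_lt m hm]; exact zero_mem _
  · obtain ⟨m, rfl⟩ := Nat.exists_eq_add_of_le' hm
    rw [bethe_eq]
    exact Algebra.subset_adjoin (Or.inr ⟨m, rfl⟩)

theorem B_mem_bethe {n : ℕ} {C : ℕ → CurrentU} (hC : ∀ j, C j ∈ bethe) (i : ℕ) :
    B n C i ∈ bethe := by
  rw [B, PowerSeries.coeff_mul]
  refine sum_mem fun x _ => mul_mem ?_ (coeff_transferSer_mem_bethe _)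
  rw [centralSer, map_add, map_sum]
  refine add_mem ?_ (sum_mem fun k _ => ?_)
  · rw [PowerSeries.coeff_one]
    split_ifs
    · exact one_mem _
    · exact zero_mem _
  · rw [PowerSeries.coeff_monomial]
    split_ifs
    · exact Subalgebra.smul_mem _ (hC k) _
    · exact zero_mem _

namespace BetheField

variable {K : Type*} [Field K] [Algebra ℂ K] {n l : ℕ} (D : BetheField n l K)

/-- The functional on `𝓜_l` attached to the roots of `f`. -/
def tau : M n l →ₗ[ℂ] K where
  toFun v := D.chi Sum.inl v
  map_add' v w := D.chi_add _ _ _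
  map_smul' c v := by
    have h : ((c • v : M n l) : VPoly n) = (MvPolynomial.C c : MvPolynomial (Fin n) ℂ) •
        (v : VPoly n) := by
      funext J
      simp [MvPolynomial.smul_eq_C_mul]
    rw [h, chi_smul, RingHom.id_apply, Algebra.smul_def]
    congr 1
    exact D.ev.commutes c

theorem tau_injective (hl : l < n) : Function.Injective D.tau := by
  rw [injective_iff_map_eq_zero]
  intro v hv
  exact Subtype.ext (D.eq_zero_of_chi_inl hl v.2 hv)

/-- The embedding of `𝓞_l` into the field. -/
def emb : O n l →ₐ[ℂ] K := D.φ.comp (rootHom n l)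

theorem emb_injective (hl : l < n) : Function.Injective D.emb :=
  D.injective.comp (rootHom_injective hl)

/-- The cyclic vector. -/
def uM (n l : ℕ) : M n l := ⟨uvec n l, uvec_mem_M n l⟩

theorem tau_uM (hl : l < n) :
    D.tau (uM n l) = algebraMap ℂ K ((n : ℂ) * (-(n : ℂ)) ^ l) * D.delta := by
  have := D.chi_uvec hl
  rw [tau, LinearMap.coe_mk, AddHom.coe_mk, uM, this]
  simp [mul_assoc]

theorem cyclic_const_ne_zero (hl : l < n) : (n : ℂ) * (-(n : ℂ)) ^ l ≠ 0 := by
  have hn : (n : ℂ) ≠ 0 := Nat.cast_ne_zero.2 (by omega)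
  exact mul_ne_zero hn (pow_ne_zero _ (neg_ne_zero.2 hn))

theorem tau_uM_ne_zero (hl : l < n) : D.tau (uM n l) ≠ 0 := by
  rw [D.tau_uM hl]
  exact mul_ne_zero ((map_ne_zero _).2 (cyclic_const_ne_zero hl)) D.delta_ne_zero

/-- Every value of `tau` is an element of `𝓞_l` times the Vandermonde product, and the value on the
cyclic vector is a nonzero scalar times that product. This is the cyclicity of `𝓜_l`. -/
theorem exists_tau_eq (hl : l < n) (v : M n l) : ∃ H : O n l, D.tau v = D.emb H * D.tau (uM n l) := by
  obtain ⟨H, hH⟩ := D.exists_chi_inl_eq hl (mem_M_iff.1 v.2).1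
  have hc := cyclic_const_ne_zero hl
  refine ⟨((n : ℂ) * (-(n : ℂ)) ^ l)⁻¹ • H, ?_⟩
  rw [map_smul, Algebra.smul_def, D.tau_uM hl, map_inv₀]
  have hc' : algebraMap ℂ K ((n : ℂ) * (-(n : ℂ)) ^ l) ≠ 0 := (map_ne_zero _).2 hc
  field_simp
  rw [mul_comm]
  exact hH

theorem betheM_ext (hl : l < n) {S T : betheM n l}
    (h : ∀ v, D.tau ((S : Module.End ℂ (M n l)) v) = D.tau ((T : Module.End ℂ (M n l)) v)) :
    S = T :=
  Subtype.ext (LinearMap.ext fun v => D.tau_injective hl (h v))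

/-- An element of the Bethe algebra acts on `tau` by a scalar as soon as its generators do; for
products this uses that `𝓜_l` is preserved. -/
theorem exists_eigenvalue (hl : l < n) {b : CurrentU} (hb : b ∈ bethe) :
    ∃ μ : K, ∀ v ∈ M n l, D.chi Sum.inl (act n b v) = μ * D.chi Sum.inl v := by
  rw [bethe_eq] at hb
  induction hb using Algebra.adjoin_induction with
  | mem x hx =>
    rcases hx with ⟨r, rfl⟩ | ⟨m, rfl⟩
    · refine ⟨D.ev (MvPolynomial.psum (Fin n) ℂ r), fun v _ => ?_⟩
      rw [act_diag, chi_smul]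
    · refine ⟨∑ j : Fin l, D.lam m (Sum.inl j), fun v _ => ?_⟩
      rw [act_coeff_transferSer, D.chi_transferOp hl]
  | algebraMap r =>
    refine ⟨algebraMap ℂ K r, fun v hv => ?_⟩
    have h := D.tau.map_smul r ⟨v, hv⟩
    rw [AlgHom.commutes, Module.algebraMap_end_apply]
    rw [Algebra.smul_def] at h
    exact h
  | add x y _ _ hx hy =>
    obtain ⟨μ, hμ⟩ := hx
    obtain ⟨ν, hν⟩ := hy
    refine ⟨μ + ν, fun v hv => ?_⟩
    rw [map_add, LinearMap.add_apply, chi_add, hμ v hv, hν v hv, add_mul]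
  | mul x y _ hy' hx hy =>
    obtain ⟨μ, hμ⟩ := hx
    obtain ⟨ν, hν⟩ := hy
    rw [← bethe_eq] at hy'
    refine ⟨μ * ν, fun v hv => ?_⟩
    rw [map_mul, Module.End.mul_apply, hμ _ (act_bethe_mem_M hy' v hv), hν v hv, mul_assoc]

/-- Every element of `𝓑_l` is diagonalized with an eigenvalue in `𝓞_l`. -/
theorem exists_emb_of_betheM (hl : l < n) (T : betheM n l) :
    ∃ H : O n l, ∀ v, D.tau ((T : Module.End ℂ (M n l)) v) = D.emb H * D.tau v := by
  obtain ⟨b, hb, hT⟩ := T.2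
  obtain ⟨μ, hμ⟩ := D.exists_eigenvalue hl hb
  have h : ∀ v, D.tau ((T : Module.End ℂ (M n l)) v) = μ * D.tau v := by
    intro v
    have := hμ v v.2
    rw [← hT] at this
    exact this
  -- A priori the eigenvalue is only in `K`. Its value on the cyclic vector shows that it comes from
  -- `𝓞_l`.
  obtain ⟨H, hH⟩ := D.exists_tau_eq hl ((T : Module.End ℂ (M n l)) (uM n l))
  rw [h] at hH
  refine ⟨H, fun v => ?_⟩
  rw [h, mul_right_cancel₀ (D.tau_uM_ne_zero hl) hH]

theorem tau_actM {b : CurrentU} (hb : b ∈ bethe) (v : M n l) :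
    D.tau (((actM hb : betheM n l) : Module.End ℂ (M n l)) v) = D.chi Sum.inl (act n b v) := rfl

/-- Every element of `𝓞_l` is the eigenvalue of an element of `𝓑_l`. -/
theorem exists_betheM_of_emb (hl : l < n) (H : O n l) : ∃ T : betheM n l,
    ∀ v, D.tau ((T : Module.End ℂ (M n l)) v) = D.emb H * D.tau v := by
  let A : Subalgebra ℂ (O n l) :=
    { carrier := {H | ∃ T : betheM n l,
        ∀ v, D.tau ((T : Module.End ℂ (M n l)) v) = D.emb H * D.tau v}
      mul_mem' := by
        rintro H H' ⟨T, hT⟩ ⟨T', hT'⟩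
        refine ⟨T * T', fun v => ?_⟩
        rw [Subalgebra.coe_mul, Module.End.mul_apply, hT, hT', map_mul, mul_assoc]
      add_mem' := by
        rintro H H' ⟨T, hT⟩ ⟨T', hT'⟩
        refine ⟨T + T', fun v => ?_⟩
        rw [Subalgebra.coe_add, LinearMap.add_apply, map_add, hT, hT', map_add, add_mul]
      algebraMap_mem' := fun c => by
        refine ⟨algebraMap ℂ _ c, fun v => ?_⟩
        rw [Subalgebra.coe_algebraMap, Module.algebraMap_end_apply, map_smul, AlgHom.commutes,
          Algebra.smul_def] }
  -- A lift inside the Bethe algebra is chosen, so that the elements `B_i` and `C_j` define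
  -- operators in `𝓑_l`.
  obtain ⟨C, hC, hCb⟩ := exists_centralLift n
  have hA : A = ⊤ := by
    refine eq_top_of_generators hl A (fun i _ hi => ?_) fun j hj hjn => ?_
    · refine ⟨actM (B_mem_bethe (n := n) hCb (i + 2)), fun v => ?_⟩
      rw [tau_actM, act_B hC i (mem_M_iff.1 v.2).1, D.chi_bOp hl hi]
      rfl
    · refine ⟨actM (hCb j), fun v => ?_⟩
      rw [tau_actM, (hC j hj hjn).2 v (mem_M_iff.1 v.2).1, chi_smul, D.ev_esymm hj hjn]
      rfl
  have : H ∈ A := by rw [hA]; trivial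
  exact this

end BetheField

/-- The isomorphism `η_l`, characterized by its eigenvalues. -/
theorem exists_eta {K : Type*} [Field K] [Algebra ℂ K] {n l : ℕ} (D : BetheField n l K)
    (hl : l < n) : ∃ η : O n l ≃ₐ[ℂ] betheM n l,
      ∀ H v, D.tau ((η H : Module.End ℂ (M n l)) v) = D.emb H * D.tau v := by
  choose f hf using D.exists_betheM_of_emb hl
  let η₀ : O n l →ₐ[ℂ] betheM n l :=
    { toFun := f
      map_one' := D.betheM_ext hl fun v => by
        rw [hf, map_one, one_mul]; rfl
      map_mul' := fun H H' => D.betheM_ext hl fun v => by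
        rw [hf, Subalgebra.coe_mul, Module.End.mul_apply, hf, hf, map_mul, mul_assoc]
      map_zero' := D.betheM_ext hl fun v => by
        rw [hf, map_zero, zero_mul]
        exact (map_zero D.tau).symm
      map_add' := fun H H' => D.betheM_ext hl fun v => by
        rw [hf, Subalgebra.coe_add, LinearMap.add_apply, map_add, map_add, hf, hf, add_mul]
      commutes' := fun c => D.betheM_ext hl fun v => by
        rw [hf, Subalgebra.coe_algebraMap, Module.algebraMap_end_apply, map_smul, AlgHom.commutes,
          Algebra.smul_def] }
  have hη : ∀ H v, D.tau ((η₀ H : Module.End ℂ (M n l)) v) = D.emb H * D.tau v := hf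
  refine ⟨AlgEquiv.ofBijective η₀ ⟨?_, fun T => ?_⟩, hη⟩
  · rw [injective_iff_map_eq_zero]
    intro H hH
    have h := hη H (BetheField.uM n l)
    rw [hH] at h
    have h0 : D.tau (((0 : betheM n l) : Module.End ℂ (M n l)) (BetheField.uM n l)) = 0 :=
      map_zero D.tau
    rw [h0] at h
    have := (mul_eq_zero.1 h.symm).resolve_right (D.tau_uM_ne_zero hl)
    exact (map_eq_zero_iff _ (D.emb_injective hl)).1 this
  · obtain ⟨H, hH⟩ := D.exists_emb_of_betheM hl T
    exact ⟨H, D.betheM_ext hl fun v => by rw [hη, hH]⟩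

/-! ### Gradings -/

/-- A linear map that shifts degrees by `N` intertwines the homogeneous components. -/
theorem homogeneousComponent_apply {n l N : ℕ} (ρ : O n l →ₗ[ℂ] VPoly n)
    (hρ : ∀ d F, MvPolynomial.IsWeightedHomogeneous (OWeight n l) F d → ρ F ∈ VHom n (d + N))
    (d : ℕ) (F : O n l) (J : Fin n → Fin 2) :
    MvPolynomial.homogeneousComponent (d + N) (ρ F J) =
      ρ (MvPolynomial.weightedHomogeneousComponent (OWeight n l) d F) J := by
  induction F using MvPolynomial.induction_on' with
  | monomial m a =>
    have h := MvPolynomial.isWeightedHomogeneous_monomial (OWeight n l) m a rfl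
    rw [MvPolynomial.homogeneousComponent_of_mem (hρ _ _ h J),
      MvPolynomial.weightedHomogeneousComponent_of_mem h]
    by_cases hd : d = Finsupp.weight (OWeight n l) m
    · rw [if_pos hd, if_pos (by rw [hd])]
    · rw [if_neg hd, if_neg (fun h' => hd (by omega)), map_zero, Pi.zero_apply]
  | add p q hp hq => rw [map_add, map_add, map_add, Pi.add_apply, map_add, hp, hq, Pi.add_apply]

/-- A map that shifts degrees by a constant commutes with taking components, so a nonzero component
in another degree would survive in the image by injectivity. -/
theorem isWeightedHomogeneous_iff_mem_VHom {n l N : ℕ} (ρ : O n l →ₗ[ℂ] VPoly n)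
    (hinj : Function.Injective ρ)
    (hρ : ∀ d F, MvPolynomial.IsWeightedHomogeneous (OWeight n l) F d → ρ F ∈ VHom n (d + N))
    (d : ℕ) (F : O n l) :
    MvPolynomial.IsWeightedHomogeneous (OWeight n l) F d ↔ ρ F ∈ VHom n (d + N) := by
  refine ⟨hρ d F, fun h m hm => ?_⟩
  by_contra hne
  have h0 : MvPolynomial.weightedHomogeneousComponent (OWeight n l)
      (Finsupp.weight (OWeight n l) m) F = 0 := by
    refine hinj (funext fun J => ?_)
    rw [← homogeneousComponent_apply ρ hρ, MvPolynomial.homogeneousComponent_of_mem (h J),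
      if_neg (by omega), map_zero, Pi.zero_apply]
  have h1 := congrArg (MvPolynomial.coeff m) h0
  rw [MvPolynomial.coeff_weightedHomogeneousComponent, if_pos rfl, MvPolynomial.coeff_zero] at h1
  exact hm h1

/-! ### Properties of `η_l` and `ρ_l` -/

section Eta

variable {K : Type*} [Field K] [Algebra ℂ K] {n l : ℕ} {D : BetheField n l K}
  {η : O n l ≃ₐ[ℂ] betheM n l}

theorem eta_GO (hl : l < n)
    (hη : ∀ H v, D.tau ((η H : Module.End ℂ (M n l)) v) = D.emb H * D.tau v)
    {i : ℕ} (hi : i + 2 ≤ n) (v : M n l) :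
    (((η (GO n l i) : Module.End ℂ (M n l)) v : M n l) : VPoly n) = bOp n i v := by
  have : (η (GO n l i) : Module.End ℂ (M n l)) v = ⟨bOp n i v, bOp_mem_M i v.2⟩ := by
    refine D.tau_injective hl ?_
    rw [hη]
    exact (D.chi_bOp hl hi v).symm
  rw [this]

theorem eta_SigmaO (hl : l < n)
    (hη : ∀ H v, D.tau ((η H : Module.End ℂ (M n l)) v) = D.emb H * D.tau v)
    {j : ℕ} (hj : 1 ≤ j) (hjn : j ≤ n) (v : M n l) :
    (((η (SigmaO n l j) : Module.End ℂ (M n l)) v : M n l) : VPoly n) =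
      MvPolynomial.esymm (Fin n) ℂ j • (v : VPoly n) := by
  have : (η (SigmaO n l j) : Module.End ℂ (M n l)) v = ⟨MvPolynomial.esymm (Fin n) ℂ j • (v : VPoly n),
      smul_mem_M (MvPolynomial.esymm_isSymmetric _ _ _) v.2⟩ := by
    refine D.tau_injective hl ?_
    rw [hη]
    refine Eq.trans ?_ (D.chi_smul Sum.inl _ _).symm
    rw [D.ev_esymm hj hjn]
    rfl
  rw [this]

theorem eta_symToO (hl : l < n)
    (hη : ∀ H v, D.tau ((η H : Module.End ℂ (M n l)) v) = D.emb H * D.tau v)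
    (p : MvPolynomial.symmetricSubalgebra (Fin n) ℂ) (F : O n l) (v : M n l) :
    (((η (symToO n l p * F) : Module.End ℂ (M n l)) v : M n l) : VPoly n) =
      (p : MvPolynomial (Fin n) ℂ) • (((η F : Module.End ℂ (M n l)) v : M n l) : VPoly n) := by
  have : (η (symToO n l p * F) : Module.End ℂ (M n l)) v =
      ⟨(p : MvPolynomial (Fin n) ℂ) • (((η F : Module.End ℂ (M n l)) v : M n l) : VPoly n),
        smul_mem_M p.2 ((η F : Module.End ℂ (M n l)) v).2⟩ := by
    refine D.tau_injective hl ?_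
    rw [hη, map_mul, mul_assoc, ← hη]
    refine Eq.trans ?_ (D.chi_smul Sum.inl _ _).symm
    rw [D.ev_symToO]
    rfl
  rw [this]

/-- The operators of degree `d` form a multiplicative family of subspaces, so only `B_{i+2}` and the
multiplications by `σ_j` have to be examined. -/
theorem endHasDegree_eta (hl : l < n)
    (hη : ∀ H v, D.tau ((η H : Module.End ℂ (M n l)) v) = D.emb H * D.tau v)
    {d : ℕ} {F : O n l} (hF : MvPolynomial.IsWeightedHomogeneous (OWeight n l) F d) :
    EndHasDegree n l d (η F : Module.End ℂ (M n l)) := by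
  let A : ℕ → Submodule ℂ (O n l) := fun d =>
    { carrier := {F | EndHasDegree n l d (η F : Module.End ℂ (M n l))}
      add_mem' := by
        intro F G hF hG m v hv
        rw [map_add, Subalgebra.coe_add, LinearMap.add_apply, Submodule.coe_add]
        exact add_mem (hF m v hv) (hG m v hv)
      zero_mem' := by
        intro m v _
        rw [map_zero]
        exact zero_mem (VHom n (m + d))
      smul_mem' := by
        intro c F hF m v hv
        rw [map_smul, Subalgebra.coe_smul, LinearMap.smul_apply, Submodule.coe_smul]
        exact (VHom n (m + d)).smul_mem c (hF m v hv) }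
  refine mem_of_generators hl A ?_ ?_ ?_ ?_ hF
  · intro m v hv
    rw [map_one]
    exact hv
  · intro c d F G hF hG m v hv
    rw [map_mul, Subalgebra.coe_mul, Module.End.mul_apply]
    have := hF _ _ (hG m v hv)
    rwa [add_assoc, add_comm d c] at this
  · intro i _ hi m v hv
    rw [eta_GO hl hη hi]
    exact bOp_mem_VHom i hv
  · intro j hj hjn m v hv
    rw [eta_SigmaO hl hη hj hjn]
    exact smul_mem_VHom (isHomogeneous_esymm n j) hv

/-- The isomorphism is built without reference to `C`. Any central lift will do, since only its
action on `𝒱^𝔖` enters. -/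
theorem sendsGenerators_eta (hl : l < n)
    (hη : ∀ H v, D.tau ((η H : Module.End ℂ (M n l)) v) = D.emb H * D.tau v)
    {C : ℕ → CurrentU} (hC : IsCentralLift n C) : SendsGenerators n l C η.toAlgHom := by
  refine ⟨fun i _ hi v => ?_, fun j hj hjn v => ?_⟩
  · rw [act_B hC i (mem_M_iff.1 v.2).1]
    exact eta_GO hl hη hi v
  · rw [(hC j hj hjn).2 v (mem_M_iff.1 v.2).1]
    exact eta_SigmaO hl hη hj hjn v

/-- A homomorphism is determined by the images of the elements `G_i` and `Σ_j`. -/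
theorem sendsGenerators_unique (hl : l < n) {C : ℕ → CurrentU} {η₁ η₂ : O n l →ₐ[ℂ] betheM n l}
    (h₁ : SendsGenerators n l C η₁) (h₂ : SendsGenerators n l C η₂) : η₁ = η₂ := by
  have h := eq_top_of_generators hl (AlgHom.equalizer η₁ η₂)
    (fun i hi hin => Subtype.ext (LinearMap.ext fun v => Subtype.ext
      ((h₁.1 i hi hin v).trans (h₂.1 i hi hin v).symm)))
    (fun j hj hjn => Subtype.ext (LinearMap.ext fun v => Subtype.ext
      ((h₁.2 j hj hjn v).trans (h₂.2 j hj hjn v).symm)))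
  refine AlgHom.ext fun F => ?_
  have : F ∈ AlgHom.equalizer η₁ η₂ := by rw [h]; trivial
  exact this

theorem exists_rho (hl : l < n)
    (hη : ∀ H v, D.tau ((η H : Module.End ℂ (M n l)) v) = D.emb H * D.tau v) :
    ∃ ρ : O n l ≃ₗ[ℂ] M n l,
      ∀ F, ρ F = (η F : Module.End ℂ (M n l)) ⟨uvec n l, uvec_mem_M n l⟩ := by
  let ρ₀ : O n l →ₗ[ℂ] M n l :=
    (LinearMap.applyₗ (BetheField.uM n l)).comp
      ((betheM n l).val.toLinearMap.comp η.toAlgHom.toLinearMap)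
  have hρ : ∀ F, ρ₀ F = (η F : Module.End ℂ (M n l)) (BetheField.uM n l) := fun _ => rfl
  refine ⟨LinearEquiv.ofBijective ρ₀ ⟨?_, fun v => ?_⟩, hρ⟩
  · rw [injective_iff_map_eq_zero]
    intro F hF
    have h := hη F (BetheField.uM n l)
    rw [← hρ, hF, map_zero] at h
    exact (map_eq_zero_iff _ (D.emb_injective hl)).1
      ((mul_eq_zero.1 h.symm).resolve_right (D.tau_uM_ne_zero hl))
  · obtain ⟨H, hH⟩ := D.exists_tau_eq hl v
    exact ⟨H, D.tau_injective hl (by rw [hρ, hη, hH])⟩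

end Eta

end Gaudin

end

theorem theorem4p5 (n l : ℕ) (hl : l < n) :
    (∀ b ∈ Gaudin.bethe, ∀ v ∈ Gaudin.M n l, Gaudin.act n b v ∈ Gaudin.M n l) ∧
    (∃ C : ℕ → Gaudin.CurrentU, Gaudin.IsCentralLift n C) ∧
    ∀ C : ℕ → Gaudin.CurrentU, Gaudin.IsCentralLift n C →
      ∃ η : Gaudin.O n l ≃ₐ[ℂ] Gaudin.betheM n l,
        Gaudin.SendsGenerators n l C η.toAlgHom ∧
        (∀ η' : Gaudin.O n l →ₐ[ℂ] Gaudin.betheM n l,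
          Gaudin.SendsGenerators n l C η' → η' = η.toAlgHom) ∧
        (∀ (d : ℕ) (F : Gaudin.O n l),
          MvPolynomial.IsWeightedHomogeneous (Gaudin.OWeight n l) F d ↔
            Gaudin.EndHasDegree n l d (η F : Module.End ℂ (Gaudin.M n l))) ∧
        (∀ (p : MvPolynomial.symmetricSubalgebra (Fin n) ℂ) (F : Gaudin.O n l)
            (v : Gaudin.M n l),
          (((η (Gaudin.symToO n l p * F) : Module.End ℂ (Gaudin.M n l)) v : Gaudin.M n l) :
              Gaudin.VPoly n) =
            (p : MvPolynomial (Fin n) ℂ) •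
              (((η F : Module.End ℂ (Gaudin.M n l)) v : Gaudin.M n l) : Gaudin.VPoly n)) ∧
        ∃ (hu : Gaudin.uvec n l ∈ Gaudin.M n l) (ρ : Gaudin.O n l ≃ₗ[ℂ] Gaudin.M n l),
          (∀ F : Gaudin.O n l,
            ρ F = (η F : Module.End ℂ (Gaudin.M n l)) ⟨Gaudin.uvec n l, hu⟩) ∧
          (∀ F H : Gaudin.O n l, ρ (F * H) = (η F : Module.End ℂ (Gaudin.M n l)) (ρ H)) ∧
          (∀ (d : ℕ) (F : Gaudin.O n l),
            MvPolynomial.IsWeightedHomogeneous (Gaudin.OWeight n l) F d ↔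
              (ρ F : Gaudin.VPoly n) ∈ Gaudin.VHom n (d + l * (l + 1) / 2)) := by
  obtain ⟨K, _, _, ⟨D⟩⟩ := Gaudin.exists_betheField n l
  refine ⟨fun b hb => Gaudin.act_bethe_mem_M hb, ?_, fun C hC => ?_⟩
  · obtain ⟨C, hC, -⟩ := Gaudin.exists_centralLift n
    exact ⟨C, hC⟩
  obtain ⟨η, hη⟩ := Gaudin.exists_eta D hl
  obtain ⟨ρ, hρ⟩ := Gaudin.exists_rho hl hη
  have hdeg : ∀ (d : ℕ) (F : Gaudin.O n l),
      MvPolynomial.IsWeightedHomogeneous (Gaudin.OWeight n l) F d ↔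
        (ρ F : Gaudin.VPoly n) ∈ Gaudin.VHom n (d + l * (l + 1) / 2) := by
    refine Gaudin.isWeightedHomogeneous_iff_mem_VHom
      ((Gaudin.M n l).subtype.comp ρ.toLinearMap)
      (Subtype.val_injective.comp ρ.injective) fun d F hF => ?_
    have h := Gaudin.endHasDegree_eta hl hη hF _
      ⟨Gaudin.uvec n l, Gaudin.uvec_mem_M n l⟩ (Gaudin.uvec_mem_VHom n l)
    rw [← hρ, add_comm] at h
    exact h
  have hgen := Gaudin.sendsGenerators_eta hl hη hC
  refine ⟨η, hgen, fun η' h' => Gaudin.sendsGenerators_unique hl h' hgen, fun d F =>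
    ⟨Gaudin.endHasDegree_eta hl hη, fun h => ?_⟩, Gaudin.eta_symToO hl hη,
    Gaudin.uvec_mem_M n l, ρ, hρ, fun F H => ?_, hdeg⟩
  -- The converse for degrees of operators is tested on the cyclic vector, where `ρ` already detects
  -- them.
  · have h1 := h _ ⟨Gaudin.uvec n l, Gaudin.uvec_mem_M n l⟩ (Gaudin.uvec_mem_VHom n l)
    rw [hdeg, hρ, add_comm d]
    exact h1
  · rw [hρ, hρ, map_mul, Subalgebra.coe_mul, Module.End.mul_apply]
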